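/- Let $n\in\mathbb{N}$, $T>0$, $b>0$, $A\in\mathbb{R}^{n\times n}$ and $x_d\in L^2(0,T;\mathbb{R}^n)$. Let $f:\mathbb{R}^n\to\mathbb{R}^n$ be continuously differentiable such that, for some $\lambda>0$, $\langle (Df(x)+\lambda I)v,v\rangle\ge 0$ for all $x,v\in\mathbb{R}^n$; let $g\in L^2(0,T;\mathbb{R}^n)$, and let $\varphi\in H^1(-b,0;\mathbb{R}^n)$ (identified with its continuous representative). For $\tau\in[0,b]$ consider the delay equation $$\dot x(t)+f(x(t))=A\,x(t-\tau)+g(t)\ \text{ in }(0,T),\qquad x(t)=\varphi(t)\ \text{ in }[-b,0],$$ a solution of which is a function $x\in C([-b,T];\mathbb{R}^n)$ with $x|_{[0,T]}\in H^1(0,T;\mathbb{R}^n)$ and $x=\varphi$ on $[-b,0]$ that satisfies the differential equation a.e. in $(0,T)$. Then for each $\tau\in[0,b]$ there is exactly one solution, denoted by $x[\tau]$. Set $$j(\tau)=\frac12\int_0^T|x[\tau](t)-x_d(t)|^2\,dt,\qquad \tau\in[0,b].$$ Derivatives of $j$ are taken on $[0,b]$ (one-sided at the end points). Then $j\in C^1[0,b]$,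 the problem $\min_{\tau\in[0,b]}j(\tau)$ has a solution, and every solution $\bar\tau$ satisfies $$j'(\bar\tau)(\tau-\bar\tau)\ge 0\quad\text{for all }\tau\in[0,b].$$ If moreover $f\in C^2(\mathbb{R}^n,\mathbb{R}^n)$, $\varphi\in H^2(-b,0;\mathbb{R}^n)$ and $g\in H^1(0,T;\mathbb{R}^n)$, then $j\in C^2[0,b]$, and each of the following conditions is sufficient for $\hat\tau$ to be a strict local minimizer of $j$ on $[0,b]$ (that is, for some $\varepsilon>0$, $j(\hat\tau)<j(\tau)$ for all $\tau\in[0,b]$ with $0<|\tau-\hat\tau|<\varepsilon$): (i) $0<\hat\tau<b$, $j'(\hat\tau)=0$ and $j''(\hat\tau)>0$; (ii) $\hat\tau=0$ and $j'(0)>0$, or $\hat\tau=b$ and $j'(b)<0$. -/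

import Mathlib

open Set Filter Topology MeasureTheory
open scoped ContDiff

noncomputable section

/-- The function `v` is the weak derivative of `u` on the open interval `(a, c)`:
`∫ ψ' u = - ∫ ψ v` for all test functions `ψ` of class `C_c^∞(a, c)`. -/
def HasWeakDerivOn {n : ℕ} (a c : ℝ) (u v : ℝ → EuclideanSpace ℝ (Fin n)) : Prop :=
  ∀ ψ : ℝ → ℝ, ContDiff ℝ ∞ ψ → HasCompactSupport ψ → tsupport ψ ⊆ Ioo a c →
    ∫ t in Ioo a c, deriv ψ t • u t = - ∫ t in Ioo a c, ψ t • v t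

/-- `u` belongs to `L²(a, c; ℝⁿ)`. -/
def IsL2 {n : ℕ} (a c : ℝ) (u : ℝ → EuclideanSpace ℝ (Fin n)) : Prop :=
  MemLp u 2 (volume.restrict (Ioo a c))

/-- `u` is a representative of an element of `H¹(a, c; ℝⁿ)`. -/
def IsH1 {n : ℕ} (a c : ℝ) (u : ℝ → EuclideanSpace ℝ (Fin n)) : Prop :=
  IsL2 a c u ∧ ∃ v : ℝ → EuclideanSpace ℝ (Fin n), IsL2 a c v ∧ HasWeakDerivOn a c u v

/-- `u` is a representative of an element of `H²(a, c; ℝⁿ)`. -/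
def IsH2 {n : ℕ} (a c : ℝ) (u : ℝ → EuclideanSpace ℝ (Fin n)) : Prop :=
  IsL2 a c u ∧ ∃ v : ℝ → EuclideanSpace ℝ (Fin n), IsH1 a c v ∧ HasWeakDerivOn a c u v

/-- The standing assumption on the data: `f` is `C¹` and, for some `lam > 0`, the (in general
nonsymmetric) matrix `Df(x) + lam I` is positive semi-definite, i.e. its quadratic form is
nonnegative, for all `x`; `g ∈ L²(0, T; ℝⁿ)`; and `φ ∈ H¹(-b, 0; ℝⁿ)`, where `φ` is taken to be
the continuous representative, since its point values enter the delay equation. -/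
structure StandingAssumption {n : ℕ} (b T : ℝ)
    (f : EuclideanSpace ℝ (Fin n) → EuclideanSpace ℝ (Fin n))
    (g φ : ℝ → EuclideanSpace ℝ (Fin n)) : Prop where
  contDiff_f : ContDiff ℝ 1 f
  lower_bound : ∃ lam : ℝ, 0 < lam ∧
    ∀ x v : EuclideanSpace ℝ (Fin n), 0 ≤ inner ℝ (fderiv ℝ f x v + lam • v) v
  g_mem : IsL2 0 T g
  φ_mem : IsH1 (-b) 0 φ
  φ_cont : ContinuousOn φ (Icc (-b) 0)

/-- The additional regularity of the data: `f ∈ C²`, `φ ∈ H²(-b, 0; ℝⁿ)`, `g ∈ H¹(0, T; ℝⁿ)`. -/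
structure RegularityAssumption {n : ℕ} (b T : ℝ)
    (f : EuclideanSpace ℝ (Fin n) → EuclideanSpace ℝ (Fin n))
    (g φ : ℝ → EuclideanSpace ℝ (Fin n)) : Prop where
  contDiff_f : ContDiff ℝ 2 f
  φ_mem : IsH2 (-b) 0 φ
  g_mem : IsH1 0 T g

/-- `x` solves `x'(t) + f(x(t)) = A x(t - τ) + g(t)` in `(0, T)`, `x = φ` on `[-b, 0]`:
`x ∈ C([-b, T]; ℝⁿ)`, the restriction of `x` to `[0, T]` is in `H¹(0, T; ℝⁿ)`, `x = φ` on
`[-b, 0]`, and the differential equation holds almost everywhere in `(0, T)` (for the weak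
derivative `v` of `x`). -/
def IsDelaySolution {n : ℕ} (b T : ℝ)
    (f : EuclideanSpace ℝ (Fin n) → EuclideanSpace ℝ (Fin n)) (A : Matrix (Fin n) (Fin n) ℝ)
    (g φ : ℝ → EuclideanSpace ℝ (Fin n)) (τ : ℝ) (x : ℝ → EuclideanSpace ℝ (Fin n)) : Prop :=
  ContinuousOn x (Icc (-b) T) ∧ EqOn x φ (Icc (-b) 0) ∧ IsL2 0 T x ∧
    ∃ v : ℝ → EuclideanSpace ℝ (Fin n), IsL2 0 T v ∧ HasWeakDerivOn 0 T x v ∧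
      ∀ᵐ t ∂(volume.restrict (Ioo 0 T)),
        v t + f (x t) = Matrix.toEuclideanLin A (x (t - τ)) + g t

/-- The state `x[τ]`: the solution of the delay equation with delay `τ` (chosen by Hilbert's
epsilon; its values on `[-b, T]` are determined as soon as the solution exists and is unique). -/
def delayState {n : ℕ} (b T : ℝ)
    (f : EuclideanSpace ℝ (Fin n) → EuclideanSpace ℝ (Fin n)) (A : Matrix (Fin n) (Fin n) ℝ)
    (g φ : ℝ → EuclideanSpace ℝ (Fin n)) (τ : ℝ) : ℝ → EuclideanSpace ℝ (Fin n) :=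
  Classical.epsilon (IsDelaySolution b T f A g φ τ)

/-- The cost `j(τ) = 1/2 ∫₀ᵀ |x[τ](t) - x_d(t)|² dt`. -/
def delayCost {n : ℕ} (b T : ℝ)
    (f : EuclideanSpace ℝ (Fin n) → EuclideanSpace ℝ (Fin n)) (A : Matrix (Fin n) (Fin n) ℝ)
    (g φ xd : ℝ → EuclideanSpace ℝ (Fin n)) (τ : ℝ) : ℝ :=
  (1 / 2 : ℝ) * ∫ t in Ioo 0 T, ‖delayState b T f A g φ τ t - xd t‖ ^ 2

/-- The derivative on `[0, b]` of a function on `[0, b]` (one-sided at the end points). -/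
def derivOn (b : ℝ) (j : ℝ → ℝ) : ℝ → ℝ := derivWithin j (Icc 0 b)

/-- `τ₀` is a strict local minimizer of `j` on `[0, b]`. -/
def IsStrictLocalMinimizerOn (b : ℝ) (j : ℝ → ℝ) (τ₀ : ℝ) : Prop :=
  τ₀ ∈ Icc 0 b ∧ ∃ ε > 0, ∀ τ ∈ Icc 0 b, τ ≠ τ₀ → |τ - τ₀| < ε → j τ₀ < j τ

end

/-!
# Differentiability of a cost functional with respect to the delay

In integrated form the state solves the Volterra equation
`x(t) = φ(0) + ∫₀ᵗ g + ∫₀ᵗ (-f(x(s)) + A x(s - τ)) ds`. Differentiation with respect to `τ` seems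
to require the derivative of `x`, but under the integral sign this derivative can be integrated:
the candidate `y` for `∂x/∂τ` solves
`y(t) = -A (x(t - τ) - φ(-τ)) + ∫₀ᵗ (-Df(x(s)) y(s) + A y(s - τ)) ds`,
an equation of the same type whose inhomogeneity is continuous as soon as `φ` is.

The core of the proof is therefore a statement on delay Volterra equations
`U(t) = R_τ(t) + ∫₀ᵗ (H(U(s)) + A U(s - τ)) ds` in a finite-dimensional space. If the
inhomogeneity `R` is Lipschitz in `τ` and differentiable in `τ` in the norm of `L¹(0, T)`, then so
is `U`, and its derivative is the solution `Z` of the formally differentiated equation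
(`IsDelayFamily.hasL1Deriv`, `IsDelayVariation.isL1Continuous`). Both facts follow from Gronwall's
inequality, since a delay `τ ≥ 0` does not increase `∫₀ᵗ ‖δ‖` when `δ` has zero history. Because the
families are bounded, differentiability in `L¹` suffices to differentiate integrals of `U` against
square integrable functions (`hasDerivWithinAt_integral_of_hasL1Deriv`).

The statement is used twice. With `U = x` and constant `R` it gives
`j'(τ) = ∫ ⟨x - x_d, y⟩` and `j ∈ C¹`. For `j ∈ C²` it is applied to the pair `U = (x, y)`, which
solves a delay equation whose inhomogeneity contains `x(t - τ) - φ(-τ)`. Here `L¹` is the right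
norm: `ẋ` jumps at `t = 0`, hence `∂²x/∂τ²` jumps at `t = τ`, and no uniform convergence of the
difference quotients is available. The additional regularity of the data makes `ẋ` continuous off
that jump (`hasL1Deriv_delayed`, `IsDelayFamily.exists_second_variation`).

Global solvability (`exists_isMildSolution`) follows from an a priori bound that is not destroyed
by a cut-off of `f`, so that `f` may be taken globally Lipschitz. The notion of solution by weak
derivatives is reduced to the integrated equation by the lemma of du Bois-Reymond.
-/

/-! ### Gronwall estimates for integral inequalities -/

theorem le_mul_exp_of_le_add_integral {D : ℝ → ℝ} {R K T : ℝ} (hK : 0 ≤ K) (hD : Continuous D)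
    (h : ∀ t ∈ Icc 0 T, D t ≤ R + K * ∫ s in (0 : ℝ)..t, D s) :
    ∀ t ∈ Icc 0 T, D t ≤ R * Real.exp (K * t) := by
  intro t ht
  set P : ℝ → ℝ := fun t => R + K * ∫ s in (0 : ℝ)..t, D s with hP
  have hP' : ∀ t, HasDerivAt P (K * D t) t := fun t =>
    ((intervalIntegral.integral_hasDerivAt_right (hD.intervalIntegrable _ _)
      (hD.stronglyMeasurableAtFilter _ _) hD.continuousAt).const_mul K).const_add R
  have hE : ∀ t, HasDerivAt (fun t => Real.exp (-(K * t))) (Real.exp (-(K * t)) * -(K * 1)) t :=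
    fun t => (((hasDerivAt_id t).const_mul K).neg).exp
  have hQ := fun t => (hP' t).mul (hE t)
  have hanti : AntitoneOn (fun t => P t * Real.exp (-(K * t))) (Icc 0 T) := by
    refine antitoneOn_of_deriv_nonpos (convex_Icc 0 T)
      (fun t _ => (hQ t).continuousAt.continuousWithinAt)
      (fun t _ => (hQ t).differentiableAt.differentiableWithinAt) fun t ht => ?_
    rw [interior_Icc] at ht
    have h1 : deriv (fun t => P t * Real.exp (-(K * t))) t = _ := (hQ t).deriv
    rw [h1]
    have h2 := mul_le_mul_of_nonneg_left (h t (Ioo_subset_Icc_self ht)) hK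
    have h3 := Real.exp_pos (-(K * t))
    have : K * D t * Real.exp (-(K * t)) + P t * (Real.exp (-(K * t)) * -(K * 1))
      = (K * D t - K * P t) * Real.exp (-(K * t)) := by ring
    rw [this]
    exact mul_nonpos_of_nonpos_of_nonneg (by simp only [hP]; linarith) h3.le
  have h0 : (0 : ℝ) ∈ Icc 0 T := ⟨le_rfl, ht.1.trans ht.2⟩
  have h4 := hanti h0 ht ht.1
  simp only [mul_zero, neg_zero, Real.exp_zero, mul_one] at h4
  have h5 : P 0 = R := by simp [hP]
  rw [h5, Real.exp_neg, ← div_eq_mul_inv, div_le_iff₀ (Real.exp_pos _)] at h4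
  exact (h t ht).trans h4

theorem intervalIntegrable_of_measurable_of_bounded {E : Type*} [NormedAddCommGroup E]
    {u : ℝ → E} (hu : StronglyMeasurable u) {M : ℝ} (hM : ∀ t, ‖u t‖ ≤ M) (a c : ℝ) :
    IntervalIntegrable u volume a c := by
  refine (intervalIntegrable_const (c := M)).mono_fun hu.aestronglyMeasurable ?_
  exact Eventually.of_forall fun t => (hM t).trans (le_abs_self M)

/-- The `L¹` form of Gronwall's inequality: an inhomogeneity that is small in `L¹` only suffices
for the `L¹` smallness of the solution. -/
theorem integral_le_exp_mul_integral {δ ρ : ℝ → ℝ} {K T M : ℝ} (hT : 0 ≤ T) (hK : 0 ≤ K)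
    (hδ : StronglyMeasurable δ) (hM : ∀ t, ‖δ t‖ ≤ M) (hρ : IntervalIntegrable ρ volume 0 T)
    (hρ0 : ∀ t, 0 ≤ ρ t) (h : ∀ t ∈ Ioc 0 T, δ t ≤ ρ t + K * ∫ s in (0 : ℝ)..t, δ s) :
    ∫ t in (0 : ℝ)..T, δ t ≤ (∫ t in (0 : ℝ)..T, ρ t) * Real.exp (K * T) := by
  have hint := intervalIntegrable_of_measurable_of_bounded hδ hM
  have hcont : Continuous fun t => ∫ s in (0 : ℝ)..t, δ s :=
    intervalIntegral.continuous_primitive hint 0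
  refine le_mul_exp_of_le_add_integral hK hcont (fun t ht => ?_) T ⟨hT, le_rfl⟩
  have hρt : IntervalIntegrable ρ volume 0 t :=
    hρ.mono_set (by rw [uIcc_of_le ht.1, uIcc_of_le hT]; exact Icc_subset_Icc_right ht.2)
  have hc : IntervalIntegrable (fun t => K * ∫ s in (0 : ℝ)..t, δ s) volume 0 t :=
    (hcont.const_mul K).intervalIntegrable _ _
  calc ∫ s in (0 : ℝ)..t, δ s ≤ ∫ s in (0 : ℝ)..t, (ρ s + K * ∫ r in (0 : ℝ)..s, δ r) :=
        intervalIntegral.integral_mono_on_of_le_Ioo ht.1 (hint _ _) (hρt.add hc)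
          fun s hs => h s ⟨hs.1, hs.2.le.trans ht.2⟩
    _ = (∫ s in (0 : ℝ)..t, ρ s) + K * ∫ s in (0 : ℝ)..t, ∫ r in (0 : ℝ)..s, δ r := by
        rw [intervalIntegral.integral_add hρt hc, intervalIntegral.integral_const_mul]
    _ ≤ _ := by
        gcongr
        exact intervalIntegral.integral_mono_interval le_rfl ht.1 ht.2
          (Eventually.of_forall hρ0) hρ

theorem integral_comp_sub_le {δ : ℝ → ℝ} {τ t : ℝ} (hτ : 0 ≤ τ)
    (hint : ∀ a c, IntervalIntegrable δ volume a c) (h0 : ∀ s, 0 ≤ δ s)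
    (hneg : ∀ s ≤ 0, δ s = 0) :
    ∫ s in (0 : ℝ)..t, δ (s - τ) ≤ ∫ s in (0 : ℝ)..t, δ s := by
  rw [intervalIntegral.integral_comp_sub_right (fun s => δ s) τ]
  have h1 : ∫ s in (0 - τ)..0, δ s = 0 := by
    have : ∀ s ∈ uIcc (0 - τ) 0, δ s = (fun _ => (0 : ℝ)) s := fun s hs => by
      rw [uIcc_of_le (by linarith)] at hs
      exact hneg s hs.2
    rw [intervalIntegral.integral_congr this]; simp
  rw [← intervalIntegral.integral_add_adjacent_intervals (hint (0 - τ) 0) (hint 0 (t - τ)), h1,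
    zero_add, ← intervalIntegral.integral_add_adjacent_intervals (hint 0 (t - τ)) (hint (t - τ) t)]
  have : 0 ≤ ∫ s in (t - τ)..t, δ s :=
    intervalIntegral.integral_nonneg (by linarith) fun s _ => h0 s
  linarith

theorem integral_comp_sub_sub_comp_sub {E : Type*} [NormedAddCommGroup E] [NormedSpace ℝ E]
    {u : ℝ → E} (hint : ∀ a c, IntervalIntegrable u volume a c) (τ τ' t : ℝ) :
    ∫ s in (0 : ℝ)..t, (u (s - τ') - u (s - τ)) =
      (∫ s in (-τ')..(-τ), u s) - ∫ s in (t - τ')..(t - τ), u s := by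
  have h : ∀ r, IntervalIntegrable (fun s => u (s - r)) volume 0 t := fun r => by
    simpa using (hint (0 - r) (t - r)).comp_sub_right r
  rw [intervalIntegral.integral_sub (h τ') (h τ),
    intervalIntegral.integral_comp_sub_right (fun s => u s) τ,
    intervalIntegral.integral_comp_sub_right (fun s => u s) τ', zero_sub, zero_sub,
    ← intervalIntegral.integral_add_adjacent_intervals (hint (-τ') (-τ)) (hint (-τ) (t - τ')),
    ← intervalIntegral.integral_add_adjacent_intervals (hint (-τ) (t - τ')) (hint (t - τ') (t - τ))]
  abel

theorem norm_integral_comp_sub_sub_comp_sub_le {E : Type*} [NormedAddCommGroup E]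
    [NormedSpace ℝ E] {u : ℝ → E} (hint : ∀ a c, IntervalIntegrable u volume a c) {M : ℝ}
    (hM : ∀ t, ‖u t‖ ≤ M) (τ τ' t : ℝ) :
    ‖∫ s in (0 : ℝ)..t, (u (s - τ') - u (s - τ))‖ ≤ 2 * M * |τ' - τ| := by
  rw [integral_comp_sub_sub_comp_sub hint]
  have h1 := intervalIntegral.norm_integral_le_of_norm_le_const (f := u) (a := -τ') (b := -τ)
    (C := M) fun s _ => hM s
  have h2 := intervalIntegral.norm_integral_le_of_norm_le_const (f := u) (a := t - τ')
    (b := t - τ) (C := M) fun s _ => hM s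
  rw [show -τ - -τ' = τ' - τ by ring] at h1
  rw [show t - τ - (t - τ') = τ' - τ by ring] at h2
  linarith [norm_sub_le (∫ s in (-τ')..(-τ), u s) (∫ s in (t - τ')..(t - τ), u s)]

/-- The shift `τ ↦ ∫₀ᵗ u(s - τ) ds` of a primitive is differentiable, uniformly in `t`, as soon
as `u` is continuous. -/
theorem norm_integral_comp_sub_sub_comp_sub_add_le {E : Type*} [NormedAddCommGroup E]
    [NormedSpace ℝ E] [CompleteSpace E] {u : ℝ → E} (hu : Continuous u) {τ τ' t ε : ℝ}
    (h1 : ∀ r ∈ uIcc (-τ') (-τ), ‖u r - u (-τ)‖ ≤ ε)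
    (h2 : ∀ r ∈ uIcc (t - τ') (t - τ), ‖u r - u (t - τ)‖ ≤ ε) :
    ‖(∫ s in (0 : ℝ)..t, (u (s - τ') - u (s - τ))) + (τ' - τ) • (u (t - τ) - u (-τ))‖
      ≤ 2 * ε * |τ' - τ| := by
  rw [integral_comp_sub_sub_comp_sub fun a c => hu.intervalIntegrable a c]
  have h3 := intervalIntegral.norm_integral_le_of_norm_le_const (f := fun r => u r - u (-τ))
    (a := -τ') (b := -τ) (C := ε) fun s hs => h1 s (uIoc_subset_uIcc hs)
  have h4 := intervalIntegral.norm_integral_le_of_norm_le_const (f := fun r => u r - u (t - τ))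
    (a := t - τ') (b := t - τ) (C := ε) fun s hs => h2 s (uIoc_subset_uIcc hs)
  rw [intervalIntegral.integral_sub (hu.intervalIntegrable _ _) intervalIntegrable_const,
    intervalIntegral.integral_const] at h3 h4
  rw [show -τ - -τ' = τ' - τ by ring] at h3
  rw [show t - τ - (t - τ') = τ' - τ by ring] at h4
  calc _ = ‖((∫ s in (-τ')..(-τ), u s) - (τ' - τ) • u (-τ))
        - ((∫ s in (t - τ')..(t - τ), u s) - (τ' - τ) • u (t - τ))‖ := by
        congr 1; rw [smul_sub]; abel
    _ ≤ _ := by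
        refine (norm_sub_le _ _).trans ?_
        linarith

/-! ### Existence for delay Volterra equations with Lipschitz nonlinearity -/

/-- Existence for a Volterra equation with delay and zero history. In the norm
`sup exp(-μ t) ‖w t‖` with `μ` large the integral operator is a contraction; the proof works with
the rescaled unknown `exp(-μ t) w t` in `C([0, T], V)`. -/
theorem exists_volterra_solution {V : Type*} [NormedAddCommGroup V] [NormedSpace ℝ V]
    [CompleteSpace V] {T τ L : ℝ} (hT : 0 ≤ T) (hτ : 0 ≤ τ) (hL : 0 ≤ L) (K : ℝ → V → V → V)
    (hint : ∀ u : ℝ → V, Continuous u →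
      IntervalIntegrable (fun s => K s (u s) (u (s - τ))) volume 0 T)
    (hlip : ∀ s v v' w w', ‖K s v v' - K s w w'‖ ≤ L * (‖v - w‖ + ‖v' - w'‖)) :
    ∃ w : ℝ → V, Continuous w ∧ (∀ t ≤ 0, w t = 0) ∧ (∀ t ≥ T, w t = w T) ∧
      ∀ t ∈ Icc 0 T, w t = ∫ s in (0 : ℝ)..t, K s (w s) (w (s - τ)) := by
  set μ : ℝ := 4 * L + 1 with hμ
  have hμ0 : 0 < μ := by positivity
  let ext : C(Icc (0 : ℝ) T, V) → ℝ → V := fun ξ s =>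
    Real.exp (μ * (projIcc 0 T hT s : ℝ)) • ξ (projIcc 0 T hT s)
  have hext : ∀ ξ, Continuous (ext ξ) := fun ξ => by
    have := continuous_projIcc (h := hT)
    have h1 : Continuous fun s => ((projIcc 0 T hT s : Icc (0 : ℝ) T) : ℝ) :=
      continuous_subtype_val.comp this
    exact (Real.continuous_exp.comp (h1.const_mul μ)).smul (ξ.continuous.comp this)
  have hI : ∀ ξ, ∀ t ∈ Icc 0 T, IntervalIntegrable
      (fun s => K s (ext ξ s) (ext ξ (s - τ))) volume 0 t := fun ξ t ht =>
    (hint _ (hext ξ)).mono_set (by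
      rw [uIcc_of_le ht.1, uIcc_of_le hT]; exact Icc_subset_Icc_right ht.2)
  have hcont : ∀ ξ, Continuous fun t : Icc (0 : ℝ) T => Real.exp (-(μ * (t : ℝ))) •
      ∫ s in (0 : ℝ)..t, K s (ext ξ s) (ext ξ (s - τ)) := fun ξ => by
    have h1 := intervalIntegral.continuousOn_primitive_interval (μ := volume)
      (f := fun s => K s (ext ξ s) (ext ξ (s - τ))) (a := 0) (b := T)
      ((intervalIntegrable_iff_integrableOn_Icc_of_le hT).1 (hint _ (hext ξ)) |>.mono_set
        (by rw [uIcc_of_le hT]))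
    rw [uIcc_of_le hT] at h1
    exact (Real.continuous_exp.comp (continuous_subtype_val.const_mul μ).neg).smul
      (continuousOn_iff_continuous_domRestrict.1 h1)
  let G : C(Icc (0 : ℝ) T, V) → C(Icc (0 : ℝ) T, V) := fun ξ => ⟨_, hcont ξ⟩
  have hdiff : ∀ ξ η : C(Icc (0 : ℝ) T, V), ∀ r s : ℝ, r ≤ s → 0 ≤ s →
      ‖ext ξ r - ext η r‖ ≤ Real.exp (μ * s) * ‖ξ - η‖ := fun ξ η r s hrs hs => by
    simp only [ext]
    rw [← smul_sub, norm_smul, Real.norm_eq_abs, abs_of_pos (Real.exp_pos _)]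
    have h1 : ((projIcc 0 T hT r : Icc (0 : ℝ) T) : ℝ) ≤ s := by
      rw [coe_projIcc]; exact max_le hs ((min_le_right _ _).trans hrs)
    gcongr
    exact (ξ - η).norm_coe_le_norm _
  have hG : ∀ ξ η, ‖G ξ - G η‖ ≤ 1 / 2 * ‖ξ - η‖ := fun ξ η => by
    refine (ContinuousMap.norm_le _ (by positivity)).2 fun t => ?_
    have ht := t.2
    change ‖Real.exp (-(μ * (t : ℝ))) • (∫ s in (0 : ℝ)..t, K s (ext ξ s) (ext ξ (s - τ))) -
      Real.exp (-(μ * (t : ℝ))) • ∫ s in (0 : ℝ)..t, K s (ext η s) (ext η (s - τ))‖ ≤ _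
    rw [← smul_sub, ← intervalIntegral.integral_sub (hI ξ t ht) (hI η t ht), norm_smul,
      Real.norm_eq_abs, abs_of_pos (Real.exp_pos _)]
    have h1 : ‖∫ s in (0 : ℝ)..t, (K s (ext ξ s) (ext ξ (s - τ)) -
        K s (ext η s) (ext η (s - τ)))‖ ≤
        ∫ s in (0 : ℝ)..t, 2 * L * ‖ξ - η‖ * Real.exp (μ * s) := by
      refine intervalIntegral.norm_integral_le_of_norm_le ht.1
        (Eventually.of_forall fun s hs => ?_)
        ((by fun_prop : Continuous fun s : ℝ => 2 * L * ‖ξ - η‖ * Real.exp (μ * s)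
          ).intervalIntegrable _ _)
      refine (hlip _ _ _ _ _).trans ?_
      have h2 := hdiff ξ η s s le_rfl hs.1.le
      have h3 := hdiff ξ η (s - τ) s (by linarith) hs.1.le
      calc _ ≤ L * (Real.exp (μ * s) * ‖ξ - η‖ + Real.exp (μ * s) * ‖ξ - η‖) := by gcongr
        _ = _ := by ring
    have h2 : ∫ s in (0 : ℝ)..t, 2 * L * ‖ξ - η‖ * Real.exp (μ * s) =
        2 * L * ‖ξ - η‖ * (μ⁻¹ * (Real.exp (μ * t) - 1)) := by
      rw [intervalIntegral.integral_const_mul, intervalIntegral.integral_comp_mul_left _ hμ0.ne']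
      simp
    rw [h2] at h1
    have h4 : 2 * L * μ⁻¹ ≤ 1 / 2 := by
      rw [← div_eq_mul_inv, div_le_iff₀ hμ0, hμ]; linarith
    have h5 : Real.exp (-(μ * (t : ℝ))) * (Real.exp (μ * t) - 1) ≤ 1 := by
      have := Real.exp_pos (-(μ * (t : ℝ)))
      rw [mul_sub, ← Real.exp_add]; simp [this.le]
    have h6 : 0 ≤ Real.exp (μ * t) - 1 := by
      have := Real.one_le_exp (mul_nonneg hμ0.le ht.1); linarith
    calc _ ≤ Real.exp (-(μ * (t : ℝ))) *
          (2 * L * ‖ξ - η‖ * (μ⁻¹ * (Real.exp (μ * t) - 1))) := by gcongr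
      _ = (2 * L * μ⁻¹) * ‖ξ - η‖ * (Real.exp (-(μ * (t : ℝ))) * (Real.exp (μ * t) - 1)) := by
          ring
      _ ≤ (1 / 2) * ‖ξ - η‖ * 1 := by gcongr
      _ = _ := mul_one _
  have hcontr : ContractingWith (1 / 2) G := by
    refine ⟨by norm_num, LipschitzWith.of_dist_le_mul fun ξ η => ?_⟩
    rw [dist_eq_norm, dist_eq_norm]
    simpa using hG ξ η
  obtain ⟨ξ, hξ⟩ : ∃ ξ, G ξ = ξ := ⟨_, hcontr.fixedPoint_isFixedPt⟩
  have heq : ∀ t ∈ Icc 0 T, ext ξ t = ∫ s in (0 : ℝ)..t, K s (ext ξ s) (ext ξ (s - τ)) :=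
    fun t ht => by
      have h1 : ξ ⟨t, ht⟩ = Real.exp (-(μ * t)) •
          ∫ s in (0 : ℝ)..t, K s (ext ξ s) (ext ξ (s - τ)) := by
        conv_lhs => rw [← hξ]
        rfl
      simp only [ext]
      rw [projIcc_of_mem hT ht, h1, smul_smul, ← Real.exp_add]
      simp [ext]
  refine ⟨ext ξ, hext ξ, fun t ht => ?_, fun t ht => ?_, heq⟩
  · have h0 : ext ξ 0 = 0 := by simpa using heq 0 ⟨le_rfl, hT⟩
    rw [← h0]
    simp only [ext]
    rw [projIcc_of_le_left hT ht, projIcc_left hT]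
  · simp only [ext]
    rw [projIcc_of_right_le hT ht, projIcc_right hT]

/-! ### Uniform estimates for `C¹` maps on balls -/

section Modulus
variable {V W : Type*} [NormedAddCommGroup V] [NormedSpace ℝ V] [FiniteDimensional ℝ V]
  [NormedAddCommGroup W] [NormedSpace ℝ W]

theorem exists_lipschitz_on_ball {H : V → W} (hH : ContDiff ℝ 1 H) (M : ℝ) :
    ∃ K, 0 ≤ K ∧ (∀ v, ‖v‖ ≤ M → ‖fderiv ℝ H v‖ ≤ K) ∧
      ∀ v w, ‖v‖ ≤ M → ‖w‖ ≤ M → ‖H w - H v‖ ≤ K * ‖w - v‖ := by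
  have : ProperSpace V := FiniteDimensional.proper ℝ V
  obtain ⟨K, hK⟩ := (isCompact_closedBall (0 : V) M).exists_bound_of_continuousOn
    (hH.continuous_fderiv one_ne_zero).continuousOn
  have hK' : ∀ v, ‖v‖ ≤ M → ‖fderiv ℝ H v‖ ≤ max K 0 := fun v hv =>
    (hK v (by simpa using hv)).trans (le_max_left _ _)
  refine ⟨max K 0, le_max_right _ _, hK', fun v w hv hw => ?_⟩
  exact (convex_closedBall (0 : V) M).norm_image_sub_le_of_norm_fderiv_le
    (fun x _ => (hH.differentiable one_ne_zero).differentiableAt)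
    (fun x hx => hK' x (by simpa using hx)) (by simpa using hv) (by simpa using hw)

theorem exists_fderiv_modulus_on_ball {H : V → W} (hH : ContDiff ℝ 1 H) (M : ℝ) {ε : ℝ}
    (hε : 0 < ε) : ∃ η > 0, ∀ v w, ‖v‖ ≤ M → ‖w‖ ≤ M → ‖w - v‖ < η →
      ‖fderiv ℝ H w - fderiv ℝ H v‖ ≤ ε ∧ ‖H w - H v - fderiv ℝ H v (w - v)‖ ≤ ε * ‖w - v‖ := by
  have : ProperSpace V := FiniteDimensional.proper ℝ V
  have huc := (isCompact_closedBall (0 : V) M).uniformContinuousOn_of_continuous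
    (hH.continuous_fderiv one_ne_zero).continuousOn
  obtain ⟨η, hη, h⟩ := Metric.uniformContinuousOn_iff.1 huc ε hε
  have h' : ∀ v w, ‖v‖ ≤ M → ‖w‖ ≤ M → ‖w - v‖ < η → ‖fderiv ℝ H w - fderiv ℝ H v‖ ≤ ε :=
    fun v w hv hw hvw => by
      have := h w (by simpa using hw) v (by simpa using hv) (by rwa [dist_eq_norm])
      rw [dist_eq_norm] at this
      exact this.le
  refine ⟨η, hη, fun v w hv hw hvw => ⟨h' v w hv hw hvw, ?_⟩⟩
  have hconv : Convex ℝ (Metric.closedBall (0 : V) M ∩ Metric.ball v η) :=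
    (convex_closedBall _ _).inter (convex_ball _ _)
  refine hconv.norm_image_sub_le_of_norm_hasFDerivWithin_le'
    (fun x _ => ((hH.differentiable one_ne_zero) x).hasFDerivAt.hasFDerivWithinAt)
    (fun x hx => h' v x hv (by simpa using hx.1) (by simpa [dist_eq_norm] using hx.2)) ?_ ?_
  · exact ⟨by simpa using hv, by simpa using hη⟩
  · exact ⟨by simpa using hw, by simpa [dist_eq_norm] using hvw⟩

end Modulus

/-! ### Differentiability of delay Volterra equations with respect to the delay -/

/-- `Z` is the derivative of the family `U` with respect to the parameter `τ ∈ [0, b]` in the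
norm of `L¹(0, T)`. -/
def HasL1Deriv {V : Type*} [NormedAddCommGroup V] [NormedSpace ℝ V] (b T : ℝ)
    (U Z : ℝ → ℝ → V) : Prop :=
  ∀ τ ∈ Icc 0 b, ∀ ε > 0, ∀ᶠ τ' in 𝓝[Icc 0 b] τ,
    ∫ t in (0 : ℝ)..T, ‖U τ' t - U τ t - (τ' - τ) • Z τ t‖ ≤ ε * |τ' - τ|

/-- The family `Z` is continuous in the parameter `τ ∈ [0, b]` in the norm of `L¹(0, T)`. -/
def IsL1Continuous {V : Type*} [NormedAddCommGroup V] (b T : ℝ) (Z : ℝ → ℝ → V) : Prop :=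
  ∀ τ ∈ Icc 0 b, ∀ ε > 0, ∀ᶠ τ' in 𝓝[Icc 0 b] τ, ∫ t in (0 : ℝ)..T, ‖Z τ' t - Z τ t‖ ≤ ε

/-- For each delay `τ ∈ [0, b]` the function `U τ` is continuous, has the history `ψ` on
`(-∞, 0]` and solves `U(t) = R_τ(t) + ∫₀ᵗ (H(U(s)) + A U(s - τ)) ds` on `[0, T]`. The
inhomogeneity `R` may depend on `τ`, in a Lipschitz way, and the solutions are bounded uniformly
in `τ`. The values of `U τ` beyond `T` play no role but are kept bounded. -/
structure IsDelayFamily {V : Type*} [NormedAddCommGroup V] [NormedSpace ℝ V] (b T : ℝ)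
    (A : V →L[ℝ] V) (H : V → V) (ψ : ℝ → V) (R U : ℝ → ℝ → V) : Prop where
  cont : ∀ τ ∈ Icc 0 b, Continuous (U τ)
  cont_R : ∀ τ ∈ Icc 0 b, Continuous (R τ)
  hist : ∀ τ ∈ Icc 0 b, ∀ t ≤ 0, U τ t = ψ t
  bdd : ∃ M, ∀ τ ∈ Icc 0 b, ∀ t, ‖U τ t‖ ≤ M
  lip : ∃ C, 0 ≤ C ∧ ∀ τ ∈ Icc 0 b, ∀ τ' ∈ Icc 0 b, ∀ t ∈ Icc 0 T,
    ‖R τ' t - R τ t‖ ≤ C * |τ' - τ|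
  eq : ∀ τ ∈ Icc 0 b, ∀ t ∈ Icc 0 T,
    U τ t = R τ t + ∫ s in (0 : ℝ)..t, (H (U τ s) + A (U τ (s - τ)))

/-- `Z` solves the delay Volterra equation which results from formal differentiation of the one
for `U` with respect to `τ`. The term `A (U τ (t - τ) - ψ (-τ))` is `∫₀ᵗ A U'(s - τ) ds`; in this
form no derivative of `U` enters. In general `Z τ` jumps at `t = 0` and is not continuous. -/
structure IsDelayVariation {V : Type*} [NormedAddCommGroup V] [NormedSpace ℝ V] (b T : ℝ)
    (A : V →L[ℝ] V) (H : V → V) (ψ : ℝ → V) (R' U Z : ℝ → ℝ → V) : Prop where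
  meas : ∀ τ ∈ Icc 0 b, StronglyMeasurable (Z τ)
  hist : ∀ τ ∈ Icc 0 b, ∀ t ≤ 0, Z τ t = 0
  bdd : ∃ M, ∀ τ ∈ Icc 0 b, ∀ t, ‖Z τ t‖ ≤ M
  eq : ∀ τ ∈ Icc 0 b, ∀ t ∈ Ioc 0 T, Z τ t = R' τ t - A (U τ (t - τ) - ψ (-τ)) +
    ∫ s in (0 : ℝ)..t, (fderiv ℝ H (U τ s) (Z τ s) + A (Z τ (s - τ)))

theorem Continuous.exists_shift_modulus {V : Type*} [NormedAddCommGroup V] {u : ℝ → V} (hu : Continuous u) {b T τ : ℝ}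
    (hτ : τ ∈ Icc 0 b) {ε : ℝ} (hε : 0 < ε) :
    ∀ᶠ τ' in 𝓝[Icc 0 b] τ, ∀ t ∈ Icc 0 T, ∀ r ∈ uIcc (t - τ') (t - τ),
      ‖u r - u (t - τ)‖ ≤ ε := by
  have huc := (isCompact_Icc (a := -b) (b := T)).uniformContinuousOn_of_continuous hu.continuousOn
  obtain ⟨η, hη, h⟩ := Metric.uniformContinuousOn_iff.1 huc ε hε
  filter_upwards [self_mem_nhdsWithin, mem_nhdsWithin_of_mem_nhds (Metric.ball_mem_nhds τ hη)]
    with τ' hτ' hd t ht r hr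
  have h1 : ∀ s ∈ uIcc (t - τ') (t - τ), s ∈ Icc (-b) T := fun s hs => by
    have := ht.1; have := ht.2; have := hτ.1; have := hτ.2; have := hτ'.1; have := hτ'.2
    exact ⟨(le_inf (by linarith) (by linarith)).trans hs.1,
      hs.2.trans (sup_le (by linarith) (by linarith))⟩
  have h2 := h r (h1 r hr) (t - τ) (h1 _ right_mem_uIcc) (by
    rw [Real.dist_eq]
    have h3 := abs_sub_right_of_mem_uIcc hr
    rw [Metric.mem_ball, Real.dist_eq] at hd
    rw [abs_sub_comm]
    refine h3.trans_lt ?_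
    rwa [show t - τ - (t - τ') = τ' - τ by ring])
  rw [dist_eq_norm] at h2
  exact h2.le

theorem eventually_abs_sub_le {b τ ε : ℝ} (hε : 0 < ε) :
    ∀ᶠ τ' in 𝓝[Icc 0 b] τ, |τ' - τ| ≤ ε := by
  filter_upwards [mem_nhdsWithin_of_mem_nhds (Metric.ball_mem_nhds τ hε)] with τ' h
  rw [Metric.mem_ball, Real.dist_eq] at h
  exact h.le

section
variable {V : Type*} [NormedAddCommGroup V] [NormedSpace ℝ V]

theorem norm_integral_comp_sub_clm_le [CompleteSpace V] (A : V →L[ℝ] V) {δ : ℝ → V}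
    (hδ : StronglyMeasurable δ) {M : ℝ}
    (hM : ∀ t, ‖δ t‖ ≤ M) (hneg : ∀ t ≤ 0, δ t = 0) {τ t : ℝ} (hτ : 0 ≤ τ) (ht : 0 ≤ t) :
    ‖∫ s in (0 : ℝ)..t, A (δ (s - τ))‖ ≤ ‖A‖ * ∫ s in (0 : ℝ)..t, ‖δ s‖ := by
  have hi := intervalIntegrable_of_measurable_of_bounded hδ hM
  have hi' : IntervalIntegrable (fun s => δ (s - τ)) volume 0 t := by
    simpa using (hi (0 - τ) (t - τ)).comp_sub_right τ
  rw [A.intervalIntegral_comp_comm hi']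
  refine (A.le_opNorm _).trans ?_
  gcongr
  refine (intervalIntegral.norm_integral_le_integral_norm ht).trans ?_
  exact integral_comp_sub_le (δ := fun s => ‖δ s‖) hτ (fun a c => (hi a c).norm)
    (fun s => norm_nonneg _) fun s hs => by simp [hneg s hs]

theorem norm_integral_clm_le {B : ℝ → V →L[ℝ] V} {δ : ℝ → V} (hδ : StronglyMeasurable δ)
    {M K : ℝ} (hM : ∀ t, ‖δ t‖ ≤ M) (hB : ∀ t, ‖B t‖ ≤ K) {t : ℝ} (ht : 0 ≤ t) :
    ‖∫ s in (0 : ℝ)..t, B s (δ s)‖ ≤ K * ∫ s in (0 : ℝ)..t, ‖δ s‖ := by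
  rw [← intervalIntegral.integral_const_mul]
  refine intervalIntegral.norm_integral_le_of_norm_le ht
    (Eventually.of_forall fun s _ => (B s).le_of_opNorm_le (hB s) _)
    (((intervalIntegrable_of_measurable_of_bounded hδ hM 0 t).norm).const_mul K)

variable [FiniteDimensional ℝ V] {b T : ℝ} {A : V →L[ℝ] V} {H : V → V} {ψ : ℝ → V}
  {R R' U Z : ℝ → ℝ → V}

theorem IsDelayFamily.exists_lipschitz (hU : IsDelayFamily b T A H ψ R U)
    (hH : ContDiff ℝ 1 H) :
    ∃ C, 0 ≤ C ∧ ∀ τ ∈ Icc 0 b, ∀ τ' ∈ Icc 0 b, ∀ t ≤ T, ‖U τ' t - U τ t‖ ≤ C * |τ' - τ| := by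
  have : CompleteSpace V := FiniteDimensional.complete ℝ V
  obtain ⟨M, hM⟩ := hU.bdd
  obtain ⟨C, hC0, hC⟩ := hU.lip
  obtain ⟨K, hK0, -, hK⟩ := exists_lipschitz_on_ball hH M
  rcases lt_or_ge b 0 with hb | hb
  · exact ⟨0, le_rfl, fun τ hτ => absurd (hτ.1.trans hτ.2) (not_le.2 hb)⟩
  have hM0 : 0 ≤ M := (norm_nonneg _).trans (hM 0 ⟨le_rfl, hb⟩ 0)
  refine ⟨(C + ‖A‖ * (2 * M)) * Real.exp ((K + ‖A‖) * T), by positivity,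
    fun τ hτ τ' hτ' t ht => ?_⟩
  rcases le_or_gt t 0 with ht0 | ht0
  · rw [hU.hist τ hτ t ht0, hU.hist τ' hτ' t ht0, sub_self, norm_zero]; positivity
  have hc := hU.cont τ hτ
  have hc' := hU.cont τ' hτ'
  set δ : ℝ → V := fun t => U τ' t - U τ t with hδ
  have hδc : Continuous δ := hc'.sub hc
  have hδM : ∀ t, ‖δ t‖ ≤ M + M := fun t => (norm_sub_le _ _).trans
    (add_le_add (hM τ' hτ' t) (hM τ hτ t))
  have hδ0 : ∀ t ≤ 0, δ t = 0 := fun t ht => by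
    simp [hδ, hU.hist τ hτ t ht, hU.hist τ' hτ' t ht]
  have key : ∀ t ∈ Icc 0 T, ‖δ t‖ ≤ (C + ‖A‖ * (2 * M)) * |τ' - τ| +
      (K + ‖A‖) * ∫ s in (0 : ℝ)..t, ‖δ s‖ := fun t ht => by
    have hHc := hH.continuous
    have e1 : δ t = (R τ' t - R τ t) + ((∫ s in (0 : ℝ)..t, (H (U τ' s) - H (U τ s))) +
        (∫ s in (0 : ℝ)..t, A (δ (s - τ'))) +
        A (∫ s in (0 : ℝ)..t, (U τ (s - τ') - U τ (s - τ)))) := by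
      rw [← A.intervalIntegral_comp_comm (Continuous.intervalIntegrable (by fun_prop) _ _),
        ← intervalIntegral.integral_add (Continuous.intervalIntegrable (by fun_prop) _ _)
          (Continuous.intervalIntegrable (by fun_prop) _ _),
        ← intervalIntegral.integral_add (Continuous.intervalIntegrable (by fun_prop) _ _)
          (Continuous.intervalIntegrable (by fun_prop) _ _)]
      simp only [hδ]
      rw [hU.eq τ hτ t ht, hU.eq τ' hτ' t ht, add_sub_add_comm,
        ← intervalIntegral.integral_sub (Continuous.intervalIntegrable (by fun_prop) _ _)
          (Continuous.intervalIntegrable (by fun_prop) _ _)]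
      congr 2
      ext s
      simp only [map_sub]
      abel
    rw [e1]
    have b1 : ‖∫ s in (0 : ℝ)..t, (H (U τ' s) - H (U τ s))‖ ≤ K * ∫ s in (0 : ℝ)..t, ‖δ s‖ := by
      rw [← intervalIntegral.integral_const_mul]
      exact intervalIntegral.norm_integral_le_of_norm_le ht.1
        (Eventually.of_forall fun s _ => hK _ _ (hM τ hτ s) (hM τ' hτ' s))
        (Continuous.intervalIntegrable (by fun_prop) _ _)
    have b2 := norm_integral_comp_sub_clm_le A hδc.stronglyMeasurable hδM hδ0 hτ'.1 ht.1
    have b3 := A.le_opNorm_of_le (norm_integral_comp_sub_sub_comp_sub_le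
      (fun a c => hc.intervalIntegrable a c) (hM τ hτ) τ τ' t)
    have b4 := hC τ hτ τ' hτ' t ht
    refine (norm_add_le _ _).trans ?_
    refine (add_le_add b4 ((norm_add₃_le).trans (add_le_add_three b1 b2 b3))).trans (le_of_eq ?_)
    ring
  have h1 := le_mul_exp_of_le_add_integral (by positivity) hδc.norm key t ⟨ht0.le, ht⟩
  refine h1.trans ?_
  rw [mul_right_comm]
  gcongr

theorem IsDelayFamily.hasL1Deriv (hU : IsDelayFamily b T A H ψ R U)
    (hZ : IsDelayVariation b T A H ψ R' U Z) (hT : 0 ≤ T) (hH : ContDiff ℝ 1 H)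
    (hR : HasL1Deriv b T R R')
    (hR' : ∀ τ ∈ Icc 0 b, StronglyMeasurable (R' τ) ∧ ∃ M, ∀ t, ‖R' τ t‖ ≤ M) :
    HasL1Deriv b T U Z := by
  have : CompleteSpace V := FiniteDimensional.complete ℝ V
  obtain ⟨M, hM⟩ := hU.bdd
  obtain ⟨N, hN⟩ := hZ.bdd
  obtain ⟨C, hC0, hC⟩ := hU.exists_lipschitz hH
  obtain ⟨K, hK0, hK, -⟩ := exists_lipschitz_on_ball hH M
  intro τ hτ ε' hε'
  have hN0 : 0 ≤ N := (norm_nonneg _).trans (hN τ hτ 0)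
  set a := ‖A‖ with ha
  have ha0 : 0 ≤ a := norm_nonneg _
  set c : ℝ := T * C + a * 2 + a * (2 * N) with hc
  have hc0 : 0 ≤ c := by positivity
  obtain ⟨ε, hε, hεε'⟩ : ∃ ε > 0, ε * ((1 + T * c) * Real.exp ((K + a) * T)) ≤ ε' := by
    refine ⟨ε' / ((1 + T * c) * Real.exp ((K + a) * T)), by positivity, le_of_eq ?_⟩
    field_simp
  obtain ⟨η, hη, hmod⟩ := exists_fderiv_modulus_on_ball hH M hε
  have hCη : ∀ᶠ τ' in 𝓝[Icc 0 b] τ, C * |τ' - τ| < η := by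
    have : Tendsto (fun τ' : ℝ => C * |τ' - τ|) (𝓝[Icc 0 b] τ) (𝓝 (C * |τ - τ|)) :=
      ((by fun_prop : Continuous fun τ' : ℝ => C * |τ' - τ|).tendsto τ).mono_left nhdsWithin_le_nhds
    rw [sub_self, abs_zero, mul_zero] at this
    exact this.eventually (gt_mem_nhds hη)
  filter_upwards [self_mem_nhdsWithin, hCη, hR τ hτ ε hε, eventually_abs_sub_le hε,
    (hU.cont τ hτ).exists_shift_modulus (T := T) hτ hε] with τ' hτ' hη' hRε hτε hshift
  have hUc := hU.cont τ hτ
  have hUc' := hU.cont τ' hτ'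
  have hRc := hU.cont_R τ hτ
  have hRc' := hU.cont_R τ' hτ'
  have hHc := hH.continuous
  have hDH := hH.continuous_fderiv one_ne_zero
  set h := τ' - τ with hh
  set δ : ℝ → V := fun t => U τ' t - U τ t - h • Z τ t with hδ
  have hZm := hZ.meas τ hτ
  have hδm : StronglyMeasurable δ :=
    (hUc'.sub hUc).stronglyMeasurable.sub (hZm.const_smul h)
  have hδM : ∀ t, ‖δ t‖ ≤ M + M + |h| * N := fun t => by
    refine (norm_sub_le _ _).trans (add_le_add ((norm_sub_le _ _).trans
      (add_le_add (hM τ' hτ' t) (hM τ hτ t))) ?_)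
    rw [norm_smul, Real.norm_eq_abs]
    exact mul_le_mul_of_nonneg_left (hN τ hτ t) (abs_nonneg _)
  have hδ0 : ∀ t ≤ 0, δ t = 0 := fun t ht => by
    simp [hδ, hU.hist τ hτ t ht, hU.hist τ' hτ' t ht, hZ.hist τ hτ t ht]
  set ρ : ℝ → ℝ := fun t => ‖R τ' t - R τ t - h • R' τ t‖ + c * ε * |h| with hρ
  have hρi : IntervalIntegrable (fun t => ‖R τ' t - R τ t - h • R' τ t‖) volume 0 T := by
    obtain ⟨hm, M', hM'⟩ := hR' τ hτ
    exact (((hRc'.sub hRc).intervalIntegrable _ _).sub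
      ((intervalIntegrable_of_measurable_of_bounded hm hM' 0 T).smul h)).norm
  have hZi := intervalIntegrable_of_measurable_of_bounded hZm (hN τ hτ)
  have hδi := intervalIntegrable_of_measurable_of_bounded hδm hδM
  have hDHb : ∀ u : ℝ → V, StronglyMeasurable u → ∀ B, (∀ t, ‖u t‖ ≤ B) → ∀ p q,
      IntervalIntegrable (fun s => fderiv ℝ H (U τ s) (u s)) volume p q := fun u hu B hB => by
    refine intervalIntegrable_of_measurable_of_bounded (M := K * B) ?_ fun t => ?_
    · exact isBoundedBilinearMap_apply.continuous.comp_stronglyMeasurable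
        ((hDH.comp hUc).stronglyMeasurable.prodMk hu)
    · exact (fderiv ℝ H (U τ t)).le_of_opNorm_le_of_le (hK _ (hM τ hτ t)) (hB t)
  have hAb : ∀ u : ℝ → V, (∀ p q, IntervalIntegrable u volume p q) → ∀ r t,
      IntervalIntegrable (fun s => A (u (s - r))) volume 0 t := fun u hu r t => by
    have : IntervalIntegrable (fun s => u (s - r)) volume 0 t := by
      simpa using (hu (0 - r) (t - r)).comp_sub_right r
    exact ⟨A.integrable_comp this.1, A.integrable_comp this.2⟩
  have key : ∀ t ∈ Ioc 0 T, ‖δ t‖ ≤ ρ t + (K + a) * ∫ s in (0 : ℝ)..t, ‖δ s‖ := fun t ht => by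
    have ht' := Ioc_subset_Icc_self ht
    have i1 : IntervalIntegrable (fun s => H (U τ' s) - H (U τ s) -
        fderiv ℝ H (U τ s) (U τ' s - U τ s)) volume 0 t :=
      Continuous.intervalIntegrable (by fun_prop) _ _
    have i2 := hDHb δ hδm _ hδM 0 t
    have i3 := hAb δ hδi τ' t
    have i4 : IntervalIntegrable (fun s => A (U τ (s - τ') - U τ (s - τ))) volume 0 t :=
      Continuous.intervalIntegrable (by fun_prop) _ _
    have i5 : IntervalIntegrable (fun s => A (Z τ (s - τ') - Z τ (s - τ))) volume 0 t := by
      simp only [map_sub]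
      exact (hAb _ hZi τ' t).sub (hAb _ hZi τ t)
    have hsplit : δ t = (R τ' t - R τ t - h • R' τ t) +
        ((∫ s in (0 : ℝ)..t, (H (U τ' s) - H (U τ s) - fderiv ℝ H (U τ s) (U τ' s - U τ s))) +
        (∫ s in (0 : ℝ)..t, fderiv ℝ H (U τ s) (δ s)) + (∫ s in (0 : ℝ)..t, A (δ (s - τ')))) +
        (A ((∫ s in (0 : ℝ)..t, (U τ (s - τ') - U τ (s - τ))) + h • (U τ (t - τ) - U τ (-τ))) +
        h • A (∫ s in (0 : ℝ)..t, (Z τ (s - τ') - Z τ (s - τ)))) := by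
      have j5 : IntervalIntegrable (fun s => Z τ (s - τ') - Z τ (s - τ)) volume 0 t := by
        have : ∀ r, IntervalIntegrable (fun s => Z τ (s - r)) volume 0 t := fun r => by
          simpa using (hZi (0 - r) (t - r)).comp_sub_right r
        exact (this τ').sub (this τ)
      rw [map_add, ← A.intervalIntegral_comp_comm (Continuous.intervalIntegrable (by fun_prop) _ _),
        ← A.intervalIntegral_comp_comm j5, ← intervalIntegral.integral_add i1 i2,
        ← intervalIntegral.integral_add (i1.add i2) i3]
      have e1 : δ t = (R τ' t - R τ t - h • R' τ t) + h • A (U τ (t - τ) - U τ (-τ)) +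
          ((∫ s in (0 : ℝ)..t, (H (U τ' s) + A (U τ' (s - τ')))) -
          (∫ s in (0 : ℝ)..t, (H (U τ s) + A (U τ (s - τ)))) -
          h • ∫ s in (0 : ℝ)..t, (fderiv ℝ H (U τ s) (Z τ s) + A (Z τ (s - τ)))) := by
        simp only [hδ]
        rw [hU.eq τ hτ t ht', hU.eq τ' hτ' t ht', hZ.eq τ hτ t ht, hU.hist τ hτ (-τ)
          (by linarith [hτ.1])]
        simp only [smul_add, smul_sub]
        abel
      have e2 : (∫ s in (0 : ℝ)..t, (H (U τ' s) + A (U τ' (s - τ')))) -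
          (∫ s in (0 : ℝ)..t, (H (U τ s) + A (U τ (s - τ)))) -
          h • (∫ s in (0 : ℝ)..t, (fderiv ℝ H (U τ s) (Z τ s) + A (Z τ (s - τ)))) =
          (∫ s in (0 : ℝ)..t, ((H (U τ' s) - H (U τ s) - fderiv ℝ H (U τ s) (U τ' s - U τ s)) +
            fderiv ℝ H (U τ s) (δ s) + A (δ (s - τ')))) +
          (∫ s in (0 : ℝ)..t, A (U τ (s - τ') - U τ (s - τ))) +
          h • ∫ s in (0 : ℝ)..t, A (Z τ (s - τ') - Z τ (s - τ)) := by
        have i6 : IntervalIntegrable (fun s => h • (fderiv ℝ H (U τ s) (Z τ s) +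
            A (Z τ (s - τ)))) volume 0 t :=
          ((hDHb (Z τ) hZm _ (hN τ hτ) 0 t).add (hAb _ hZi τ t)).smul h
        have i7 : IntervalIntegrable (fun s => h • A (Z τ (s - τ') - Z τ (s - τ))) volume 0 t :=
          i5.smul h
        rw [← intervalIntegral.integral_smul, ← intervalIntegral.integral_smul,
          ← intervalIntegral.integral_sub (Continuous.intervalIntegrable (by fun_prop) _ _)
            (Continuous.intervalIntegrable (by fun_prop) _ _),
          ← intervalIntegral.integral_sub (Continuous.intervalIntegrable (by fun_prop) _ _)
            i6,
          ← intervalIntegral.integral_add ((i1.add i2).add i3) i4,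
          ← intervalIntegral.integral_add (((i1.add i2).add i3).add i4) i7]
        congr 1
        ext s
        simp only [hδ, map_sub, map_smul, smul_add, smul_sub]
        abel
      rw [e1, e2, map_smul]
      abel
    have b1 : ‖∫ s in (0 : ℝ)..t, (H (U τ' s) - H (U τ s) -
        fderiv ℝ H (U τ s) (U τ' s - U τ s))‖ ≤ T * (ε * (C * |h|)) := by
      have hb : ∀ s ∈ uIoc 0 t, ‖H (U τ' s) - H (U τ s) - fderiv ℝ H (U τ s) (U τ' s - U τ s)‖ ≤
          ε * (C * |h|) := fun s hs => by
        rw [uIoc_of_le ht'.1] at hs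
        have h1 := hC τ hτ τ' hτ' s (hs.2.trans ht.2)
        refine (hmod _ _ (hM τ hτ s) (hM τ' hτ' s) (h1.trans_lt hη')).2.trans ?_
        gcongr
      refine (intervalIntegral.norm_integral_le_of_norm_le_const hb).trans ?_
      rw [sub_zero, abs_of_nonneg ht'.1, mul_comm]
      gcongr
      exact ht.2
    have b2 := norm_integral_clm_le hδm hδM (fun s => hK _ (hM τ hτ s)) ht'.1
    have b3 := norm_integral_comp_sub_clm_le A hδm hδM hδ0 hτ'.1 ht'.1
    have b4 : ‖A ((∫ s in (0 : ℝ)..t, (U τ (s - τ') - U τ (s - τ))) +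
        h • (U τ (t - τ) - U τ (-τ)))‖ ≤ a * (2 * ε * |h|) :=
      A.le_opNorm_of_le (norm_integral_comp_sub_sub_comp_sub_add_le hUc
        (by simpa using hshift 0 ⟨le_rfl, hT⟩) (hshift t ht'))
    have b5 : ‖h • A (∫ s in (0 : ℝ)..t, (Z τ (s - τ') - Z τ (s - τ)))‖ ≤
        ε * (a * (2 * N * |h|)) := by
      rw [norm_smul, Real.norm_eq_abs]
      have := A.le_opNorm_of_le (norm_integral_comp_sub_sub_comp_sub_le hZi (hN τ hτ) τ τ' t)
      gcongr
    rw [hsplit]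
    refine norm_add₃_le.trans ((add_le_add_three le_rfl (norm_add₃_le.trans
      (add_le_add_three b1 b2 b3)) ((norm_add_le _ _).trans (add_le_add b4 b5))).trans
      (le_of_eq ?_))
    simp only [hρ, hc]
    ring
  have hfin := integral_le_exp_mul_integral hT (by positivity) hδm.norm
    (fun t => by rw [norm_norm]; exact hδM t) (hρi.add intervalIntegrable_const)
    (fun t => by positivity) key
  refine hfin.trans ?_
  have hρint : ∫ t in (0 : ℝ)..T, ρ t ≤ ε * |h| + T * (c * ε * |h|) := by
    rw [intervalIntegral.integral_add hρi intervalIntegrable_const,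
      intervalIntegral.integral_const, sub_zero, smul_eq_mul]
    linarith
  calc _ ≤ (ε * |h| + T * (c * ε * |h|)) * Real.exp ((K + a) * T) := by gcongr
    _ = ε * ((1 + T * c) * Real.exp ((K + a) * T)) * |h| := by ring
    _ ≤ _ := by gcongr

theorem IsDelayVariation.isL1Continuous (hU : IsDelayFamily b T A H ψ R U)
    (hZ : IsDelayVariation b T A H ψ R' U Z) (hT : 0 ≤ T) (hH : ContDiff ℝ 1 H)
    (hψ : Continuous ψ) (hR : IsL1Continuous b T R')
    (hR' : ∀ τ ∈ Icc 0 b, StronglyMeasurable (R' τ) ∧ ∃ M, ∀ t, ‖R' τ t‖ ≤ M) :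
    IsL1Continuous b T Z := by
  have : CompleteSpace V := FiniteDimensional.complete ℝ V
  obtain ⟨M, hM⟩ := hU.bdd
  obtain ⟨N, hN⟩ := hZ.bdd
  obtain ⟨C, hC0, hC⟩ := hU.exists_lipschitz hH
  obtain ⟨K, hK0, hK, -⟩ := exists_lipschitz_on_ball hH M
  intro τ hτ ε' hε'
  have hN0 : 0 ≤ N := (norm_nonneg _).trans (hN τ hτ 0)
  set a := ‖A‖ with ha
  have ha0 : 0 ≤ a := norm_nonneg _
  set c : ℝ := a * (C + 1) + a + T * N + a * (2 * N) with hc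
  have hc0 : 0 ≤ c := by positivity
  obtain ⟨ε, hε, hεε'⟩ : ∃ ε > 0, ε * ((1 + T * c) * Real.exp ((K + a) * T)) ≤ ε' := by
    refine ⟨ε' / ((1 + T * c) * Real.exp ((K + a) * T)), by positivity, le_of_eq ?_⟩
    field_simp
  obtain ⟨η, hη, hmod⟩ := exists_fderiv_modulus_on_ball hH M hε
  have hCη : ∀ᶠ τ' in 𝓝[Icc 0 b] τ, C * |τ' - τ| < η := by
    have : Tendsto (fun τ' : ℝ => C * |τ' - τ|) (𝓝[Icc 0 b] τ) (𝓝 (C * |τ - τ|)) :=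
      ((by fun_prop : Continuous fun τ' : ℝ => C * |τ' - τ|).tendsto τ).mono_left nhdsWithin_le_nhds
    rw [sub_self, abs_zero, mul_zero] at this
    exact this.eventually (gt_mem_nhds hη)
  filter_upwards [self_mem_nhdsWithin, hCη, hR τ hτ ε hε, eventually_abs_sub_le hε,
    (hU.cont τ hτ).exists_shift_modulus (T := T) hτ hε, hψ.exists_shift_modulus (T := T) hτ hε]
    with τ' hτ' hη' hRε hτε hshift hshiftψ
  have hUc := hU.cont τ hτ
  have hUc' := hU.cont τ' hτ'
  have hDH := hH.continuous_fderiv one_ne_zero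
  set δ : ℝ → V := fun t => Z τ' t - Z τ t with hδ
  have hZm := hZ.meas τ hτ
  have hZm' := hZ.meas τ' hτ'
  have hδm : StronglyMeasurable δ := hZm'.sub hZm
  have hδM : ∀ t, ‖δ t‖ ≤ N + N := fun t => (norm_sub_le _ _).trans
    (add_le_add (hN τ' hτ' t) (hN τ hτ t))
  have hδ0 : ∀ t ≤ 0, δ t = 0 := fun t ht => by
    simp [hδ, hZ.hist τ hτ t ht, hZ.hist τ' hτ' t ht]
  set ρ : ℝ → ℝ := fun t => ‖R' τ' t - R' τ t‖ + c * ε with hρ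
  have hρi : IntervalIntegrable (fun t => ‖R' τ' t - R' τ t‖) volume 0 T := by
    obtain ⟨hm, M', hM'⟩ := hR' τ hτ
    obtain ⟨hm2, M2, hM2⟩ := hR' τ' hτ'
    exact ((intervalIntegrable_of_measurable_of_bounded hm2 hM2 0 T).sub
      (intervalIntegrable_of_measurable_of_bounded hm hM' 0 T)).norm
  have hZi := intervalIntegrable_of_measurable_of_bounded hZm (hN τ hτ)
  have hδi := intervalIntegrable_of_measurable_of_bounded hδm hδM
  have hDHb : ∀ σ ∈ Icc 0 b, ∀ u : ℝ → V, StronglyMeasurable u → ∀ B, (∀ t, ‖u t‖ ≤ B) → ∀ p q,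
      IntervalIntegrable (fun s => fderiv ℝ H (U σ s) (u s)) volume p q := fun σ hσ u hu B hB => by
    refine intervalIntegrable_of_measurable_of_bounded (M := K * B) ?_ fun t => ?_
    · exact isBoundedBilinearMap_apply.continuous.comp_stronglyMeasurable
        ((hDH.comp (hU.cont σ hσ)).stronglyMeasurable.prodMk hu)
    · exact (fderiv ℝ H (U σ t)).le_of_opNorm_le_of_le (hK _ (hM σ hσ t)) (hB t)
  have hSb : ∀ u : ℝ → V, (∀ p q, IntervalIntegrable u volume p q) → ∀ r t,
      IntervalIntegrable (fun s => u (s - r)) volume 0 t := fun u hu r t => by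
    simpa using (hu (0 - r) (t - r)).comp_sub_right r
  have hAb : ∀ u : ℝ → V, (∀ p q, IntervalIntegrable u volume p q) → ∀ r t,
      IntervalIntegrable (fun s => A (u (s - r))) volume 0 t := fun u hu r t =>
    ⟨A.integrable_comp (hSb u hu r t).1, A.integrable_comp (hSb u hu r t).2⟩
  have key : ∀ t ∈ Ioc 0 T, ‖δ t‖ ≤ ρ t + (K + a) * ∫ s in (0 : ℝ)..t, ‖δ s‖ := fun t ht => by
    have ht' := Ioc_subset_Icc_self ht
    have i1 : IntervalIntegrable (fun s => (fderiv ℝ H (U τ' s) - fderiv ℝ H (U τ s)) (Z τ s))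
        volume 0 t := by
      simp only [_root_.sub_apply]
      exact (hDHb τ' hτ' _ hZm _ (hN τ hτ) 0 t).sub (hDHb τ hτ _ hZm _ (hN τ hτ) 0 t)
    have i2 := hDHb τ' hτ' δ hδm _ hδM 0 t
    have i3 := hAb δ hδi τ' t
    have j5 : IntervalIntegrable (fun s => Z τ (s - τ') - Z τ (s - τ)) volume 0 t :=
      (hSb _ hZi τ' t).sub (hSb _ hZi τ t)
    have i5 : IntervalIntegrable (fun s => A (Z τ (s - τ') - Z τ (s - τ))) volume 0 t :=
      ⟨A.integrable_comp j5.1, A.integrable_comp j5.2⟩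
    have i6 := (hDHb τ hτ _ hZm _ (hN τ hτ) 0 t).add (hAb _ hZi τ t)
    have i7 := (hDHb τ' hτ' _ hZm' _ (hN τ' hτ') 0 t).add
      (hAb _ (intervalIntegrable_of_measurable_of_bounded hZm' (hN τ' hτ')) τ' t)
    have hsplit : δ t = (R' τ' t - R' τ t) + (A (U τ (t - τ) - U τ' (t - τ')) +
        A (ψ (-τ') - ψ (-τ))) +
        ((∫ s in (0 : ℝ)..t, (fderiv ℝ H (U τ' s) - fderiv ℝ H (U τ s)) (Z τ s)) +
        (∫ s in (0 : ℝ)..t, fderiv ℝ H (U τ' s) (δ s)) + (∫ s in (0 : ℝ)..t, A (δ (s - τ'))) +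
        A (∫ s in (0 : ℝ)..t, (Z τ (s - τ') - Z τ (s - τ)))) := by
      rw [← A.intervalIntegral_comp_comm j5, ← intervalIntegral.integral_add i1 i2,
        ← intervalIntegral.integral_add (i1.add i2) i3,
        ← intervalIntegral.integral_add ((i1.add i2).add i3) i5]
      simp only [hδ]
      rw [hZ.eq τ hτ t ht, hZ.eq τ' hτ' t ht, add_sub_add_comm,
        ← intervalIntegral.integral_sub i7 i6]
      congr 1
      · simp only [map_sub]; abel
      · congr 1
        ext s
        simp only [map_sub, _root_.sub_apply]
        abel
    have b0 : ‖A (U τ (t - τ) - U τ' (t - τ'))‖ ≤ a * ((C + 1) * ε) := by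
      refine A.le_opNorm_of_le ?_
      have h1 := hshift t ht' (t - τ') left_mem_uIcc
      have h2 := hC τ hτ τ' hτ' (t - τ') (by linarith [hτ'.1, ht.2])
      have h3 : C * |τ' - τ| ≤ C * ε := by gcongr
      rw [norm_sub_rev]
      linarith [norm_sub_le_norm_sub_add_norm_sub (U τ' (t - τ')) (U τ (t - τ')) (U τ (t - τ))]
    have b0' : ‖A (ψ (-τ') - ψ (-τ))‖ ≤ a * ε := A.le_opNorm_of_le
      (by simpa using hshiftψ 0 ⟨le_rfl, hT⟩ (0 - τ') left_mem_uIcc)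
    have b1 : ‖∫ s in (0 : ℝ)..t, (fderiv ℝ H (U τ' s) - fderiv ℝ H (U τ s)) (Z τ s)‖ ≤
        T * (ε * N) := by
      have hb : ∀ s ∈ uIoc 0 t, ‖(fderiv ℝ H (U τ' s) - fderiv ℝ H (U τ s)) (Z τ s)‖ ≤
          ε * N := fun s hs => by
        rw [uIoc_of_le ht'.1] at hs
        have h1 := hC τ hτ τ' hτ' s (hs.2.trans ht.2)
        exact ContinuousLinearMap.le_of_opNorm_le_of_le _
          (hmod _ _ (hM τ hτ s) (hM τ' hτ' s) (h1.trans_lt hη')).1 (hN τ hτ s)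
      refine (intervalIntegral.norm_integral_le_of_norm_le_const hb).trans ?_
      rw [sub_zero, abs_of_nonneg ht'.1, mul_comm]
      gcongr
      exact ht.2
    have b2 := norm_integral_clm_le hδm hδM (fun s => hK _ (hM τ' hτ' s)) ht'.1
    have b3 := norm_integral_comp_sub_clm_le A hδm hδM hδ0 hτ'.1 ht'.1
    have b5 : ‖A (∫ s in (0 : ℝ)..t, (Z τ (s - τ') - Z τ (s - τ)))‖ ≤ a * (2 * N * ε) :=
      A.le_opNorm_of_le ((norm_integral_comp_sub_sub_comp_sub_le hZi (hN τ hτ) τ τ' t).trans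
        (by gcongr))
    rw [hsplit]
    refine norm_add₃_le.trans ((add_le_add_three le_rfl ((norm_add_le _ _).trans
      (add_le_add b0 b0')) ((norm_add_le _ _).trans (add_le_add (norm_add₃_le.trans
      (add_le_add_three b1 b2 b3)) b5))).trans (le_of_eq ?_))
    simp only [hρ, hc]
    ring
  have hfin := integral_le_exp_mul_integral hT (by positivity) hδm.norm
    (fun t => by rw [norm_norm]; exact hδM t) (hρi.add intervalIntegrable_const)
    (fun t => by positivity) key
  refine hfin.trans (le_trans ?_ hεε')
  have hρint : ∫ t in (0 : ℝ)..T, ρ t ≤ ε + T * (c * ε) := by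
    rw [intervalIntegral.integral_add hρi intervalIntegrable_const,
      intervalIntegral.integral_const, sub_zero, smul_eq_mul]
    linarith
  calc _ ≤ (ε + T * (c * ε)) * Real.exp ((K + a) * T) := by gcongr
    _ = ε * ((1 + T * c) * Real.exp ((K + a) * T)) := by ring

end

section
variable {V : Type*} [NormedAddCommGroup V] [NormedSpace ℝ V] [FiniteDimensional ℝ V] {b T : ℝ}
  {A : V →L[ℝ] V} {H : V → V} {ψ : ℝ → V} {R R' U Z : ℝ → ℝ → V}

/-- The differentiated equation is solvable. The possibly discontinuous inhomogeneity is split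
off, and the remainder is the continuous solution of an affine Volterra equation. -/
theorem IsDelayFamily.exists_variation (hU : IsDelayFamily b T A H ψ R U) (hT : 0 < T)
    (hH : ContDiff ℝ 1 H) (hR' : ∀ τ ∈ Icc 0 b, StronglyMeasurable (R' τ)) {M' : ℝ}
    (hM' : ∀ τ ∈ Icc 0 b, ∀ t, ‖R' τ t‖ ≤ M') :
    ∃ Z, IsDelayVariation b T A H ψ R' U Z ∧
      ∀ τ ∈ Icc 0 b, R' τ = 0 → Continuous (Z τ) := by
  have : CompleteSpace V := FiniteDimensional.complete ℝ V
  obtain ⟨M, hM⟩ := hU.bdd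
  obtain ⟨K, hK0, hK, -⟩ := exists_lipschitz_on_ball hH M
  have hDH := hH.continuous_fderiv one_ne_zero
  set a := ‖A‖ with ha
  have ha0 : 0 ≤ a := norm_nonneg _
  set Mk : ℝ := M' + a * (M + M) with hMk
  let k : ℝ → ℝ → V := fun τ => (Ioi (0 : ℝ)).indicator
    fun t => R' τ t - A (U τ (t - τ) - ψ (-τ))
  have hkm : ∀ τ ∈ Icc 0 b, StronglyMeasurable (k τ) := fun τ hτ => by
    have h1 := hU.cont τ hτ
    exact ((hR' τ hτ).sub (by fun_prop : Continuous fun t => A (U τ (t - τ) - ψ (-τ))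
      ).stronglyMeasurable).indicator measurableSet_Ioi
  have hkb : ∀ τ ∈ Icc 0 b, ∀ t, ‖k τ t‖ ≤ Mk := fun τ hτ t => by
    refine (norm_indicator_le_norm_self _ _).trans ((norm_sub_le _ _).trans
      (add_le_add (hM' τ hτ t) (A.le_opNorm_of_le ((norm_sub_le _ _).trans
        (add_le_add (hM τ hτ _) ?_)))))
    rw [← hU.hist τ hτ (-τ) (by linarith [hτ.1])]
    exact hM τ hτ _
  have hk0 : ∀ τ, ∀ t ≤ 0, k τ t = 0 := fun τ t ht =>
    indicator_of_notMem (by simpa using ht) _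
  have hDHb : ∀ σ ∈ Icc 0 b, ∀ u : ℝ → V, StronglyMeasurable u → ∀ p q,
      IntervalIntegrable u volume p q →
      IntervalIntegrable (fun s => fderiv ℝ H (U σ s) (u s)) volume p q := fun σ hσ u hu p q hi => by
    refine (hi.norm.const_mul K).mono_fun ?_ (Eventually.of_forall fun s => ?_)
    · exact (isBoundedBilinearMap_apply.continuous.comp_stronglyMeasurable
        ((hDH.comp (hU.cont σ hσ)).stronglyMeasurable.prodMk hu)).aestronglyMeasurable
    · exact ((fderiv ℝ H (U σ s)).le_of_opNorm_le (hK _ (hM σ hσ s)) _).trans (le_abs_self _)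
  have hAb : ∀ u : ℝ → V, (∀ p q, IntervalIntegrable u volume p q) → ∀ r t,
      IntervalIntegrable (fun s => A (u (s - r))) volume 0 t := fun u hu r t => by
    have : IntervalIntegrable (fun s => u (s - r)) volume 0 t := by
      simpa using (hu (0 - r) (t - r)).comp_sub_right r
    exact ⟨A.integrable_comp this.1, A.integrable_comp this.2⟩
  have hex : ∀ τ ∈ Icc 0 b, ∃ w : ℝ → V, Continuous w ∧ (∀ t ≤ 0, w t = 0) ∧
      (∀ t ≥ T, w t = w T) ∧ ∀ t ∈ Icc 0 T, w t = ∫ s in (0 : ℝ)..t,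
        (fderiv ℝ H (U τ s) (k τ s + w s) + A (k τ (s - τ) + w (s - τ))) := fun τ hτ => by
    refine exists_volterra_solution (L := K + a) hT.le hτ.1 (by positivity)
      (fun s v v' => fderiv ℝ H (U τ s) (k τ s + v) + A (k τ (s - τ) + v')) (fun u hu => ?_) ?_
    · have hi : ∀ p q, IntervalIntegrable (fun s => k τ s + u s) volume p q := fun p q =>
        (intervalIntegrable_of_measurable_of_bounded (hkm τ hτ) (hkb τ hτ) p q).add
          (hu.intervalIntegrable _ _)
      exact (hDHb τ hτ _ ((hkm τ hτ).add hu.stronglyMeasurable) 0 T (hi 0 T)).add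
        (hAb _ hi τ T)
    · intro s v v' w w'
      have h1 := (fderiv ℝ H (U τ s)).le_of_opNorm_le (hK _ (hM τ hτ s)) (v - w)
      have h2 := A.le_opNorm (v' - w')
      rw [← ha] at h2
      calc _ = ‖fderiv ℝ H (U τ s) (v - w) + A (v' - w')‖ := by
            simp only [map_add, map_sub]; congr 1; abel
        _ ≤ K * ‖v - w‖ + a * ‖v' - w'‖ := (norm_add_le _ _).trans (add_le_add h1 h2)
        _ ≤ (K + a) * (‖v - w‖ + ‖v' - w'‖) := by
            nlinarith [mul_nonneg hK0 (norm_nonneg (v' - w')), mul_nonneg ha0 (norm_nonneg (v - w))]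
  choose! w hwc hw0 hwT hw using hex
  let Z : ℝ → ℝ → V := fun τ t => k τ t + w τ t
  have hZm : ∀ τ ∈ Icc 0 b, StronglyMeasurable (Z τ) := fun τ hτ =>
    (hkm τ hτ).add (hwc τ hτ).stronglyMeasurable
  have hZ0 : ∀ τ ∈ Icc 0 b, ∀ t ≤ 0, Z τ t = 0 := fun τ hτ t ht => by
    simp [Z, hk0 τ t ht, hw0 τ hτ t ht]
  have hwb : ∀ τ ∈ Icc 0 b, ∃ B, ∀ t, ‖w τ t‖ ≤ B := fun τ hτ => by
    obtain ⟨B, hB⟩ := (isCompact_Icc (a := (0 : ℝ)) (b := T)).exists_bound_of_continuousOn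
      (hwc τ hτ).continuousOn
    refine ⟨B, fun t => ?_⟩
    rcases le_total t 0 with h | h
    · have h0 := hB 0 ⟨le_rfl, hT.le⟩
      rwa [hw0 τ hτ 0 le_rfl, ← hw0 τ hτ t h] at h0
    rcases le_total T t with h' | h'
    · rw [hwT τ hτ t h']; exact hB T ⟨hT.le, le_rfl⟩
    · exact hB t ⟨h, h'⟩
  have hMk0 : ∀ τ ∈ Icc 0 b, 0 ≤ Mk := fun τ hτ => (norm_nonneg _).trans (hkb τ hτ 0)
  set B₁ : ℝ := (K + a) * ((T * Mk) * Real.exp ((K + a) * T)) with hB₁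
  have hwB : ∀ τ ∈ Icc 0 b, ∀ t ∈ Icc 0 T, ‖w τ t‖ ≤ B₁ := fun τ hτ => by
    obtain ⟨B, hB⟩ := hwb τ hτ
    have hZb : ∀ t, ‖Z τ t‖ ≤ Mk + B := fun t =>
      (norm_add_le _ _).trans (add_le_add (hkb τ hτ t) (hB t))
    have hZi := intervalIntegrable_of_measurable_of_bounded (hZm τ hτ) hZb
    have h1 : ∀ t ∈ Icc 0 T, ‖w τ t‖ ≤ (K + a) * ∫ s in (0 : ℝ)..t, ‖Z τ s‖ := fun t ht => by
      rw [hw τ hτ t ht, intervalIntegral.integral_add (hDHb τ hτ _ (hZm τ hτ) 0 t (hZi 0 t))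
        (hAb _ hZi τ t), add_mul]
      exact (norm_add_le _ _).trans (add_le_add
        (norm_integral_clm_le (hZm τ hτ) hZb (fun s => hK _ (hM τ hτ s)) ht.1)
        (norm_integral_comp_sub_clm_le A (hZm τ hτ) hZb (hZ0 τ hτ) hτ.1 ht.1))
    have h2 := integral_le_exp_mul_integral hT.le (by positivity) (hZm τ hτ).norm
      (fun t => by rw [norm_norm]; exact hZb t) (intervalIntegrable_const (c := Mk))
      (fun _ => hMk0 τ hτ)
      fun t ht => (norm_add_le _ _).trans (add_le_add (hkb τ hτ t) (h1 t (Ioc_subset_Icc_self ht)))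
    rw [intervalIntegral.integral_const, sub_zero, smul_eq_mul] at h2
    intro t ht
    refine (h1 t ht).trans (mul_le_mul_of_nonneg_left (le_trans ?_ h2) (by positivity))
    exact intervalIntegral.integral_mono_interval le_rfl ht.1 ht.2
      (Eventually.of_forall fun s => norm_nonneg _) (hZi 0 T).norm
  refine ⟨Z, ⟨hZm, hZ0, ⟨Mk + B₁, fun τ hτ t => ?_⟩, fun τ hτ t ht => ?_⟩, fun τ hτ hz => ?_⟩
  · refine (norm_add_le _ _).trans (add_le_add (hkb τ hτ t) ?_)
    rcases le_total t 0 with h | h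
    · have h0 := hwB τ hτ 0 ⟨le_rfl, hT.le⟩
      rwa [hw0 τ hτ 0 le_rfl, ← hw0 τ hτ t h] at h0
    rcases le_total T t with h' | h'
    · rw [hwT τ hτ t h']; exact hwB τ hτ T ⟨hT.le, le_rfl⟩
    · exact hwB τ hτ t ⟨h, h'⟩
  · change k τ t + w τ t = _
    rw [hw τ hτ t (Ioc_subset_Icc_self ht)]
    congr 1
    exact indicator_of_mem (show t ∈ Ioi (0 : ℝ) from ht.1) _
  · have hUc := hU.cont τ hτ
    have : k τ = fun t => - A (U τ (max t 0 - τ) - ψ (-τ)) := by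
      ext t
      rcases le_or_gt t 0 with h | h
      · rw [hk0 τ t h, max_eq_right h, zero_sub, hU.hist τ hτ (-τ) (by linarith [hτ.1])]
        simp
      · simp only [k]
        rw [indicator_of_mem (show t ∈ Ioi (0 : ℝ) from h), hz, max_eq_left h.le]
        simp
    have hkc : Continuous (k τ) := by rw [this]; fun_prop
    exact hkc.add (hwc τ hτ)

end

/-! ### Integral functionals of `L¹`-differentiable families -/

theorem contDiffOn_one_of_hasDerivWithinAt {b : ℝ} (hb : 0 < b) {j j' : ℝ → ℝ}
    (h : ∀ τ ∈ Icc 0 b, HasDerivWithinAt j (j' τ) (Icc 0 b) τ) (hc : ContinuousOn j' (Icc 0 b)) :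
    ContDiffOn ℝ 1 j (Icc 0 b) := by
  have hu := uniqueDiffOn_Icc hb
  rw [← zero_add (1 : WithTop ℕ∞), contDiffOn_succ_iff_derivWithin hu]
  refine ⟨fun τ hτ => (h τ hτ).differentiableWithinAt, by simp, contDiffOn_zero.2 ?_⟩
  exact hc.congr fun τ hτ => (h τ hτ).derivWithin (hu τ hτ)

/-- A bounded function that is small in `L¹` pairs to something small with a square integrable
function. The weight `Λ` separates small from large values of `ξ`. -/
theorem integral_mul_le_of_sq_integrable {T c Λ : ℝ} (hT : 0 ≤ T) (hΛ : 0 < Λ) {a d : ℝ → ℝ}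
    (ha : IntervalIntegrable (fun t => a t ^ 2) volume 0 T) (hd : IntervalIntegrable d volume 0 T)
    (hd0 : ∀ t, 0 ≤ d t) (hdc : ∀ t ∈ Icc 0 T, d t ≤ c)
    (hi : IntervalIntegrable (fun t => a t * d t) volume 0 T) :
    ∫ t in (0 : ℝ)..T, a t * d t ≤
      Λ * (∫ t in (0 : ℝ)..T, d t) + c / Λ * ∫ t in (0 : ℝ)..T, a t ^ 2 := by
  rw [← intervalIntegral.integral_const_mul, ← intervalIntegral.integral_const_mul,
    ← intervalIntegral.integral_add (hd.const_mul _) (ha.const_mul _)]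
  refine intervalIntegral.integral_mono_on hT hi ((hd.const_mul _).add (ha.const_mul _))
    fun t ht => ?_
  have h1 := hd0 t
  have h2 := hdc t ht
  have hc : 0 ≤ c := h1.trans h2
  rcases le_total (a t) Λ with h | h
  · have h3 := mul_le_mul_of_nonneg_right h h1
    have : 0 ≤ c / Λ * a t ^ 2 := by positivity
    linarith
  · have h3 : a t * d t ≤ a t * c := mul_le_mul_of_nonneg_left h2 (hΛ.le.trans h)
    have h4 : a t * c ≤ c / Λ * a t ^ 2 := by
      rw [div_mul_eq_mul_div, le_div_iff₀ hΛ]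
      nlinarith [mul_nonneg hc (hΛ.le.trans h)]
    have : 0 ≤ Λ * d t := by positivity
    linarith

theorem hasDerivWithinAt_integral_of_hasL1Deriv {V : Type*} [NormedAddCommGroup V]
    [NormedSpace ℝ V] [FiniteDimensional ℝ V] {b T : ℝ} (hT : 0 ≤ T) {U Z : ℝ → ℝ → V}
    (hU : ∀ τ ∈ Icc 0 b, StronglyMeasurable (U τ)) (hZ : ∀ τ ∈ Icc 0 b, StronglyMeasurable (Z τ))
    {M N C : ℝ} (hM : ∀ τ ∈ Icc 0 b, ∀ t, ‖U τ t‖ ≤ M) (hN : ∀ τ ∈ Icc 0 b, ∀ t, ‖Z τ t‖ ≤ N)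
    (hC0 : 0 ≤ C)
    (hC : ∀ τ ∈ Icc 0 b, ∀ τ' ∈ Icc 0 b, ∀ t ≤ T, ‖U τ' t - U τ t‖ ≤ C * |τ' - τ|)
    (hUZ : HasL1Deriv b T U Z) (hZc : IsL1Continuous b T Z) {P : V → ℝ} (hP : ContDiff ℝ 1 P)
    {ξ : ℝ → V →L[ℝ] ℝ} (hξ : MemLp ξ 2 (volume.restrict (Ioc 0 T))) :
    (∀ τ ∈ Icc 0 b, HasDerivWithinAt (fun τ => ∫ t in (0 : ℝ)..T, (P (U τ t) + ξ t (U τ t)))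
      (∫ t in (0 : ℝ)..T, (fderiv ℝ P (U τ t) (Z τ t) + ξ t (Z τ t))) (Icc 0 b) τ) ∧
    ContinuousOn (fun τ => ∫ t in (0 : ℝ)..T, (fderiv ℝ P (U τ t) (Z τ t) + ξ t (Z τ t)))
      (Icc 0 b) := by
  obtain ⟨K, hK0, hK, -⟩ := exists_lipschitz_on_ball hP M
  have hDP := hP.continuous_fderiv one_ne_zero
  have hDPc : ∀ τ ∈ Icc 0 b, StronglyMeasurable (fun t => fderiv ℝ P (U τ t)) := fun τ hτ =>
    hDP.comp_stronglyMeasurable (hU τ hτ)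
  have hL : ∀ τ ∈ Icc 0 b, MemLp (fun t => fderiv ℝ P (U τ t) + ξ t) 2
      (volume.restrict (Ioc 0 T)) := fun τ hτ =>
    (MemLp.of_bound (hDPc τ hτ).aestronglyMeasurable K
      (Eventually.of_forall fun t => hK _ (hM τ hτ t))).add hξ
  have hsq : ∀ ζ : ℝ → V →L[ℝ] ℝ, MemLp ζ 2 (volume.restrict (Ioc 0 T)) →
      IntervalIntegrable (fun t => ‖ζ t‖ ^ 2) volume 0 T := fun ζ hζ => by
    rw [intervalIntegrable_iff_integrableOn_Ioc_of_le hT]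
    exact hζ.integrable_norm_pow two_ne_zero
  have happ : ∀ ζ : ℝ → V →L[ℝ] ℝ, MemLp ζ 2 (volume.restrict (Ioc 0 T)) → ∀ u : ℝ → V,
      StronglyMeasurable u → ∀ B, (∀ t, ‖u t‖ ≤ B) →
      IntervalIntegrable (fun t => ζ t (u t)) volume 0 T ∧
      IntervalIntegrable (fun t => ‖ζ t‖ * ‖u t‖) volume 0 T := fun ζ hζ u hu B hB => by
    rw [intervalIntegrable_iff_integrableOn_Ioc_of_le hT,
      intervalIntegrable_iff_integrableOn_Ioc_of_le hT]
    have h1 : IntegrableOn ζ (Ioc 0 T) := hζ.integrable one_le_two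
    have h2 := h1.norm.mul_const B
    have h3 : ∀ t, ‖ζ t‖ * ‖u t‖ ≤ ‖ζ t‖ * B := fun t =>
      mul_le_mul_of_nonneg_left (hB t) (norm_nonneg _)
    refine ⟨h2.mono' ?_ (Eventually.of_forall fun t => ((ζ t).le_opNorm _).trans (h3 t)),
      h2.mono' (h1.aestronglyMeasurable.norm.mul hu.aestronglyMeasurable.norm)
      (Eventually.of_forall fun t => ?_)⟩
    · exact isBoundedBilinearMap_apply.continuous.comp_aestronglyMeasurable
        (h1.aestronglyMeasurable.prodMk hu.aestronglyMeasurable)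
    · rw [Real.norm_of_nonneg (by positivity)]; exact h3 t
  have hPi : ∀ τ ∈ Icc 0 b, IntervalIntegrable (fun t => P (U τ t)) volume 0 T := fun τ hτ => by
    have : ProperSpace V := FiniteDimensional.proper ℝ V
    obtain ⟨B, hB⟩ := (isCompact_closedBall (0 : V) M).exists_bound_of_continuousOn
      hP.continuous.continuousOn
    exact intervalIntegrable_of_measurable_of_bounded
      (hP.continuous.comp_stronglyMeasurable (hU τ hτ))
      (fun t => hB _ (by simpa using hM τ hτ t)) _ _
  have hCη : ∀ τ, ∀ η > 0, ∀ᶠ τ' in 𝓝[Icc 0 b] τ, C * |τ' - τ| < η := fun τ η hη => by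
    have : Tendsto (fun τ' : ℝ => C * |τ' - τ|) (𝓝[Icc 0 b] τ) (𝓝 (C * |τ - τ|)) :=
      ((by fun_prop : Continuous fun τ' : ℝ => C * |τ' - τ|).tendsto τ).mono_left nhdsWithin_le_nhds
    rw [sub_self, abs_zero, mul_zero] at this
    exact this.eventually (gt_mem_nhds hη)
  refine ⟨fun τ hτ => ?_, fun τ hτ => ?_⟩
  · have hN0 : 0 ≤ N := (norm_nonneg _).trans (hN τ hτ 0)
    set L : ℝ → V →L[ℝ] ℝ := fun t => fderiv ℝ P (U τ t) + ξ t with hLdef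
    set Q : ℝ := ∫ t in (0 : ℝ)..T, ‖L t‖ ^ 2 with hQ
    have hQ0 : 0 ≤ Q := intervalIntegral.integral_nonneg hT fun t _ => by positivity
    refine .of_isLittleO (Asymptotics.isLittleO_iff.2 fun ε' hε' => ?_)
    obtain ⟨ε, hε, hεε'⟩ : ∃ ε > 0, ε * (T * C + 2) ≤ ε' :=
      ⟨ε' / (T * C + 2), by positivity, le_of_eq (by field_simp)⟩
    obtain ⟨Λ, hΛ, hΛQ⟩ : ∃ Λ > 0, (C + N) / Λ * Q ≤ ε := by
      refine ⟨((C + N) * Q + 1) / ε, by positivity, ?_⟩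
      rw [div_div_eq_mul_div, div_mul_eq_mul_div, div_le_iff₀ (by positivity)]
      nlinarith
    obtain ⟨η, hη, hmod⟩ := exists_fderiv_modulus_on_ball hP M hε
    filter_upwards [self_mem_nhdsWithin, hCη τ η hη, hUZ τ hτ (ε / Λ) (by positivity)]
      with τ' hτ' hη' hUZ'
    set h := τ' - τ with hh
    set δ : ℝ → V := fun t => U τ' t - U τ t - h • Z τ t with hδ
    have hδm : StronglyMeasurable δ :=
      ((hU τ' hτ').sub (hU τ hτ)).sub ((hZ τ hτ).const_smul h)
    have hδM : ∀ t, ‖δ t‖ ≤ M + M + |h| * N := fun t => by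
      refine (norm_sub_le _ _).trans (add_le_add ((norm_sub_le _ _).trans
        (add_le_add (hM τ' hτ' t) (hM τ hτ t))) ?_)
      rw [norm_smul, Real.norm_eq_abs]
      exact mul_le_mul_of_nonneg_left (hN τ hτ t) (abs_nonneg _)
    have hδc : ∀ t ∈ Icc 0 T, ‖δ t‖ ≤ (C + N) * |h| := fun t ht => by
      refine (norm_sub_le _ _).trans ?_
      rw [norm_smul, Real.norm_eq_abs, add_mul, mul_comm N]
      exact add_le_add (hC τ hτ τ' hτ' t ht.2)
        (mul_le_mul_of_nonneg_left (hN τ hτ t) (abs_nonneg _))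
    have hpair := integral_mul_le_of_sq_integrable hT hΛ (hsq L (hL τ hτ))
      (intervalIntegrable_of_measurable_of_bounded hδm hδM 0 T).norm (fun t => norm_nonneg _) hδc
      (happ L (hL τ hτ) δ hδm _ hδM).2
    have i1 := (hPi τ' hτ').add (happ ξ hξ _ (hU τ' hτ') _ (hM τ' hτ')).1
    have i2 := (hPi τ hτ).add (happ ξ hξ _ (hU τ hτ) _ (hM τ hτ)).1
    have i3 : IntervalIntegrable (fun t => h • (fderiv ℝ P (U τ t) (Z τ t) + ξ t (Z τ t)))
        volume 0 T := (happ L (hL τ hτ) _ (hZ τ hτ) _ (hN τ hτ)).1.smul h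
    rw [← intervalIntegral.integral_smul, ← intervalIntegral.integral_sub i1 i2,
      ← intervalIntegral.integral_sub (i1.sub i2) i3]
    have hbd : ∀ t ∈ Ioc 0 T, ‖P (U τ' t) + ξ t (U τ' t) - (P (U τ t) + ξ t (U τ t)) -
        h • (fderiv ℝ P (U τ t) (Z τ t) + ξ t (Z τ t))‖ ≤ ε * (C * |h|) + ‖L t‖ * ‖δ t‖ := by
      intro t ht
      have e : P (U τ' t) + ξ t (U τ' t) - (P (U τ t) + ξ t (U τ t)) -
          h • (fderiv ℝ P (U τ t) (Z τ t) + ξ t (Z τ t)) =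
          (P (U τ' t) - P (U τ t) - fderiv ℝ P (U τ t) (U τ' t - U τ t)) + L t (δ t) := by
        simp only [hLdef, hδ, _root_.add_apply, map_sub, map_smul, smul_add]
        abel
      rw [e]
      have h1 := hC τ hτ τ' hτ' t ht.2
      have h2 := (hmod _ _ (hM τ hτ t) (hM τ' hτ' t) (h1.trans_lt hη')).2
      exact (norm_add_le _ _).trans (add_le_add (h2.trans (by gcongr)) ((L t).le_opNorm _))
    refine (intervalIntegral.norm_integral_le_of_norm_le hT (Eventually.of_forall hbd)
      (intervalIntegrable_const.add (happ L (hL τ hτ) δ hδm _ hδM).2)).trans ?_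
    rw [intervalIntegral.integral_add intervalIntegrable_const
      (happ L (hL τ hτ) δ hδm _ hδM).2, intervalIntegral.integral_const, sub_zero, smul_eq_mul,
      Real.norm_eq_abs]
    have h3 : Λ * (∫ t in (0 : ℝ)..T, ‖δ t‖) ≤ ε * |h| := by
      calc _ ≤ Λ * (ε / Λ * |h|) := by gcongr
        _ = _ := by field_simp
    have h4 : (C + N) * |h| / Λ * Q ≤ ε * |h| := by
      calc _ = (C + N) / Λ * Q * |h| := by ring
        _ ≤ _ := by gcongr
    have h5 : ε * (T * C + 2) * |h| ≤ ε' * |h| := by gcongr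
    nlinarith
  · have hN0 : 0 ≤ N := (norm_nonneg _).trans (hN τ hτ 0)
    set L : ℝ → V →L[ℝ] ℝ := fun t => fderiv ℝ P (U τ t) + ξ t with hLdef
    set Q : ℝ := ∫ t in (0 : ℝ)..T, ‖L t‖ ^ 2 with hQ
    have hQ0 : 0 ≤ Q := intervalIntegral.integral_nonneg hT fun t _ => by positivity
    refine Metric.tendsto_nhds.2 fun ε' hε' => ?_
    obtain ⟨ε, hε, hεε'⟩ : ∃ ε > 0, ε * (T * N + 2) < ε' :=
      ⟨ε' / 2 / (T * N + 2), by positivity, by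
        rw [div_mul_cancel₀ _ (by positivity)]; linarith⟩
    obtain ⟨Λ, hΛ, hΛQ⟩ : ∃ Λ > 0, (N + N) / Λ * Q ≤ ε := by
      refine ⟨((N + N) * Q + 1) / ε, by positivity, ?_⟩
      rw [div_div_eq_mul_div, div_mul_eq_mul_div, div_le_iff₀ (by positivity)]
      nlinarith
    obtain ⟨η, hη, hmod⟩ := exists_fderiv_modulus_on_ball hP M hε
    filter_upwards [self_mem_nhdsWithin, hCη τ η hη, hZc τ hτ (ε / Λ) (by positivity)]
      with τ' hτ' hη' hZ'
    set δ : ℝ → V := fun t => Z τ' t - Z τ t with hδ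
    have hδm : StronglyMeasurable δ := (hZ τ' hτ').sub (hZ τ hτ)
    have hδM : ∀ t, ‖δ t‖ ≤ N + N := fun t =>
      (norm_sub_le _ _).trans (add_le_add (hN τ' hτ' t) (hN τ hτ t))
    have hpair := integral_mul_le_of_sq_integrable hT hΛ (hsq L (hL τ hτ))
      (intervalIntegrable_of_measurable_of_bounded hδm hδM 0 T).norm (fun t => norm_nonneg _)
      (fun t _ => hδM t) (happ L (hL τ hτ) δ hδm _ hδM).2
    have i1 : IntervalIntegrable (fun t => fderiv ℝ P (U τ' t) (Z τ' t) + ξ t (Z τ' t))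
        volume 0 T := (happ _ (hL τ' hτ') _ (hZ τ' hτ') _ (hN τ' hτ')).1
    have i2 : IntervalIntegrable (fun t => fderiv ℝ P (U τ t) (Z τ t) + ξ t (Z τ t))
        volume 0 T := (happ _ (hL τ hτ) _ (hZ τ hτ) _ (hN τ hτ)).1
    rw [Real.dist_eq, ← Real.norm_eq_abs, ← intervalIntegral.integral_sub i1 i2]
    have hbd : ∀ t ∈ Ioc 0 T, ‖fderiv ℝ P (U τ' t) (Z τ' t) + ξ t (Z τ' t) -
        (fderiv ℝ P (U τ t) (Z τ t) + ξ t (Z τ t))‖ ≤ ε * N + ‖L t‖ * ‖δ t‖ := by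
      intro t ht
      have e : fderiv ℝ P (U τ' t) (Z τ' t) + ξ t (Z τ' t) -
          (fderiv ℝ P (U τ t) (Z τ t) + ξ t (Z τ t)) =
          (fderiv ℝ P (U τ' t) - fderiv ℝ P (U τ t)) (Z τ' t) + L t (δ t) := by
        simp only [hLdef, hδ, _root_.add_apply, _root_.sub_apply, map_sub]
        abel
      rw [e]
      have h1 := hC τ hτ τ' hτ' t ht.2
      have h2 := (hmod _ _ (hM τ hτ t) (hM τ' hτ' t) (h1.trans_lt hη')).1
      exact (norm_add_le _ _).trans (add_le_add
        (ContinuousLinearMap.le_of_opNorm_le_of_le _ h2 (hN τ' hτ' t)) ((L t).le_opNorm _))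
    refine (intervalIntegral.norm_integral_le_of_norm_le hT (Eventually.of_forall hbd)
      (intervalIntegrable_const.add (happ L (hL τ hτ) δ hδm _ hδM).2)).trans_lt ?_
    rw [intervalIntegral.integral_add intervalIntegrable_const
      (happ L (hL τ hτ) δ hδm _ hδM).2, intervalIntegral.integral_const, sub_zero, smul_eq_mul]
    have h3 : Λ * (∫ t in (0 : ℝ)..T, ‖δ t‖) ≤ ε := by
      calc _ ≤ Λ * (ε / Λ) := by gcongr
        _ = _ := by field_simp
    nlinarith

/-! ### Weak derivatives in one dimension -/

theorem IsCompact.exists_subset_Icc_of_subset_Ioo {K : Set ℝ} (hK : IsCompact K) {a c : ℝ}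
    (hac : a < c) (h : K ⊆ Ioo a c) : ∃ p q, a < p ∧ q < c ∧ K ⊆ Icc p q := by
  rcases K.eq_empty_or_nonempty with rfl | hne
  · exact ⟨(a + c) / 2, (a + c) / 2, by linarith, by linarith, empty_subset _⟩
  · obtain ⟨p, hp⟩ := hK.exists_isLeast hne
    obtain ⟨q, hq⟩ := hK.exists_isGreatest hne
    exact ⟨p, q, (h hp.1).1, (h hq.1).2, fun x hx => ⟨hp.2 hx, hq.2 hx⟩⟩

section
variable {n : ℕ} {a c : ℝ} {u v : ℝ → EuclideanSpace ℝ (Fin n)}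

theorem hasWeakDerivOn_of_eq_integral (hac : a < c) (hv : IntervalIntegrable v volume a c)
    (C : EuclideanSpace ℝ (Fin n)) (hu : ∀ t ∈ Ioo a c, u t = C + ∫ s in a..t, v s) :
    HasWeakDerivOn a c u v := by
  intro ψ hψ _ hsupp
  have hψa : ψ a = 0 := image_eq_zero_of_notMem_tsupport fun h => lt_irrefl _ (hsupp h).1
  have hψc : ψ c = 0 := image_eq_zero_of_notMem_tsupport fun h => lt_irrefl _ (hsupp h).2
  have hψ' : Continuous (deriv ψ) := hψ.continuous_deriv (by simp)
  have hprim : ContinuousOn (fun t => ∫ s in a..t, v s) (uIcc a c) :=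
    intervalIntegral.continuousOn_primitive_interval' hv left_mem_uIcc
  rw [setIntegral_congr_fun measurableSet_Ioo
      (g := fun t => deriv ψ t • (C + ∫ s in a..t, v s)) (fun t ht => by simp only [hu t ht]),
    ← integral_Ioc_eq_integral_Ioo, ← integral_Ioc_eq_integral_Ioo,
    ← intervalIntegral.integral_of_le hac.le, ← intervalIntegral.integral_of_le hac.le]
  have i1 : IntervalIntegrable (fun t => deriv ψ t • (C + ∫ s in a..t, v s)) volume a c :=
    (hψ'.continuousOn.smul (continuousOn_const.add hprim)).intervalIntegrable
  have i2 : IntervalIntegrable (fun t => ψ t • v t) volume a c :=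
    hv.continuousOn_smul hψ.continuous.continuousOn
  ext i
  have e1 : ∀ w : ℝ → EuclideanSpace ℝ (Fin n), ∀ t ∈ uIcc a c, IntervalIntegrable w volume a c →
      (∫ s in a..t, w s) i = ∫ s in a..t, w s i := fun w t ht hw =>
    ((EuclideanSpace.proj (𝕜 := ℝ) i).intervalIntegral_comp_comm
      (hw.mono_set (uIcc_subset_uIcc left_mem_uIcc ht))).symm
  have hvi : IntervalIntegrable (fun t => v t i) volume a c :=
    ⟨(EuclideanSpace.proj (𝕜 := ℝ) i).integrable_comp hv.1,
      (EuclideanSpace.proj (𝕜 := ℝ) i).integrable_comp hv.2⟩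
  rw [PiLp.neg_apply, e1 _ c right_mem_uIcc i1, e1 _ c right_mem_uIcc i2]
  have hψac : AbsolutelyContinuousOnInterval ψ a c :=
    ((hψ.of_le (by simp)).contDiffOn).absolutelyContinuousOnInterval
  have hpac := hvi.absolutelyContinuousOnInterval_intervalIntegral left_mem_uIcc
  have hibp := hψac.integral_mul_deriv_eq_deriv_mul hpac
  rw [hψa, hψc, zero_mul, zero_mul, sub_self, zero_sub] at hibp
  have e2 : ∫ t in a..c, ψ t * deriv (fun t => ∫ s in a..t, v s i) t = ∫ t in a..c, ψ t * v t i := by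
    refine intervalIntegral.integral_congr_ae ?_
    filter_upwards [hvi.ae_hasDerivAt_integral] with t ht ht'
    rw [(ht (uIoc_subset_uIcc ht') a left_mem_uIcc).deriv]
  have e3 : ∫ t in a..c, (deriv ψ t • (C + ∫ s in a..t, v s)) i =
      (∫ t in a..c, deriv ψ t * C i) + ∫ t in a..c, deriv ψ t * ∫ s in a..t, v s i := by
    have j1 : IntervalIntegrable (fun t => deriv ψ t * C i) volume a c :=
      Continuous.intervalIntegrable (by fun_prop) _ _
    have j2 : IntervalIntegrable (fun t => deriv ψ t * ∫ s in a..t, v s i) volume a c :=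
      (hψ'.continuousOn.mul hpac.continuousOn).intervalIntegrable
    rw [← intervalIntegral.integral_add j1 j2]
    refine intervalIntegral.integral_congr fun t ht => ?_
    simp only [PiLp.smul_apply, PiLp.add_apply, smul_eq_mul, mul_add, e1 v t ht hv]
  have e4 : ∫ t in a..c, deriv ψ t * C i = 0 := by
    rw [intervalIntegral.integral_mul_const, intervalIntegral.integral_deriv_eq_sub
      (fun t _ => (hψ.differentiable (by simp)) t) (hψ'.intervalIntegrable _ _), hψa, hψc]
    simp
  rw [e3, e4, zero_add]
  simp only [PiLp.smul_apply, smul_eq_mul]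
  rw [← e2, hibp, neg_neg]

/-- A smooth function with vanishing integral and compact support in `(a, c)` is the derivative
of a test function. -/
theorem exists_test_primitive (hac : a < c) {χ : ℝ → ℝ} (hχ : ContDiff ℝ ∞ χ)
    (hχc : HasCompactSupport χ) (hsupp : tsupport χ ⊆ Ioo a c) (h0 : ∫ t, χ t = 0) :
    ∃ ψ : ℝ → ℝ, ContDiff ℝ ∞ ψ ∧ HasCompactSupport ψ ∧ tsupport ψ ⊆ Ioo a c ∧ deriv ψ = χ := by
  obtain ⟨p, q, hp, hq, hpq⟩ := hχc.isCompact.exists_subset_Icc_of_subset_Ioo hac hsupp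
  have hd : ∀ t, HasDerivAt (fun t => ∫ s in a..t, χ s) (χ t) t := fun t =>
    intervalIntegral.integral_hasDerivAt_right (hχ.continuous.intervalIntegrable _ _)
      (hχ.continuous.stronglyMeasurableAtFilter _ _) hχ.continuous.continuousAt
  have hd' : deriv (fun t => ∫ s in a..t, χ s) = χ := funext fun t => (hd t).deriv
  have hs : Function.support χ ⊆ Icc p q := (subset_tsupport χ).trans hpq
  have hsub : Function.support (fun t => ∫ s in a..t, χ s) ⊆ Icc p q := by
    intro t ht
    by_contra hout
    apply ht
    rcases lt_or_ge t p with h | h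
    · have : ∀ s ∈ uIcc a t, χ s = (fun _ => (0 : ℝ)) s := fun s hs' => by
        by_contra hne
        have h1 := (hs (show s ∈ Function.support χ from hne)).1
        exact absurd (hs'.2.trans (sup_le hp.le h.le)) (not_le.2 (lt_of_le_of_ne h1 (by
          rintro rfl
          exact absurd hs'.2 (not_le.2 (max_lt hp h)))))
      change ∫ s in a..t, χ s = 0
      rw [intervalIntegral.integral_congr this]; simp
    · have hqt : q < t := by
        by_contra hle
        exact hout ⟨h, not_lt.1 hle⟩
      change ∫ s in a..t, χ s = 0
      rw [intervalIntegral.integral_eq_integral_of_support_subset, h0]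
      exact fun s hs' => ⟨hp.trans_le (hs hs').1, (hs hs').2.trans hqt.le⟩
  refine ⟨fun t => ∫ s in a..t, χ s, ?_, HasCompactSupport.of_support_subset_isCompact
    isCompact_Icc hsub, ?_, hd'⟩
  · rw [contDiff_infty_iff_deriv, hd']
    exact ⟨fun t => (hd t).differentiableAt, hχ⟩
  · exact (closure_minimal hsub isClosed_Icc).trans
      fun s hs' => ⟨hp.trans_le hs'.1, hs'.2.trans_lt hq⟩

/-- The lemma of du Bois-Reymond: a function with a weak derivative is, up to a null set, a
primitive of it. -/
theorem HasWeakDerivOn.ae_eq_integral (h : HasWeakDerivOn a c u v) (hac : a < c)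
    (hu : IntegrableOn u (Ioo a c)) (hv : IntervalIntegrable v volume a c) :
    ∃ C, ∀ᵐ t, t ∈ Ioo a c → u t = C + ∫ s in a..t, v s := by
  set p : ℝ → EuclideanSpace ℝ (Fin n) := fun t => ∫ s in a..t, v s with hp
  have hpc : ContinuousOn p (uIcc a c) :=
    intervalIntegral.continuousOn_primitive_interval' hv left_mem_uIcc
  have hpi : IntegrableOn p (Ioo a c) := by
    rw [uIcc_of_le hac.le] at hpc
    exact (hpc.integrableOn_compact isCompact_Icc).mono_set Ioo_subset_Icc_self
  have hwi : IntegrableOn (fun t => u t - p t) (Ioo a c) := hu.sub hpi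
  have hmul : ∀ θ : ℝ → ℝ, Continuous θ → ∀ z : ℝ → EuclideanSpace ℝ (Fin n),
      IntegrableOn z (Ioo a c) → IntegrableOn (fun t => θ t • z t) (Ioo a c) := fun θ hθ z hz =>
    hz.continuousOn_smul_of_subset hθ.continuousOn isCompact_Icc
      measurableSet_Ioo Ioo_subset_Icc_self
  -- the difference of `u` and the primitive has vanishing weak derivative
  have hzero : ∀ χ : ℝ → ℝ, ContDiff ℝ ∞ χ → HasCompactSupport χ → tsupport χ ⊆ Ioo a c →
      ∫ t, χ t = 0 → ∫ t in Ioo a c, χ t • (u t - p t) = 0 := fun χ hχ hχc hχs h0 => by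
    obtain ⟨ψ, hψ, hψc, hψs, rfl⟩ := exists_test_primitive hac hχ hχc hχs h0
    have h1 := h ψ hψ hψc hψs
    have h2 : HasWeakDerivOn a c p v :=
      hasWeakDerivOn_of_eq_integral hac hv 0 fun t _ => by simp [hp]
    have h3 := h2 ψ hψ hψc hψs
    simp only [smul_sub]
    rw [integral_sub (hmul _ hχ.continuous _ hu) (hmul _ hχ.continuous _ hpi), h1, h3, sub_self]
  obtain ⟨f, hfs, hfc, hf, hf1⟩ : ∃ f : ℝ → ℝ, tsupport f ⊆ Ioo a c ∧ HasCompactSupport f ∧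
      ContDiff ℝ ∞ f ∧ ∫ t, f t = 1 := by
    let B : ContDiffBump ((a + c) / 2) := ⟨(c - a) / 8, (c - a) / 4, by linarith, by linarith⟩
    refine ⟨B.normed volume, ?_, B.hasCompactSupport_normed, B.contDiff_normed, B.integral_normed⟩
    rw [B.tsupport_normed_eq, Real.closedBall_eq_Icc]
    intro t ht
    have h1 := ht.1
    have h2 := ht.2
    change (a + c) / 2 - (c - a) / 4 ≤ t at h1
    change t ≤ (a + c) / 2 + (c - a) / 4 at h2
    exact ⟨by linarith, by linarith⟩
  set C := ∫ t in Ioo a c, f t • (u t - p t) with hC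
  refine ⟨C, ?_⟩
  have hae := isOpen_Ioo.ae_eq_zero_of_integral_contDiff_smul_eq_zero (μ := volume)
    (U := Ioo a c) (f := fun t => u t - p t - C)
    ((hwi.sub (integrableOn_const (by simp))).locallyIntegrableOn) fun θ hθ hθc hθs => by
      have hset : ∫ t, θ t • (u t - p t - C) = ∫ t in Ioo a c, θ t • (u t - p t - C) := by
        refine (setIntegral_eq_integral_of_forall_compl_eq_zero fun t ht => ?_).symm
        rw [image_eq_zero_of_notMem_tsupport fun h => ht (hθs h), zero_smul]
      have hθi : ∫ t in Ioo a c, θ t = ∫ t, θ t :=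
        setIntegral_eq_integral_of_forall_compl_eq_zero fun t ht =>
          image_eq_zero_of_notMem_tsupport fun h => ht (hθs h)
      have hχ := hzero (fun t => θ t - (∫ s, θ s) * f t) (hθ.sub (contDiff_const.mul hf))
        (hθc.sub hfc.mul_left) ((tsupport_sub _ _).trans (union_subset hθs
          ((tsupport_mul_subset_right).trans hfs))) (by
            rw [integral_sub (hθ.continuous.integrable_of_hasCompactSupport hθc)
              ((hf.continuous.integrable_of_hasCompactSupport hfc).const_mul _),
              integral_const_mul, hf1, mul_one, sub_self])
      have i1 := hmul θ hθ.continuous _ hwi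
      have i2 := hmul f hf.continuous _ hwi
      have i3 : IntegrableOn (fun t => (∫ s, θ s) • f t • (u t - p t)) (Ioo a c) :=
        Integrable.smul (∫ s, θ s) i2
      simp only [sub_smul, mul_smul] at hχ
      rw [integral_sub i1 i3, integral_smul, ← hC] at hχ
      rw [hset]
      simp only [smul_sub _ _ C]
      rw [integral_sub i1 ((hθ.continuous.integrable_of_hasCompactSupport hθc).integrableOn.smul_const C),
        integral_smul_const, hθi]
      exact hχ
  filter_upwards [hae] with t ht ht'
  have := sub_eq_zero.1 (ht ht')
  rw [← this]
  simp [hp]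

theorem IsL2.integrableOn (hv : IsL2 a c v) : IntegrableOn v (Ioo a c) :=
  MemLp.integrable one_le_two hv

theorem IsL2.intervalIntegrable (hv : IsL2 a c v) (hac : a ≤ c) :
    IntervalIntegrable v volume a c :=
  (intervalIntegrable_iff_integrableOn_Ioo_of_le hac).2 hv.integrableOn

theorem HasWeakDerivOn.eq_add_integral (h : HasWeakDerivOn a c u v) (hac : a < c)
    (hu : ContinuousOn u (Icc a c)) (hv : IntervalIntegrable v volume a c) :
    ∀ t ∈ Icc a c, u t = u a + ∫ s in a..t, v s := by
  obtain ⟨C, hC⟩ := h.ae_eq_integral hac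
    ((hu.integrableOn_compact isCompact_Icc).mono_set Ioo_subset_Icc_self) hv
  have hpc : ContinuousOn (fun t => C + ∫ s in a..t, v s) (Icc a c) := by
    have := intervalIntegral.continuousOn_primitive_interval' hv left_mem_uIcc
    rw [uIcc_of_le hac.le] at this
    exact continuousOn_const.add this
  have heq : EqOn u (fun t => C + ∫ s in a..t, v s) (Icc a c) := by
    refine Measure.eqOn_Icc_of_ae_eq volume hac.ne ?_ hu hpc
    rw [← restrict_Ioo_eq_restrict_Icc]
    exact (ae_restrict_iff' measurableSet_Ioo).2 hC
  intro t ht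
  have h0 := heq (left_mem_Icc.2 hac.le)
  simp only [intervalIntegral.integral_same, add_zero] at h0
  rw [h0]
  exact heq ht

end

/-! ### Global solutions of the delay equation -/

/-- `x` solves the delay equation in integrated form, with history `ψ` on `(-∞, 0]` and with
`G` in place of the integral of the inhomogeneity. The value `x T` is kept beyond `T`. -/
structure IsMildSolution {V : Type*} [NormedAddCommGroup V] [NormedSpace ℝ V] (T : ℝ)
    (A : V →L[ℝ] V) (f : V → V) (ψ G : ℝ → V) (τ : ℝ) (x : ℝ → V) : Prop where
  cont : Continuous x
  hist : ∀ t ≤ 0, x t = ψ t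
  const : ∀ t ≥ T, x t = x T
  eq : ∀ t ∈ Icc 0 T, x t = ψ 0 + G t + ∫ s in (0 : ℝ)..t, (-f (x s) + A (x (s - τ)))

section
variable {V : Type*} [NormedAddCommGroup V] [InnerProductSpace ℝ V]

theorem inner_sub_ge_of_fderiv {f : V → V} (hf : Differentiable ℝ f) {lam : ℝ}
    (h : ∀ x v : V, 0 ≤ inner ℝ (fderiv ℝ f x v + lam • v) v) (x y : V) :
    -lam * ‖x - y‖ ^ 2 ≤ inner ℝ (f x - f y) (x - y) := by
  set v := x - y with hv
  have hd : ∀ s : ℝ, HasDerivAt (fun s : ℝ => inner ℝ (f (y + s • v)) v + lam * ‖v‖ ^ 2 * s)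
      (inner ℝ (fderiv ℝ f (y + s • v) v + lam • v) v) s := fun s => by
    have h1 : HasDerivAt (fun s : ℝ => y + s • v) v s := by
      simpa using ((hasDerivAt_id s).smul_const v).const_add y
    have h2 := (hf (y + s • v)).hasFDerivAt.comp_hasDerivAt s h1
    have h3 := (h2.inner ℝ (hasDerivAt_const s v)).add
      ((hasDerivAt_id s).const_mul (lam * ‖v‖ ^ 2))
    refine h3.congr_deriv ?_
    rw [inner_add_left, inner_smul_left, real_inner_self_eq_norm_sq]
    simp
  have hmono : Monotone (fun s : ℝ => inner ℝ (f (y + s • v)) v + lam * ‖v‖ ^ 2 * s) :=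
    monotone_of_deriv_nonneg (fun s => (hd s).differentiableAt) fun s => by
      rw [(hd s).deriv]; exact h _ _
  have h01 := hmono zero_le_one
  simp only [zero_smul, add_zero, mul_zero, one_smul, mul_one] at h01
  rw [show y + v = x by rw [hv]; abel] at h01
  rw [inner_sub_left]
  linarith

variable [CompleteSpace V] {T : ℝ}

/-- A priori bound, uniform in the delay `τ` and in a cut-off factor `χ` of the nonlinearity.
With `w = x - G`, which is continuously differentiable, one-sided monotonicity of `f` bounds
`⟨f (w + G) - f G, w⟩` from below, and this lower bound survives multiplication by `χ`. Gronwall's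
inequality for `‖w‖ ^ 2` concludes. -/
theorem exists_bound_of_isMildSolution (A : V →L[ℝ] V) {f : V → V} (hf : Continuous f) {lam : ℝ}
    (hlam : 0 ≤ lam) (hmono : ∀ x y, -lam * ‖x - y‖ ^ 2 ≤ inner ℝ (f x - f y) (x - y))
    {ψ G : ℝ → V} (hG : Continuous G) {Φ : ℝ} (hψ : ∀ t, ‖ψ t‖ ≤ Φ) (hT : 0 ≤ T) :
    ∃ M, 0 ≤ M ∧ ∀ χ : V → ℝ, Continuous χ → (∀ v, χ v ∈ Icc (0 : ℝ) 1) → ∀ τ, 0 ≤ τ →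
      ∀ x, IsMildSolution T A (fun v => χ v • f v) ψ G τ x → ∀ t, ‖x t‖ ≤ M := by
  obtain ⟨γ, hγ⟩ := (isCompact_Icc (a := (0 : ℝ)) (b := T)).exists_bound_of_continuousOn
    hG.continuousOn
  obtain ⟨c, hc⟩ := (isCompact_Icc (a := (0 : ℝ)) (b := T)).exists_bound_of_continuousOn
    (hf.comp hG).continuousOn
  have hΦ0 : 0 ≤ Φ := (norm_nonneg _).trans (hψ 0)
  have hγ0 : 0 ≤ γ := (norm_nonneg _).trans (hγ 0 ⟨le_rfl, hT⟩)
  have hc0 : 0 ≤ c := (norm_nonneg _).trans (hc 0 ⟨le_rfl, hT⟩)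
  set a := ‖A‖ with ha
  set B := c ^ 2 + a ^ 2 * (Φ ^ 2 + 2 * γ ^ 2) with hB
  set K := 2 * lam + 2 + 2 * a ^ 2 with hK
  set S := Real.sqrt ((Φ ^ 2 + T * B) * Real.exp (K * T)) with hS
  refine ⟨Φ + (S + γ), by positivity, fun χ hχ hχ01 τ hτ x hx => ?_⟩
  have hxc := hx.cont
  set q : ℝ → V := fun s => -(χ (x s) • f (x s)) + A (x (s - τ)) with hq
  have hqc : Continuous q := by fun_prop
  set w : ℝ → V := fun t => ψ 0 + ∫ s in (0 : ℝ)..t, q s with hw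
  have hwd : ∀ t, HasDerivAt w (q t) t := fun t =>
    (intervalIntegral.integral_hasDerivAt_right (hqc.intervalIntegrable _ _)
      (hqc.stronglyMeasurableAtFilter _ _) hqc.continuousAt).const_add _
  have hwc : Continuous w := continuous_iff_continuousAt.2 fun t => (hwd t).continuousAt
  have hxw : ∀ t ∈ Icc 0 T, x t = w t + G t := fun t ht => by
    rw [hx.eq t ht]; simp only [hw, hq]; abel
  have hNd : ∀ t, HasDerivAt (fun t => ‖w t‖ ^ 2) (2 * inner ℝ (w t) (q t)) t := fun t =>
    (hwd t).norm_sq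
  have hN : Continuous fun t => ‖w t‖ ^ 2 := by fun_prop
  set δ : ℝ → ℝ := (Ioi (0 : ℝ)).indicator fun t => ‖w t‖ ^ 2 with hδ
  have hδi : ∀ p q, IntervalIntegrable δ volume p q := fun p q =>
    ⟨(hN.intervalIntegrable p q).1.indicator measurableSet_Ioi,
      (hN.intervalIntegrable p q).2.indicator measurableSet_Ioi⟩
  have hδ0 : ∀ t, 0 ≤ δ t := fun t => indicator_nonneg (fun _ _ => by positivity) t
  have hδle : ∀ t, δ t ≤ ‖w t‖ ^ 2 := fun t => indicator_le_self' (fun _ _ => by positivity) t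
  have hδneg : ∀ t ≤ 0, δ t = 0 := fun t ht => indicator_of_notMem (by simpa using ht) _
  have hx2 : ∀ r ≤ T, ‖x r‖ ^ 2 ≤ Φ ^ 2 + 2 * γ ^ 2 + 2 * δ r := fun r hr => by
    rcases le_or_gt r 0 with h | h
    · rw [hx.hist r h, hδneg r h]
      have := hψ r
      have : ‖ψ r‖ ^ 2 ≤ Φ ^ 2 := by gcongr
      nlinarith [sq_nonneg γ]
    · have h1 : δ r = ‖w r‖ ^ 2 := indicator_of_mem (show r ∈ Ioi (0 : ℝ) from h) _
      rw [h1, hxw r ⟨h.le, hr⟩]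
      have h2 := hγ r ⟨h.le, hr⟩
      have h3 : ‖w r + G r‖ ^ 2 ≤ (‖w r‖ + γ) ^ 2 := by
        gcongr; exact (norm_add_le _ _).trans (by gcongr)
      nlinarith [sq_nonneg (‖w r‖ - γ), sq_nonneg Φ]
  have hmain : ∀ s ∈ Icc 0 T, 2 * inner ℝ (w s) (q s) ≤
      (2 * lam + 2) * ‖w s‖ ^ 2 + B + 2 * a ^ 2 * δ (s - τ) := fun s hs => by
    have h1 := hmono (x s) (G s)
    have h2 : x s - G s = w s := by rw [hxw s hs]; abel
    rw [h2, inner_sub_left] at h1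
    have h3 : |inner ℝ (f (G s)) (w s)| ≤ c * ‖w s‖ :=
      (abs_real_inner_le_norm _ _).trans (by gcongr; exact hc s hs)
    have h4 : -(lam * ‖w s‖ ^ 2 + c * ‖w s‖) ≤ inner ℝ (f (x s)) (w s) := by
      have := (abs_le.1 h3).1; linarith
    obtain ⟨c0, c1⟩ := hχ01 (x s)
    have h5 : -(lam * ‖w s‖ ^ 2 + c * ‖w s‖) ≤ χ (x s) * inner ℝ (f (x s)) (w s) := by
      have h6 : 0 ≤ lam * ‖w s‖ ^ 2 + c * ‖w s‖ := by positivity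
      have h7 := mul_le_mul_of_nonneg_left h4 c0
      nlinarith
    have h8 : inner ℝ (w s) (A (x (s - τ))) ≤ ‖w s‖ * (a * ‖x (s - τ)‖) :=
      (real_inner_le_norm _ _).trans (by gcongr; exact A.le_opNorm _)
    have h9 := hx2 (s - τ) (by linarith [hs.2])
    have h10 : inner ℝ (w s) (q s) =
        -(χ (x s) * inner ℝ (f (x s)) (w s)) + inner ℝ (w s) (A (x (s - τ))) := by
      simp only [hq]
      rw [inner_add_right, inner_neg_right, inner_smul_right, real_inner_comm]
    rw [h10]
    have h11 := mul_le_mul_of_nonneg_left h9 (sq_nonneg a)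
    nlinarith [sq_nonneg (‖w s‖ - c), sq_nonneg (‖w s‖ - a * ‖x (s - τ)‖)]
  have hgron : ∀ t ∈ Icc 0 T, ‖w t‖ ^ 2 ≤ (Φ ^ 2 + T * B) +
      K * ∫ s in (0 : ℝ)..t, ‖w s‖ ^ 2 := fun t ht => by
    have hδt : IntervalIntegrable (fun s => δ (s - τ)) volume 0 t := by
      simpa using (hδi (0 - τ) (t - τ)).comp_sub_right τ
    have hNi := hN.intervalIntegrable (μ := volume) 0 t
    have e1 : ∫ s in (0 : ℝ)..t, 2 * inner ℝ (w s) (q s) = ‖w t‖ ^ 2 - ‖w 0‖ ^ 2 :=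
      intervalIntegral.integral_eq_sub_of_hasDerivAt (fun s _ => hNd s)
        (Continuous.intervalIntegrable (by fun_prop) _ _)
    have e2 : ∫ s in (0 : ℝ)..t, 2 * inner ℝ (w s) (q s) ≤
        ∫ s in (0 : ℝ)..t, ((2 * lam + 2) * ‖w s‖ ^ 2 + B + 2 * a ^ 2 * δ (s - τ)) :=
      intervalIntegral.integral_mono_on ht.1 (Continuous.intervalIntegrable (by fun_prop) _ _)
        (((hNi.const_mul _).add intervalIntegrable_const).add (hδt.const_mul _))
        fun s hs => hmain s ⟨hs.1, hs.2.trans ht.2⟩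
    rw [e1, intervalIntegral.integral_add ((hNi.const_mul _).add intervalIntegrable_const)
      (hδt.const_mul _), intervalIntegral.integral_add (hNi.const_mul _) intervalIntegrable_const,
      intervalIntegral.integral_const_mul, intervalIntegral.integral_const_mul,
      intervalIntegral.integral_const, sub_zero, smul_eq_mul] at e2
    have e3 := integral_comp_sub_le (t := t) hτ hδi hδ0 hδneg
    have e4 : ∫ s in (0 : ℝ)..t, δ s ≤ ∫ s in (0 : ℝ)..t, ‖w s‖ ^ 2 :=
      intervalIntegral.integral_mono_on ht.1 (hδi _ _) hNi fun s _ => hδle s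
    have e5 : ‖w 0‖ ^ 2 ≤ Φ ^ 2 := by
      simp only [hw, intervalIntegral.integral_same, add_zero]
      have := hψ 0
      gcongr
    have e6 := mul_le_mul_of_nonneg_left (e3.trans e4) (by positivity : (0 : ℝ) ≤ 2 * a ^ 2)
    have e7 : t * B ≤ T * B := mul_le_mul_of_nonneg_right ht.2 (by positivity)
    rw [hK, add_mul]
    linarith
  have hw2 : ∀ t ∈ Icc 0 T, ‖x t‖ ≤ S + γ := fun t ht => by
    have h1 := le_mul_exp_of_le_add_integral (by positivity) hN hgron t ht
    have h2 : ‖w t‖ ≤ S := by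
      refine Real.le_sqrt_of_sq_le (h1.trans ?_)
      have := ht.2
      gcongr
    rw [hxw t ht]
    exact (norm_add_le _ _).trans (add_le_add h2 (hγ t ht))
  intro t
  have hS0 : 0 ≤ S := Real.sqrt_nonneg _
  rcases le_total t 0 with h | h
  · rw [hx.hist t h]; linarith [hψ t]
  rcases le_total T t with h' | h'
  · rw [hx.const t h']; linarith [hw2 T ⟨hT, le_rfl⟩]
  · linarith [hw2 t ⟨h, h'⟩]

theorem IsMildSolution.eq_of_lipschitz {A : V →L[ℝ] V} {f : V → V} (hf : Continuous f)
    {ψ G : ℝ → V} {τ : ℝ} (hτ : 0 ≤ τ) {x y : ℝ → V} (hx : IsMildSolution T A f ψ G τ x)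
    (hy : IsMildSolution T A f ψ G τ y) {M K : ℝ} (hK0 : 0 ≤ K) (hxM : ∀ t, ‖x t‖ ≤ M)
    (hyM : ∀ t, ‖y t‖ ≤ M) (hK : ∀ v w, ‖v‖ ≤ M → ‖w‖ ≤ M → ‖f w - f v‖ ≤ K * ‖w - v‖) :
    ∀ t ≤ T, x t = y t := by
  have hxc := hx.cont
  have hyc := hy.cont
  set δ : ℝ → V := fun t => x t - y t with hδ
  have hδc : Continuous δ := hxc.sub hyc
  have hδM : ∀ t, ‖δ t‖ ≤ M + M := fun t => (norm_sub_le _ _).trans (add_le_add (hxM t) (hyM t))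
  have hδ0 : ∀ t ≤ 0, δ t = 0 := fun t ht => by simp [hδ, hx.hist t ht, hy.hist t ht]
  have key : ∀ t ∈ Icc 0 T, ‖δ t‖ ≤ 0 + (K + ‖A‖) * ∫ s in (0 : ℝ)..t, ‖δ s‖ := fun t ht => by
    have e : δ t = (∫ s in (0 : ℝ)..t, -(f (x s) - f (y s))) +
        ∫ s in (0 : ℝ)..t, A (δ (s - τ)) := by
      rw [← intervalIntegral.integral_add (Continuous.intervalIntegrable (by fun_prop) _ _)
        (Continuous.intervalIntegrable (by fun_prop) _ _)]
      simp only [hδ]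
      rw [hx.eq t ht, hy.eq t ht, add_sub_add_left_eq_sub,
        ← intervalIntegral.integral_sub (Continuous.intervalIntegrable (by fun_prop) _ _)
          (Continuous.intervalIntegrable (by fun_prop) _ _)]
      congr 1
      ext s
      rw [map_sub]
      abel
    have b1 : ‖∫ s in (0 : ℝ)..t, -(f (x s) - f (y s))‖ ≤ K * ∫ s in (0 : ℝ)..t, ‖δ s‖ := by
      rw [← intervalIntegral.integral_const_mul]
      exact intervalIntegral.norm_integral_le_of_norm_le ht.1
        (Eventually.of_forall fun s _ => by rw [norm_neg]; exact hK _ _ (hyM s) (hxM s))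
        (Continuous.intervalIntegrable (by fun_prop) _ _)
    have b2 := norm_integral_comp_sub_clm_le A hδc.stronglyMeasurable hδM hδ0 hτ ht.1
    rw [e, zero_add, add_mul]
    exact (norm_add_le _ _).trans (add_le_add b1 b2)
  intro t ht
  rcases le_total t 0 with h | h
  · rw [hx.hist t h, hy.hist t h]
  · have := le_mul_exp_of_le_add_integral (by positivity) hδc.norm key t ⟨h, ht⟩
    rw [zero_mul] at this
    exact sub_eq_zero.1 (norm_le_zero_iff.1 this)

end

section
variable {V : Type*} [NormedAddCommGroup V] [InnerProductSpace ℝ V] [FiniteDimensional ℝ V]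

/-- Global solvability. The nonlinearity is multiplied by a bump function which equals `1` on a
ball so large that, by the a priori bound, the solution never leaves it. -/
theorem exists_isMildSolution {T : ℝ} (A : V →L[ℝ] V) {f : V → V} (hf : ContDiff ℝ 1 f) {lam : ℝ}
    (hlam : 0 ≤ lam) (hmono : ∀ x y, -lam * ‖x - y‖ ^ 2 ≤ inner ℝ (f x - f y) (x - y))
    {ψ : ℝ → V} (hψc : Continuous ψ) {Φ : ℝ} (hψ : ∀ t, ‖ψ t‖ ≤ Φ)
    (hψ0 : ∀ t ≥ 0, ψ t = ψ 0) {g : ℝ → V} (hg : Integrable g) (hT : 0 ≤ T) :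
    ∃ M, ∀ τ, 0 ≤ τ →
      (∃ x, IsMildSolution T A f ψ (fun t => ∫ s in (0 : ℝ)..t, g s) τ x) ∧
      ∀ x, IsMildSolution T A f ψ (fun t => ∫ s in (0 : ℝ)..t, g s) τ x → ∀ t, ‖x t‖ ≤ M := by
  have : CompleteSpace V := FiniteDimensional.complete ℝ V
  have hGc : Continuous fun t => ∫ s in (0 : ℝ)..t, g s :=
    intervalIntegral.continuous_primitive (fun p q => hg.intervalIntegrable) 0
  obtain ⟨M, hM0, hM⟩ := exists_bound_of_isMildSolution A hf.continuous hlam hmono hGc hψ hT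
  refine ⟨M, fun τ hτ => ⟨?_, fun x hx => hM (fun _ => 1) continuous_const
    (fun _ => by simp) τ hτ x (by simpa using hx)⟩⟩
  let χ : ContDiffBump (0 : V) := ⟨M + 1, M + 2, by linarith, by linarith⟩
  have hχf : ContDiff ℝ 1 fun v => χ v • f v := χ.contDiff.smul hf
  obtain ⟨L, hL⟩ := ContDiff.lipschitzWith_of_hasCompactSupport
    (χ.hasCompactSupport.smul_right (f' := f)) hχf one_ne_zero
  have hL' : ∀ v w, ‖χ v • f v - χ w • f w‖ ≤ L * ‖v - w‖ := fun v w => by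
    have := hL.dist_le_mul v w
    rwa [dist_eq_norm, dist_eq_norm] at this
  have hKc : ∀ u : ℝ → V, Continuous u → Continuous fun s =>
      -(χ (ψ 0 + u s) • f (ψ 0 + u s)) + A (ψ (s - τ) + u (s - τ)) := fun u hu => by
    have h1 : Continuous fun s => χ (ψ 0 + u s) • f (ψ 0 + u s) :=
      hχf.continuous.comp (continuous_const.add hu)
    fun_prop
  obtain ⟨w, hwc, hw0, hwT, hw⟩ := exists_volterra_solution (L := L + ‖A‖) hT hτ (by positivity)
    (fun s v v' => -(χ (ψ 0 + v) • f (ψ 0 + v)) + A (ψ (s - τ) + v') + g s)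
    (fun u hu => ((hKc u hu).intervalIntegrable _ _).add hg.intervalIntegrable)
    fun s v v' w w' => by
      have h1 := hL' (ψ 0 + v) (ψ 0 + w)
      rw [add_sub_add_left_eq_sub] at h1
      have h2 := A.le_opNorm (v' - w')
      calc _ = ‖-(χ (ψ 0 + v) • f (ψ 0 + v) - χ (ψ 0 + w) • f (ψ 0 + w)) + A (v' - w')‖ := by
            simp only [map_add, map_sub]; congr 1; abel
        _ ≤ L * ‖v - w‖ + ‖A‖ * ‖v' - w'‖ := by
            refine (norm_add_le _ _).trans ?_
            rw [norm_neg]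
            exact add_le_add h1 h2
        _ ≤ (L + ‖A‖) * (‖v - w‖ + ‖v' - w'‖) := by
            nlinarith [mul_nonneg L.coe_nonneg (norm_nonneg (v' - w')),
              mul_nonneg (norm_nonneg A) (norm_nonneg (v - w))]
  have hsol : IsMildSolution T A (fun v => χ v • f v) ψ (fun t => ∫ s in (0 : ℝ)..t, g s) τ
      (fun t => ψ t + w t) := by
    refine ⟨hψc.add hwc, fun t ht => by simp [hw0 t ht], fun t ht => ?_, fun t ht => ?_⟩
    · simp only [hwT t ht, hψ0 t (hT.trans ht), hψ0 T hT]
    · rw [hw t ht, hψ0 t ht.1, intervalIntegral.integral_add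
        ((hKc w hwc).intervalIntegrable _ _) hg.intervalIntegrable, add_assoc,
        add_comm (∫ s in (0 : ℝ)..t, g s)]
      congr 2
      refine intervalIntegral.integral_congr fun s hs => ?_
      rw [uIcc_of_le ht.1] at hs
      simp only [hψ0 s hs.1]
  have hbd := hM χ χ.continuous (fun v => ⟨χ.nonneg, χ.le_one⟩) τ hτ _ hsol
  refine ⟨_, hsol.cont, hsol.hist, hsol.const, fun t ht => (hsol.eq t ht).trans ?_⟩
  congr 1
  refine intervalIntegral.integral_congr fun s _ => ?_
  have h1 : χ (ψ s + w s) = 1 := χ.one_of_mem_closedBall (by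
    rw [mem_closedBall_zero_iff]
    exact (hbd s).trans (by change M ≤ M + 1; linarith))
  simp only [h1, one_smul]

end

/-! ### The state and its derivative with respect to the delay -/

/-- The continuous extension of a function on `[-b, 0]` by its boundary values. -/
def historyExt {E : Type*} (b : ℝ) (φ : ℝ → E) (t : ℝ) : E := φ (max (-b) (min t 0))

section
variable {E : Type*}

theorem historyExt_of_mem {b : ℝ} {φ : ℝ → E} {t : ℝ} (ht : t ∈ Icc (-b) 0) :
    historyExt b φ t = φ t := by
  rw [historyExt, min_eq_left ht.2, max_eq_right ht.1]

theorem historyExt_of_nonneg {b : ℝ} {φ : ℝ → E} {t : ℝ} (ht : 0 ≤ t) :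
    historyExt b φ t = historyExt b φ 0 := by
  rw [historyExt, historyExt, min_eq_right ht, min_self]

theorem max_min_mem_Icc {p q : ℝ} (h : p ≤ q) (t : ℝ) : max p (min t q) ∈ Icc p q :=
  ⟨le_max_left _ _, max_le h (min_le_right _ _)⟩

variable [NormedAddCommGroup E]

theorem continuous_historyExt {b : ℝ} (hb : 0 ≤ b) {φ : ℝ → E} (hφ : ContinuousOn φ (Icc (-b) 0)) :
    Continuous (historyExt b φ) :=
  hφ.comp_continuous (by fun_prop) fun t => max_min_mem_Icc (by linarith) t

theorem exists_bound_historyExt {b : ℝ} (hb : 0 ≤ b) {φ : ℝ → E}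
    (hφ : ContinuousOn φ (Icc (-b) 0)) : ∃ Φ, ∀ t, ‖historyExt b φ t‖ ≤ Φ := by
  obtain ⟨Φ, hΦ⟩ := isCompact_Icc.exists_bound_of_continuousOn hφ
  exact ⟨Φ, fun t => hΦ _ (max_min_mem_Icc (by linarith) t)⟩

end

section
variable {n : ℕ} {b T : ℝ} {f : EuclideanSpace ℝ (Fin n) → EuclideanSpace ℝ (Fin n)}
  {A : Matrix (Fin n) (Fin n) ℝ} {g φ xd : ℝ → EuclideanSpace ℝ (Fin n)} {τ : ℝ}

theorem IsL2.integrable_indicator (hg : IsL2 0 T g) : Integrable ((Ioo 0 T).indicator g) :=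
  hg.integrableOn.integrable_indicator measurableSet_Ioo

theorem IsDelaySolution.isMildSolution {x : ℝ → EuclideanSpace ℝ (Fin n)} (hb : 0 ≤ b)
    (hT : 0 < T) (hf : Continuous f) (hg : IsL2 0 T g) (hτ : τ ∈ Icc 0 b)
    (hx : IsDelaySolution b T f A g φ τ x) :
    IsMildSolution T (Matrix.toEuclideanLin A).toContinuousLinearMap f (historyExt b φ)
      (fun t => ∫ s in (0 : ℝ)..t, (Ioo 0 T).indicator g s) τ
      (fun t => x (max (-b) (min t T))) := by
  obtain ⟨hxc, hxφ, -, v, hv, hxv, hode⟩ := hx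
  have hbT : -b ≤ T := by linarith
  set y : ℝ → EuclideanSpace ℝ (Fin n) := fun t => x (max (-b) (min t T)) with hy
  have hyx : ∀ t ∈ Icc (-b) T, y t = x t := fun t ht => by
    simp only [hy]; rw [min_eq_left ht.2, max_eq_right ht.1]
  have hyc : Continuous y := hxc.comp_continuous (by fun_prop) fun t => max_min_mem_Icc hbT t
  have hhist : ∀ t ≤ 0, y t = historyExt b φ t := fun t ht => by
    simp only [hy, historyExt]
    rw [min_eq_left (ht.trans hT.le), min_eq_left ht]
    exact hxφ ⟨le_max_left _ _, max_le (by linarith) ht⟩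
  refine ⟨hyc, hhist, fun t ht => ?_, fun t ht => ?_⟩
  · simp only [hy]; rw [min_eq_right ht, min_self]
  · have h1 := hxv.eq_add_integral hT (hxc.mono (Icc_subset_Icc_left (by linarith)))
      (hv.intervalIntegrable hT.le) t ht
    rw [hyx t ⟨by linarith [ht.1], ht.2⟩, h1, ← hhist 0 le_rfl, hyx 0 ⟨by linarith, hT.le⟩,
      add_assoc, ← intervalIntegral.integral_add hg.integrable_indicator.intervalIntegrable
        (Continuous.intervalIntegrable (by fun_prop) _ _)]
    congr 1
    refine intervalIntegral.integral_congr_ae ?_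
    have h2 := (ae_restrict_iff' measurableSet_Ioo).1 hode
    filter_upwards [h2, compl_mem_ae_iff.2 (measure_singleton (μ := volume) T)]
      with s hs hsT hst
    rw [uIoc_of_le ht.1] at hst
    have hs' : s ∈ Ioo 0 T := ⟨hst.1, lt_of_le_of_ne (hst.2.trans ht.2) hsT⟩
    have h3 := hs hs'
    rw [indicator_of_mem hs', hyx s ⟨by linarith [hs'.1], hs'.2.le⟩,
      hyx (s - τ) ⟨by linarith [hs'.1, hτ.2], by linarith [hs'.2, hτ.1]⟩,
      LinearMap.coe_toContinuousLinearMap', eq_sub_of_add_eq h3]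
    abel

theorem IsMildSolution.isDelaySolution {x : ℝ → EuclideanSpace ℝ (Fin n)} (hT : 0 < T)
    (hf : Continuous f) (hg : IsL2 0 T g)
    (hx : IsMildSolution T (Matrix.toEuclideanLin A).toContinuousLinearMap f (historyExt b φ)
      (fun t => ∫ s in (0 : ℝ)..t, (Ioo 0 T).indicator g s) τ x) :
    IsDelaySolution b T f A g φ τ x := by
  have hxc := hx.cont
  set A' := (Matrix.toEuclideanLin A).toContinuousLinearMap with hA'
  have hL2 : ∀ u : ℝ → EuclideanSpace ℝ (Fin n), Continuous u → IsL2 0 T u := fun u hu => by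
    obtain ⟨B, hB⟩ := (isCompact_Icc (a := (0 : ℝ)) (b := T)).exists_bound_of_continuousOn
      hu.continuousOn
    refine MemLp.of_bound hu.aestronglyMeasurable B ?_
    exact (ae_restrict_iff' measurableSet_Ioo).2
      (Eventually.of_forall fun t ht => hB t (Ioo_subset_Icc_self ht))
  have hgi : IsL2 0 T ((Ioo 0 T).indicator g) :=
    (memLp_congr_ae (indicator_ae_eq_restrict measurableSet_Ioo)).2 hg
  have hq : Continuous fun s => -f (x s) + A' (x (s - τ)) := by fun_prop
  refine ⟨hxc.continuousOn, fun t ht => ?_, hL2 x hxc,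
    fun s => (Ioo 0 T).indicator g s + (-f (x s) + A' (x (s - τ))), hgi.add (hL2 _ hq),
    hasWeakDerivOn_of_eq_integral hT (hg.integrable_indicator.intervalIntegrable.add
      (hq.intervalIntegrable _ _)) (historyExt b φ 0) fun t ht => ?_,
    (ae_restrict_iff' measurableSet_Ioo).2 (Eventually.of_forall fun s hs => ?_)⟩
  · rw [hx.hist t ht.2, historyExt_of_mem ht]
  · rw [hx.eq t (Ioo_subset_Icc_self ht), add_assoc, ← intervalIntegral.integral_add
      hg.integrable_indicator.intervalIntegrable (hq.intervalIntegrable _ _)]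
  · simp only [indicator_of_mem hs, hA', LinearMap.coe_toContinuousLinearMap']
    abel

/-- Unique solvability of the delay equation. The mild solutions `X τ` represent the states. -/
theorem StandingAssumption.exists_states (hb : 0 < b) (hT : 0 < T)
    (hA : StandingAssumption b T f g φ) : ∃ (X : ℝ → ℝ → EuclideanSpace ℝ (Fin n)),
      IsDelayFamily b T (Matrix.toEuclideanLin A).toContinuousLinearMap (fun v => -f v)
        (historyExt b φ)
        (fun _ t => historyExt b φ 0 + ∫ s in (0 : ℝ)..t, (Ioo 0 T).indicator g s) X ∧
      ∀ τ ∈ Icc 0 b, IsDelaySolution b T f A g φ τ (delayState b T f A g φ τ) ∧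
        ∀ y, IsDelaySolution b T f A g φ τ y → EqOn y (X τ) (Icc (-b) T) := by
  obtain ⟨lam, hlam, hlow⟩ := hA.lower_bound
  have hf := hA.contDiff_f
  obtain ⟨Φ, hΦ⟩ := exists_bound_historyExt hb.le hA.φ_cont
  obtain ⟨M, hM⟩ := exists_isMildSolution (Matrix.toEuclideanLin A).toContinuousLinearMap hf
    hlam.le (inner_sub_ge_of_fderiv (hf.differentiable one_ne_zero) hlow)
    (continuous_historyExt hb.le hA.φ_cont) hΦ (fun t ht => historyExt_of_nonneg ht)
    hA.g_mem.integrable_indicator hT.le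
  obtain ⟨K, hK0, -, hK⟩ := exists_lipschitz_on_ball hf M
  choose! X hX using fun τ (hτ : τ ∈ Icc 0 b) => (hM τ hτ.1).1
  refine ⟨X, ⟨fun τ hτ => (hX τ hτ).cont, fun τ _ => ?_, fun τ hτ => (hX τ hτ).hist,
    ⟨M, fun τ hτ => (hM τ hτ.1).2 _ (hX τ hτ)⟩, ⟨0, le_rfl, fun _ _ _ _ _ _ => by simp⟩,
    fun τ hτ => (hX τ hτ).eq⟩, fun τ hτ => ⟨Classical.epsilon_spec (p := IsDelaySolution b T f A g φ τ)
      ⟨X τ, (hX τ hτ).isDelaySolution hT hf.continuous hA.g_mem⟩, fun y hy t ht => ?_⟩⟩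
  · exact continuous_const.add (intervalIntegral.continuous_primitive
      (fun p q => hA.g_mem.integrable_indicator.intervalIntegrable) 0)
  · have h1 := hy.isMildSolution hb.le hT hf.continuous hA.g_mem hτ
    have h2 := h1.eq_of_lipschitz hf.continuous hτ.1 (hX τ hτ) hK0 ((hM τ hτ.1).2 _ h1)
      ((hM τ hτ.1).2 _ (hX τ hτ)) hK t ht.2
    rw [← h2, min_eq_left ht.2, max_eq_right ht.1]

theorem IsL2.memLp_innerSL (hxd : IsL2 0 T xd) :
    MemLp (fun t => -innerSL ℝ (xd t)) 2 (volume.restrict (Ioc 0 T)) := by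
  have h : MemLp xd 2 (volume.restrict (Ioc 0 T)) := by
    rw [← restrict_Ioo_eq_restrict_Ioc]; exact hxd
  refine (h.of_le (g := xd) ((innerSL ℝ).continuous.comp_aestronglyMeasurable
    h.aestronglyMeasurable) (Eventually.of_forall fun t => ?_)).neg
  exact (innerSL_apply_norm ℝ (xd t)).le

theorem delayCost_eq (hxd : IsL2 0 T xd) (hT : 0 ≤ T) {x : ℝ → EuclideanSpace ℝ (Fin n)}
    (hx : Continuous x) (h : ∀ t ∈ Icc 0 T, delayState b T f A g φ τ t = x t) :
    delayCost b T f A g φ xd τ =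
      (∫ t in (0 : ℝ)..T, ((1 / 2 : ℝ) * ‖x t‖ ^ 2 + (-innerSL ℝ (xd t)) (x t))) +
        (1 / 2 : ℝ) * ∫ t in Ioo 0 T, ‖xd t‖ ^ 2 := by
  have h2 : MemLp xd 2 (volume.restrict (Ioc 0 T)) := by
    rw [← restrict_Ioo_eq_restrict_Ioc]; exact hxd
  have i1 : IntervalIntegrable (fun t => (1 / 2 : ℝ) * ‖xd t‖ ^ 2) volume 0 T := by
    rw [intervalIntegrable_iff_integrableOn_Ioc_of_le hT]
    exact (h2.integrable_norm_pow two_ne_zero).const_mul _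
  have i2 : IntervalIntegrable (fun t => (-innerSL ℝ (xd t)) (x t)) volume 0 T := by
    have h3 : IntervalIntegrable xd volume 0 T := hxd.intervalIntegrable hT
    obtain ⟨B, hB⟩ := (isCompact_Icc (a := (0 : ℝ)) (b := T)).exists_bound_of_continuousOn
      hx.continuousOn
    rw [intervalIntegrable_iff_integrableOn_Ioc_of_le hT] at h3 ⊢
    refine (h3.norm.mul_const B).mono' ?_ ?_
    · exact (h3.aestronglyMeasurable.inner hx.aestronglyMeasurable).neg
    · refine (ae_restrict_iff' measurableSet_Ioc).2 (Eventually.of_forall fun t ht => ?_)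
      rw [_root_.neg_apply, norm_neg, innerSL_apply_apply]
      exact (norm_inner_le_norm _ _).trans
        (mul_le_mul_of_nonneg_left (hB t (Ioc_subset_Icc_self ht)) (norm_nonneg _))
  have i3 : IntervalIntegrable (fun t => (1 / 2 : ℝ) * ‖x t‖ ^ 2) volume 0 T :=
    Continuous.intervalIntegrable (by fun_prop) _ _
  rw [delayCost, ← integral_const_mul, ← integral_const_mul, ← integral_Ioc_eq_integral_Ioo,
    ← integral_Ioc_eq_integral_Ioo, ← intervalIntegral.integral_of_le hT,
    ← intervalIntegral.integral_of_le hT, ← intervalIntegral.integral_add (i3.add i2) i1]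
  refine intervalIntegral.integral_congr fun t ht => ?_
  rw [uIcc_of_le hT] at ht
  simp only [h t ht, _root_.neg_apply, innerSL_apply_apply, norm_sub_sq_real]
  rw [real_inner_comm]
  ring

end

/-! ### Differentiating a delayed argument in `L¹` -/

theorem eventually_integral_le_of_tendsto {T τ B : ℝ} {S : Set ℝ} {F : ℝ → ℝ → ℝ}
    (hm : ∀ τ' ∈ S, StronglyMeasurable (F τ')) (hB : ∀ τ' ∈ S, ∀ t ∈ uIoc 0 T, ‖F τ' t‖ ≤ B)
    (hlim : ∀ᵐ t, t ∈ uIoc 0 T → Tendsto (fun τ' => F τ' t) (𝓝[S] τ) (𝓝 0)) {ε : ℝ}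
    (hε : 0 < ε) : ∀ᶠ τ' in 𝓝[S] τ, ∫ t in (0 : ℝ)..T, F τ' t ≤ ε := by
  have h := intervalIntegral.tendsto_integral_filter_of_dominated_convergence
    (μ := volume) (a := 0) (b := T) (l := 𝓝[S] τ) (F := F) (f := fun _ => 0) (fun _ => B)
    (eventually_nhdsWithin_of_forall fun τ' hτ' => (hm τ' hτ').aestronglyMeasurable)
    (eventually_nhdsWithin_of_forall fun τ' hτ' => Eventually.of_forall (hB τ' hτ'))
    intervalIntegrable_const hlim
  simp only [intervalIntegral.integral_zero] at h
  exact (h.eventually (gt_mem_nhds hε)).mono fun _ h => h.le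

section
variable {V W : Type*} [NormedAddCommGroup V] [NormedSpace ℝ V] [NormedAddCommGroup W]
  [NormedSpace ℝ W] {b T : ℝ}

theorem norm_sub_add_smul_le_of_eq_integral [CompleteSpace V] {x D : ℝ → V} {r s ε : ℝ}
    (hi : IntervalIntegrable D volume r s) (h : x s - x r = ∫ t in r..s, D t)
    (hε : ∀ t ∈ uIcc r s, ‖D t - D r‖ ≤ ε) :
    ‖x s - x r + (r - s) • D r‖ ≤ ε * |s - r| := by
  have h1 := intervalIntegral.norm_integral_le_of_norm_le_const (f := fun t => D t - D r)
    (a := r) (b := s) (C := ε) fun t ht => hε t (uIoc_subset_uIcc ht)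
  rw [intervalIntegral.integral_sub hi intervalIntegrable_const,
    intervalIntegral.integral_const, ← h] at h1
  rwa [← neg_sub s r, neg_smul, ← sub_eq_add_neg]

theorem HasL1Deriv.clm_comp (L : V →L[ℝ] W) {U Z : ℝ → ℝ → V} (h : HasL1Deriv b T U Z)
    (hT : 0 ≤ T) (hi : ∀ τ ∈ Icc 0 b, IntervalIntegrable (U τ) volume 0 T)
    (hi' : ∀ τ ∈ Icc 0 b, IntervalIntegrable (Z τ) volume 0 T) :
    HasL1Deriv b T (fun τ t => L (U τ t)) (fun τ t => L (Z τ t)) := by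
  intro τ hτ ε hε
  filter_upwards [self_mem_nhdsWithin, h τ hτ (ε / (‖L‖ + 1)) (by positivity)] with τ' hτ' h'
  have hd := ((hi τ' hτ').sub (hi τ hτ)).sub ((hi' τ hτ).smul (τ' - τ))
  have hd' : IntervalIntegrable (fun t => ‖U τ' t - U τ t - (τ' - τ) • Z τ t‖) volume 0 T :=
    hd.norm
  calc _ ≤ ∫ t in (0 : ℝ)..T, (‖L‖ + 1) * ‖U τ' t - U τ t - (τ' - τ) • Z τ t‖ := by
        refine intervalIntegral.integral_mono_on hT ?_ (hd'.const_mul _) fun t _ => ?_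
        · have : IntervalIntegrable (fun t => L (U τ' t - U τ t - (τ' - τ) • Z τ t)) volume 0 T :=
            ⟨L.integrable_comp hd.1, L.integrable_comp hd.2⟩
          simpa only [map_sub, map_smul] using this.norm
        · rw [← map_sub, ← map_smul, ← map_sub]
          exact L.le_of_opNorm_le (by linarith) _
    _ = (‖L‖ + 1) * ∫ t in (0 : ℝ)..T, ‖U τ' t - U τ t - (τ' - τ) • Z τ t‖ :=
        intervalIntegral.integral_const_mul _ _
    _ ≤ (‖L‖ + 1) * (ε / (‖L‖ + 1) * |τ' - τ|) := by gcongr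
    _ = ε * |τ' - τ| := by field_simp

theorem IsL1Continuous.clm_comp (L : V →L[ℝ] W) {Z : ℝ → ℝ → V} (h : IsL1Continuous b T Z)
    (hT : 0 ≤ T) (hi : ∀ τ ∈ Icc 0 b, IntervalIntegrable (Z τ) volume 0 T) :
    IsL1Continuous b T (fun τ t => L (Z τ t)) := by
  intro τ hτ ε hε
  filter_upwards [self_mem_nhdsWithin, h τ hτ (ε / (‖L‖ + 1)) (by positivity)] with τ' hτ' h'
  have hd := (hi τ' hτ').sub (hi τ hτ)
  have hd' : IntervalIntegrable (fun t => ‖Z τ' t - Z τ t‖) volume 0 T := hd.norm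
  calc _ ≤ ∫ t in (0 : ℝ)..T, (‖L‖ + 1) * ‖Z τ' t - Z τ t‖ := by
        refine intervalIntegral.integral_mono_on hT ?_ (hd'.const_mul _) fun t _ => ?_
        · have : IntervalIntegrable (fun t => L (Z τ' t - Z τ t)) volume 0 T :=
            ⟨L.integrable_comp hd.1, L.integrable_comp hd.2⟩
          simpa only [map_sub] using this.norm
        · rw [← map_sub]
          exact L.le_of_opNorm_le (by linarith) _
    _ = (‖L‖ + 1) * ∫ t in (0 : ℝ)..T, ‖Z τ' t - Z τ t‖ :=
        intervalIntegral.integral_const_mul _ _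
    _ ≤ (‖L‖ + 1) * (ε / (‖L‖ + 1)) := by gcongr
    _ = ε := by field_simp

/-- A family `X` with piecewise continuous time derivative `D` (a jump at `t = 0` is allowed),
evaluated at the delayed time `t - τ`, is differentiable in `τ` with respect to the norm of
`L¹(0, T)`. -/
theorem hasL1Deriv_delayed [CompleteSpace V] {X Y D : ℝ → ℝ → V} {ψ p : ℝ → V} (hT : 0 ≤ T)
    (hXc : ∀ τ ∈ Icc 0 b, Continuous (X τ)) (hX0 : ∀ τ ∈ Icc 0 b, ∀ t ≤ 0, X τ t = ψ t)
    {B : ℝ}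
    (hYc : ∀ τ ∈ Icc 0 b, Continuous (Y τ)) (hY0 : ∀ τ ∈ Icc 0 b, ∀ t ≤ 0, Y τ t = 0)
    (hXY : HasL1Deriv b T X Y)
    (hDm : ∀ τ ∈ Icc 0 b, StronglyMeasurable (D τ)) (hDB : ∀ τ ∈ Icc 0 b, ∀ t, ‖D τ t‖ ≤ B)
    (hXD : ∀ τ ∈ Icc 0 b, ∀ r ∈ Icc (-b) T, ∀ s ∈ Icc (-b) T, X τ s - X τ r = ∫ t in r..s, D τ t)
    (hDc : ∀ τ ∈ Icc 0 b, ∀ s, s ≠ 0 → ContinuousAt (D τ) s)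
    (hp : Continuous p) (hDp : ∀ τ ∈ Icc 0 b, ∀ t ≤ 0, D τ t = p t) :
    HasL1Deriv b T (fun τ t => X τ (t - τ) - ψ (-τ))
      (fun τ t => Y τ (t - τ) - D τ (t - τ) + p (-τ)) := by
  intro τ hτ ε' hε'
  obtain ⟨ε, hε, hεε'⟩ : ∃ ε > 0, ε * (2 + 2 * T) ≤ ε' :=
    ⟨ε' / (2 + 2 * T), by positivity, le_of_eq (by field_simp)⟩
  have hB0 : 0 ≤ B := (norm_nonneg _).trans (hDB τ hτ 0)
  have hDi := intervalIntegrable_of_measurable_of_bounded (hDm τ hτ) (hDB τ hτ)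
  have hmem : ∀ τ' ∈ Icc 0 b, ∀ t ∈ Icc 0 T, t - τ' ∈ Icc (-b) T := fun τ' hτ' t ht =>
    ⟨by linarith [hτ'.2, ht.1], by linarith [hτ'.1, ht.2]⟩
  have hlip : ∀ τ' ∈ Icc 0 b, ∀ t ∈ Icc 0 T,
      ‖X τ (t - τ') - X τ (t - τ)‖ ≤ B * |τ' - τ| := fun τ' hτ' t ht => by
    rw [hXD τ hτ _ (hmem τ hτ t ht) _ (hmem τ' hτ' t ht)]
    refine (intervalIntegral.norm_integral_le_of_norm_le_const fun s _ => hDB τ hτ s).trans ?_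
    rw [show t - τ' - (t - τ) = -(τ' - τ) by ring, abs_neg]
  have hquot : ∀ᶠ τ' in 𝓝[Icc 0 b] τ, ∫ t in (0 : ℝ)..T, |τ' - τ|⁻¹ *
      ‖X τ (t - τ') - X τ (t - τ) + (τ' - τ) • D τ (t - τ)‖ ≤ ε := by
    refine eventually_integral_le_of_tendsto (B := 2 * B) (fun τ' hτ' => ?_)
      (fun τ' hτ' t ht => ?_) ?_ hε
    · have h1 := hXc τ hτ
      have h2 : StronglyMeasurable fun t => D τ (t - τ) :=
        (hDm τ hτ).comp_measurable (measurable_id.sub_const τ)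
      exact stronglyMeasurable_const.mul (((by fun_prop : Continuous fun t =>
        X τ (t - τ') - X τ (t - τ)).stronglyMeasurable.add (h2.const_smul _)).norm)
    · rw [uIoc_of_le hT] at ht
      have h1 := hlip τ' hτ' t (Ioc_subset_Icc_self ht)
      have h2 : ‖(τ' - τ) • D τ (t - τ)‖ ≤ |τ' - τ| * B := by
        rw [norm_smul, Real.norm_eq_abs]; gcongr; exact hDB τ hτ _
      rw [Real.norm_of_nonneg (by positivity)]
      rcases eq_or_ne τ' τ with rfl | hne
      · simp; exact hB0
      · have h3 : 0 < |τ' - τ| := abs_pos.2 (sub_ne_zero.2 hne)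
        rw [inv_mul_le_iff₀ h3]
        linarith [norm_add_le (X τ (t - τ') - X τ (t - τ)) ((τ' - τ) • D τ (t - τ))]
    · filter_upwards [compl_mem_ae_iff.2 (measure_singleton (μ := volume) τ)] with t htτ ht
      rw [uIoc_of_le hT] at ht
      have ht' := Ioc_subset_Icc_self ht
      refine Metric.tendsto_nhds.2 fun η hη => ?_
      obtain ⟨κ, hκ, hκ'⟩ := Metric.continuousAt_iff.1
        (hDc τ hτ (t - τ) (sub_ne_zero.2 htτ)) (η / 2) (by positivity)
      filter_upwards [self_mem_nhdsWithin,
        mem_nhdsWithin_of_mem_nhds (Metric.ball_mem_nhds τ hκ)] with τ' hτ' hd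
      rw [Metric.mem_ball, Real.dist_eq] at hd
      have h1 := norm_sub_add_smul_le_of_eq_integral (x := X τ) (D := D τ) (ε := η / 2) (hDi _ _)
        (hXD τ hτ _ (hmem τ hτ t ht') _ (hmem τ' hτ' t ht')) fun s hs => by
          have h2 := hκ' (x := s) (by
            rw [Real.dist_eq]
            refine (abs_sub_left_of_mem_uIcc hs).trans_lt ?_
            rwa [show t - τ' - (t - τ) = -(τ' - τ) by ring, abs_neg])
          rw [dist_eq_norm] at h2
          exact h2.le
      rw [show t - τ - (t - τ') = τ' - τ by ring, show t - τ' - (t - τ) = -(τ' - τ) by ring,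
        abs_neg] at h1
      rw [dist_zero_right, Real.norm_of_nonneg (by positivity)]
      rcases eq_or_ne τ' τ with rfl | hne
      · simpa using hη
      · have h3 : 0 < |τ' - τ| := abs_pos.2 (sub_ne_zero.2 hne)
        rw [inv_mul_lt_iff₀ h3]
        nlinarith
  have hpmod := hp.exists_shift_modulus (T := 0) hτ hε
  filter_upwards [self_mem_nhdsWithin, hXY τ hτ ε hε, hquot, hpmod,
    (hYc τ hτ).exists_shift_modulus (T := T) hτ hε] with τ' hτ' h1 h2 h3 h4
  set h := τ' - τ with hh
  have hXcτ := hXc τ hτ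
  have hXcτ' := hXc τ' hτ'
  have hYcτ := hYc τ hτ
  have h5 : ‖ψ (-τ') - ψ (-τ) + h • p (-τ)‖ ≤ ε * |h| := by
    have e1 : X τ (-τ') - X τ (-τ) = ∫ t in (-τ)..(-τ'), D τ t := by
      simpa using hXD τ hτ _ (hmem τ hτ 0 ⟨le_rfl, hT⟩) _ (hmem τ' hτ' 0 ⟨le_rfl, hT⟩)
    have e2 := norm_sub_add_smul_le_of_eq_integral (x := X τ) (D := D τ) (ε := ε) (hDi _ _) e1
      fun s hs => by
        have hs0 : s ≤ 0 := hs.2.trans (sup_le (by linarith [hτ.1]) (by linarith [hτ'.1]))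
        rw [hDp τ hτ s hs0, hDp τ hτ (-τ) (by linarith [hτ.1])]
        simpa using h3 0 ⟨le_rfl, le_rfl⟩ s (by simpa [uIcc_comm] using hs)
    rwa [hX0 τ hτ (-τ') (by linarith [hτ'.1]), hX0 τ hτ (-τ) (by linarith [hτ.1]),
      hDp τ hτ (-τ) (by linarith [hτ.1]), show -τ - -τ' = h by rw [hh]; ring,
      show -τ' - -τ = -h by rw [hh]; ring, abs_neg] at e2
  have h2' : ∫ t in (0 : ℝ)..T, ‖X τ (t - τ') - X τ (t - τ) + h • D τ (t - τ)‖ ≤ ε * |h| := by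
    rcases eq_or_ne h 0 with h0 | hne
    · have : τ' = τ := by linarith
      simp [h0, this]
    · rw [intervalIntegral.integral_const_mul, inv_mul_le_iff₀ (abs_pos.2 hne)] at h2
      linarith
  have hδc : Continuous fun t => X τ' t - X τ t - h • Y τ t := by fun_prop
  have h1' : ∫ t in (0 : ℝ)..T, ‖X τ' (t - τ') - X τ (t - τ') - h • Y τ (t - τ')‖ ≤ ε * |h| :=
    (integral_comp_sub_le (δ := fun t => ‖X τ' t - X τ t - h • Y τ t‖) hτ'.1
      (fun p q => hδc.norm.intervalIntegrable _ _) (fun t => norm_nonneg _) fun t ht => by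
        simp [hX0 τ hτ t ht, hX0 τ' hτ' t ht, hY0 τ hτ t ht]).trans h1
  have hDi' : IntervalIntegrable (fun t => D τ (t - τ)) volume 0 T := by
    simpa using (hDi (0 - τ) (T - τ)).comp_sub_right τ
  have i1 : IntervalIntegrable (fun t => ‖X τ' (t - τ') - X τ (t - τ') - h • Y τ (t - τ')‖)
      volume 0 T := Continuous.intervalIntegrable (by fun_prop) _ _
  have i2 : IntervalIntegrable (fun t => X τ (t - τ') - X τ (t - τ) + h • D τ (t - τ))
      volume 0 T := (Continuous.intervalIntegrable (by fun_prop) _ _).add (hDi'.smul h)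
  have i3 : IntervalIntegrable (fun t => X τ' (t - τ') - ψ (-τ') - (X τ (t - τ) - ψ (-τ)) -
      h • (Y τ (t - τ) - D τ (t - τ) + p (-τ))) volume 0 T :=
    (Continuous.intervalIntegrable (by fun_prop) _ _).sub
      ((((Continuous.intervalIntegrable (by fun_prop) _ _).sub hDi').add
        intervalIntegrable_const).smul h)
  calc _ ≤ ∫ t in (0 : ℝ)..T, (‖X τ' (t - τ') - X τ (t - τ') - h • Y τ (t - τ')‖ +
        ‖X τ (t - τ') - X τ (t - τ) + h • D τ (t - τ)‖ + 2 * ε * |h|) := by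
        refine intervalIntegral.integral_mono_on hT i3.norm
          ((i1.add i2.norm).add intervalIntegrable_const) fun t ht => ?_
        have e : X τ' (t - τ') - ψ (-τ') - (X τ (t - τ) - ψ (-τ)) -
            h • (Y τ (t - τ) - D τ (t - τ) + p (-τ)) =
            (X τ' (t - τ') - X τ (t - τ') - h • Y τ (t - τ')) +
            (X τ (t - τ') - X τ (t - τ) + h • D τ (t - τ)) +
            (h • (Y τ (t - τ') - Y τ (t - τ)) - (ψ (-τ') - ψ (-τ) + h • p (-τ))) := by
          simp only [smul_add, smul_sub]; abel
        have h6 : ‖h • (Y τ (t - τ') - Y τ (t - τ))‖ ≤ |h| * ε := by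
          rw [norm_smul, Real.norm_eq_abs]
          gcongr
          exact h4 t ht _ left_mem_uIcc
        rw [e]
        refine norm_add₃_le.trans (add_le_add le_rfl ((norm_sub_le _ _).trans
          ((add_le_add h6 h5).trans (le_of_eq (by ring)))))
    _ ≤ ε * |h| + ε * |h| + T * (2 * ε * |h|) := by
        rw [intervalIntegral.integral_add (i1.add i2.norm) intervalIntegrable_const,
          intervalIntegral.integral_add i1 i2.norm, intervalIntegral.integral_const, sub_zero,
          smul_eq_mul]
        linarith
    _ = ε * (2 + 2 * T) * |h| := by ring
    _ ≤ ε' * |h| := by gcongr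

end

theorem isL1Continuous_delayed {V : Type*} [NormedAddCommGroup V] {b T : ℝ} {Y D : ℝ → ℝ → V}
    {p : ℝ → V} (hT : 0 ≤ T)
    (hYc : ∀ τ ∈ Icc 0 b, Continuous (Y τ)) (hY0 : ∀ τ ∈ Icc 0 b, ∀ t ≤ 0, Y τ t = 0)
    (hY : IsL1Continuous b T Y) {B : ℝ}
    (hDm : ∀ τ ∈ Icc 0 b, StronglyMeasurable (D τ)) (hDB : ∀ τ ∈ Icc 0 b, ∀ t, ‖D τ t‖ ≤ B)
    (hDc : ∀ τ ∈ Icc 0 b, ∀ t ∈ Ioc 0 T, t ≠ τ →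
      Tendsto (fun τ' => D τ' (t - τ')) (𝓝[Icc 0 b] τ) (𝓝 (D τ (t - τ))))
    (hp : Continuous p) :
    IsL1Continuous b T (fun τ t => Y τ (t - τ) - D τ (t - τ) + p (-τ)) := by
  intro τ hτ ε' hε'
  obtain ⟨ε, hε, hεε'⟩ : ∃ ε > 0, ε * (2 + 2 * T) ≤ ε' :=
    ⟨ε' / (2 + 2 * T), by positivity, le_of_eq (by field_simp)⟩
  have hDs : ∀ σ ∈ Icc 0 b, StronglyMeasurable fun t => D σ (t - σ) := fun σ hσ =>
    (hDm σ hσ).comp_measurable (measurable_id.sub_const σ)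
  have hD : ∀ᶠ τ' in 𝓝[Icc 0 b] τ, ∫ t in (0 : ℝ)..T, ‖D τ' (t - τ') - D τ (t - τ)‖ ≤ ε := by
    refine eventually_integral_le_of_tendsto (B := B + B)
      (fun τ' hτ' => ((hDs τ' hτ').sub (hDs τ hτ)).norm) (fun τ' hτ' t _ => ?_) ?_ hε
    · rw [norm_norm]
      exact (norm_sub_le _ _).trans (add_le_add (hDB τ' hτ' _) (hDB τ hτ _))
    · filter_upwards [compl_mem_ae_iff.2 (measure_singleton (μ := volume) τ)] with t htτ ht
      rw [uIoc_of_le hT] at ht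
      exact tendsto_iff_norm_sub_tendsto_zero.1 (hDc τ hτ t ht htτ)
  filter_upwards [self_mem_nhdsWithin, hY τ hτ ε hε, hD, hp.exists_shift_modulus (T := 0) hτ hε,
    (hYc τ hτ).exists_shift_modulus (T := T) hτ hε] with τ' hτ' h1 h2 h3 h4
  have hYcτ := hYc τ hτ
  have hYcτ' := hYc τ' hτ'
  have hDi : ∀ σ ∈ Icc 0 b, IntervalIntegrable (fun t => D σ (t - σ)) volume 0 T := fun σ hσ =>
    intervalIntegrable_of_measurable_of_bounded (hDs σ hσ) (fun t => hDB σ hσ _) 0 T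
  have h1' : ∫ t in (0 : ℝ)..T, ‖Y τ' (t - τ') - Y τ (t - τ')‖ ≤ ε :=
    (integral_comp_sub_le (δ := fun t => ‖Y τ' t - Y τ t‖) hτ'.1
      (fun p q => (hYcτ'.sub hYcτ).norm.intervalIntegrable _ _) (fun t => norm_nonneg _)
      fun t ht => by simp [hY0 τ hτ t ht, hY0 τ' hτ' t ht]).trans h1
  have h3' : ‖p (-τ') - p (-τ)‖ ≤ ε := by
    simpa using h3 0 ⟨le_rfl, le_rfl⟩ (0 - τ') left_mem_uIcc
  have i1 : IntervalIntegrable (fun t => ‖Y τ' (t - τ') - Y τ (t - τ')‖) volume 0 T :=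
    Continuous.intervalIntegrable (by fun_prop) _ _
  have i2 : IntervalIntegrable (fun t => ‖D τ' (t - τ') - D τ (t - τ)‖) volume 0 T :=
    ((hDi τ' hτ').sub (hDi τ hτ)).norm
  have i3 : IntervalIntegrable (fun t => Y τ' (t - τ') - D τ' (t - τ') + p (-τ') -
      (Y τ (t - τ) - D τ (t - τ) + p (-τ))) volume 0 T :=
    (((Continuous.intervalIntegrable (by fun_prop) _ _).sub (hDi τ' hτ')).add
      intervalIntegrable_const).sub
    (((Continuous.intervalIntegrable (by fun_prop) _ _).sub (hDi τ hτ)).add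
      intervalIntegrable_const)
  calc _ ≤ ∫ t in (0 : ℝ)..T, (‖Y τ' (t - τ') - Y τ (t - τ')‖ +
        ‖D τ' (t - τ') - D τ (t - τ)‖ + 2 * ε) := by
        refine intervalIntegral.integral_mono_on hT i3.norm
          ((i1.add i2).add intervalIntegrable_const) fun t ht => ?_
        have e : Y τ' (t - τ') - D τ' (t - τ') + p (-τ') - (Y τ (t - τ) - D τ (t - τ) + p (-τ)) =
            (Y τ' (t - τ') - Y τ (t - τ')) - (D τ' (t - τ') - D τ (t - τ)) +
            ((Y τ (t - τ') - Y τ (t - τ)) + (p (-τ') - p (-τ))) := by abel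
        rw [e]
        refine (norm_add_le _ _).trans (add_le_add (norm_sub_le _ _) ((norm_add_le _ _).trans
          ((add_le_add (h4 t ht _ left_mem_uIcc) h3').trans (le_of_eq (by ring)))))
    _ ≤ ε + ε + T * (2 * ε) := by
        rw [intervalIntegral.integral_add (i1.add i2) intervalIntegrable_const,
          intervalIntegral.integral_add i1 i2, intervalIntegral.integral_const, sub_zero,
          smul_eq_mul]
        linarith
    _ = ε * (2 + 2 * T) := by ring
    _ ≤ ε' := hεε'

/-! ### Regularity of the data -/

section
variable {n : ℕ} {a c : ℝ} {u : ℝ → EuclideanSpace ℝ (Fin n)}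

theorem IsH1.exists_continuous_ae_eq (h : IsH1 a c u) (hac : a < c) :
    ∃ p : ℝ → EuclideanSpace ℝ (Fin n), Continuous p ∧ (∃ B, ∀ t, ‖p t‖ ≤ B) ∧
      ∀ᵐ t, t ∈ Ioo a c → u t = p t := by
  obtain ⟨hu, v, hv, huv⟩ := h
  obtain ⟨C, hC⟩ := huv.ae_eq_integral hac hu.integrableOn (hv.intervalIntegrable hac.le)
  have hc : ContinuousOn (fun t => C + ∫ s in a..t, v s) (Icc a c) := by
    have := intervalIntegral.continuousOn_primitive_interval' (hv.intervalIntegrable hac.le)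
      left_mem_uIcc
    rw [uIcc_of_le hac.le] at this
    exact continuousOn_const.add this
  obtain ⟨B, hB⟩ := isCompact_Icc.exists_bound_of_continuousOn hc
  refine ⟨fun t => C + ∫ s in a..(max a (min t c)), v s,
    hc.comp_continuous (by fun_prop) fun t => max_min_mem_Icc hac.le t,
    ⟨B, fun t => hB _ (max_min_mem_Icc hac.le t)⟩, ?_⟩
  filter_upwards [hC] with t ht ht'
  rw [ht ht', min_eq_left ht'.2.le, max_eq_right ht'.1.le]

theorem IsH2.exists_continuous_deriv (h : IsH2 a c u) (hac : a < c)
    (hu : ContinuousOn u (Icc a c)) :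
    ∃ p : ℝ → EuclideanSpace ℝ (Fin n), Continuous p ∧ (∃ B, ∀ t, ‖p t‖ ≤ B) ∧
      ∀ t ∈ Icc a c, u t = u a + ∫ s in a..t, p s := by
  obtain ⟨-, v, hv, huv⟩ := h
  obtain ⟨p, hp, hpB, hvp⟩ := hv.exists_continuous_ae_eq hac
  refine ⟨p, hp, hpB, fun t ht => ?_⟩
  rw [huv.eq_add_integral hac hu (hv.1.intervalIntegrable hac.le) t ht]
  congr 1
  refine intervalIntegral.integral_congr_ae ?_
  filter_upwards [hvp, compl_mem_ae_iff.2 (measure_singleton (μ := volume) c)] with s hs hsc hst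
  rw [uIoc_of_le ht.1] at hst
  exact hs ⟨hst.1, lt_of_le_of_ne (hst.2.trans ht.2) hsc⟩

end

theorem hasL1Deriv_const {V : Type*} [NormedAddCommGroup V] [NormedSpace ℝ V] {b T : ℝ}
    (r : ℝ → V) : HasL1Deriv b T (fun _ => r) (fun _ _ => 0) := fun τ _ ε hε =>
  Eventually.of_forall fun τ' => by simp; positivity

theorem isL1Continuous_const {V : Type*} [NormedAddCommGroup V] {b T : ℝ} (r : ℝ → V) :
    IsL1Continuous b T (fun _ => r) := fun τ _ ε hε =>
  Eventually.of_forall fun τ' => by simpa using hε.le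

/-! ### Differentiating twice -/

section
variable {V : Type*} [NormedAddCommGroup V] [NormedSpace ℝ V] [FiniteDimensional ℝ V] {b T : ℝ}
  {A : V →L[ℝ] V} {f : V → V} {ψ r : ℝ → V} {X Y : ℝ → ℝ → V}

theorem IsDelayFamily.tendsto_joint {H : V → V} {R : ℝ → ℝ → V}
    (hX : IsDelayFamily b T A H ψ R X) (hH : ContDiff ℝ 1 H) {τ : ℝ} (hτ : τ ∈ Icc 0 b)
    {ρ : ℝ → ℝ} (hρ : Continuous ρ) (hρT : ∀ τ' ∈ Icc 0 b, ρ τ' ≤ T) :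
    Tendsto (fun τ' => X τ' (ρ τ')) (𝓝[Icc 0 b] τ) (𝓝 (X τ (ρ τ))) := by
  obtain ⟨C, hC0, hC⟩ := hX.exists_lipschitz hH
  have h1 : Tendsto (fun τ' => X τ (ρ τ')) (𝓝[Icc 0 b] τ) (𝓝 (X τ (ρ τ))) :=
    (((hX.cont τ hτ).comp hρ).tendsto τ).mono_left nhdsWithin_le_nhds
  have h2 : Tendsto (fun τ' => X τ' (ρ τ') - X τ (ρ τ')) (𝓝[Icc 0 b] τ) (𝓝 0) := by
    have h3 : Tendsto (fun τ' : ℝ => C * |τ' - τ|) (𝓝[Icc 0 b] τ) (𝓝 (C * |τ - τ|)) :=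
      ((by fun_prop : Continuous fun τ' : ℝ => C * |τ' - τ|).tendsto τ).mono_left nhdsWithin_le_nhds
    rw [sub_self, abs_zero, mul_zero] at h3
    refine squeeze_zero_norm' ?_ h3
    filter_upwards [self_mem_nhdsWithin] with τ' hτ'
    exact hC τ hτ τ' hτ' _ (hρT τ' hτ')
  simpa using h2.add h1

/-- The pair of a family of states and its derivative `Y` with respect to the delay is itself a
family of solutions of a delay equation, to which the differentiability theorem applies once
more. Continuous data make the time derivative of the states piecewise continuous, with a jump
at `t = 0` only. -/
theorem IsDelayFamily.exists_second_variation (hb : 0 < b) (hT : 0 < T)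
    (hX : IsDelayFamily b T A (fun v => -f v) ψ (fun _ => r) X) (hf : ContDiff ℝ 2 f)
    (hY : IsDelayVariation b T A (fun v => -f v) ψ (fun _ _ => 0) X Y)
    (hYc : ∀ τ ∈ Icc 0 b, Continuous (Y τ)) (hψc : Continuous ψ) {p γ : ℝ → V}
    (hp : Continuous p) (hpB : ∃ B, ∀ t, ‖p t‖ ≤ B) (hγ : Continuous γ)
    (hγB : ∃ B, ∀ t, ‖γ t‖ ≤ B) (hψp : ∀ t ∈ Icc (-b) 0, ψ t = ψ 0 + ∫ s in (0 : ℝ)..t, p s)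
    (hrγ : ∀ t ∈ Icc 0 T, r t = ψ 0 + ∫ s in (0 : ℝ)..t, γ s) :
    ∃ (H : V × V → V × V) (ψ₂ : ℝ → V × V) (R R' Z : ℝ → ℝ → V × V),
      ContDiff ℝ 1 H ∧
      IsDelayFamily b T (A.prodMap A) H ψ₂ R (fun τ t => (X τ t, Y τ t)) ∧
      IsDelayVariation b T (A.prodMap A) H ψ₂ R' (fun τ t => (X τ t, Y τ t)) Z ∧
      HasL1Deriv b T (fun τ t => (X τ t, Y τ t)) Z ∧ IsL1Continuous b T Z := by
  have : CompleteSpace V := FiniteDimensional.complete ℝ V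
  have hf1 : ContDiff ℝ 1 (fun v => -f v) := (hf.of_le one_le_two).neg
  have hfc := hf.continuous
  obtain ⟨M, hM⟩ := hX.bdd
  obtain ⟨N, hN⟩ := hY.bdd
  obtain ⟨C, hC0, hC⟩ := hX.exists_lipschitz hf1
  obtain ⟨Bp, hBp⟩ := hpB
  obtain ⟨Bγ, hBγ⟩ := hγB
  have hprop : ProperSpace V := FiniteDimensional.proper ℝ V
  obtain ⟨Bf, hBf⟩ := (isCompact_closedBall (0 : V) M).exists_bound_of_continuousOn
    hfc.continuousOn
  have hXY : HasL1Deriv b T X Y := hX.hasL1Deriv hY hT.le hf1 (hasL1Deriv_const r)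
    fun _ _ => ⟨stronglyMeasurable_const, 0, fun _ => by simp⟩
  have hYL : IsL1Continuous b T Y := hY.isL1Continuous hX hT.le hf1 hψc (isL1Continuous_const _)
    fun _ _ => ⟨stronglyMeasurable_const, 0, fun _ => by simp⟩
  -- the time derivative of the states
  let W : ℝ → ℝ → V := fun τ s => γ s - f (X τ s) + A (X τ (s - τ))
  let D : ℝ → ℝ → V := fun τ s => if s ≤ 0 then p s else W τ s
  have hWc : ∀ τ ∈ Icc 0 b, Continuous (W τ) := fun τ hτ => by
    have := hX.cont τ hτ
    fun_prop
  have hDm : ∀ τ ∈ Icc 0 b, StronglyMeasurable (D τ) := fun τ hτ =>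
    StronglyMeasurable.ite measurableSet_Iic hp.stronglyMeasurable (hWc τ hτ).stronglyMeasurable
  set B := max Bp (Bγ + Bf + ‖A‖ * M) with hB
  have hDB : ∀ τ ∈ Icc 0 b, ∀ t, ‖D τ t‖ ≤ B := fun τ hτ t => by
    simp only [D]
    split_ifs with h
    · exact (hBp t).trans (le_max_left _ _)
    · refine le_trans ?_ (le_max_right _ _)
      exact (norm_add_le _ _).trans (add_le_add ((norm_sub_le _ _).trans
        (add_le_add (hBγ t) (hBf _ (by simpa using hM τ hτ t)))) (A.le_opNorm_of_le (hM τ hτ _)))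
  have hDp : ∀ τ ∈ Icc 0 b, ∀ t ≤ 0, D τ t = p t := fun τ _ t ht => if_pos ht
  have hDW : ∀ τ t, 0 < t → D τ t = W τ t := fun τ t ht => if_neg (not_le.2 ht)
  have hDi : ∀ τ ∈ Icc 0 b, ∀ x y, IntervalIntegrable (D τ) volume x y := fun τ hτ =>
    intervalIntegrable_of_measurable_of_bounded (hDm τ hτ) (hDB τ hτ)
  have hXD0 : ∀ τ ∈ Icc 0 b, ∀ s ∈ Icc (-b) T, X τ s = ψ 0 + ∫ t in (0 : ℝ)..s, D τ t :=
    fun τ hτ s hs => by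
      have hXc := hX.cont τ hτ
      rcases le_total s 0 with h | h
      · rw [hX.hist τ hτ s h, hψp s ⟨hs.1, h⟩]
        congr 1
        refine intervalIntegral.integral_congr fun t ht => ?_
        rw [uIcc_of_ge h] at ht
        exact (hDp τ hτ t ht.2).symm
      · rw [hX.eq τ hτ s ⟨h, hs.2⟩, hrγ s ⟨h, hs.2⟩, add_assoc, ← intervalIntegral.integral_add
          (hγ.intervalIntegrable _ _) (Continuous.intervalIntegrable (by fun_prop) _ _)]
        congr 1
        refine intervalIntegral.integral_congr_ae (Eventually.of_forall fun t ht => ?_)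
        rw [uIoc_of_le h] at ht
        rw [hDW τ t ht.1]
        simp only [W]
        abel
  have hXD : ∀ τ ∈ Icc 0 b, ∀ x ∈ Icc (-b) T, ∀ s ∈ Icc (-b) T,
      X τ s - X τ x = ∫ t in x..s, D τ t := fun τ hτ x hx s hs => by
    rw [hXD0 τ hτ x hx, hXD0 τ hτ s hs, add_sub_add_left_eq_sub,
      intervalIntegral.integral_interval_sub_left (hDi τ hτ _ _) (hDi τ hτ _ _)]
  have hDc : ∀ τ ∈ Icc 0 b, ∀ s, s ≠ 0 → ContinuousAt (D τ) s := fun τ hτ s hs => by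
    rcases lt_or_gt_of_ne hs with h | h
    · refine hp.continuousAt.congr ?_
      filter_upwards [gt_mem_nhds h] with t ht using (hDp τ hτ t ht.le).symm
    · refine (hWc τ hτ).continuousAt.congr ?_
      filter_upwards [lt_mem_nhds h] with t ht using (hDW τ t ht).symm
  have hDj : ∀ τ ∈ Icc 0 b, ∀ t ∈ Ioc 0 T, t ≠ τ →
      Tendsto (fun τ' => D τ' (t - τ')) (𝓝[Icc 0 b] τ) (𝓝 (D τ (t - τ))) :=
    fun τ hτ t ht htτ => by
      have hlin : ∀ q : ℝ → V, Continuous q →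
          Tendsto (fun τ' => q (t - τ')) (𝓝[Icc 0 b] τ) (𝓝 (q (t - τ))) := fun q hq =>
        ((by fun_prop : Continuous fun τ' => q (t - τ')).tendsto τ).mono_left nhdsWithin_le_nhds
      rcases lt_or_gt_of_ne htτ with h | h
      · rw [hDp τ hτ _ (by linarith)]
        refine (hlin p hp).congr' ?_
        filter_upwards [self_mem_nhdsWithin, mem_nhdsWithin_of_mem_nhds (lt_mem_nhds h)]
          with τ' hτ' hlt using (hDp τ' hτ' _ (by linarith)).symm
      · rw [hDW τ _ (by linarith)]
        have h1 := hX.tendsto_joint hf1 hτ (ρ := fun τ' => t - τ') (by fun_prop)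
          fun τ' hτ' => by linarith [hτ'.1, ht.2]
        have h2 := hX.tendsto_joint hf1 hτ (ρ := fun τ' => t - τ' - τ') (by fun_prop)
          fun τ' hτ' => by linarith [hτ'.1, ht.2]
        have h3 : Tendsto (fun τ' => W τ' (t - τ')) (𝓝[Icc 0 b] τ) (𝓝 (W τ (t - τ))) :=
          ((hlin γ hγ).sub ((hfc.tendsto _).comp h1)).add ((A.continuous.tendsto _).comp h2)
        refine h3.congr' ?_
        filter_upwards [mem_nhdsWithin_of_mem_nhds (gt_mem_nhds h)]
          with τ' hlt using (hDW τ' _ (by linarith)).symm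
  -- the inhomogeneity of the equation for `Y`
  have hS := hasL1Deriv_delayed hT.le hX.cont hX.hist hYc hY.hist hXY hDm hDB hXD hDc hp hDp
  have hS' := isL1Continuous_delayed hT.le hYc hY.hist hYL hDm hDB hDj hp
  set S : ℝ → ℝ → V := fun τ t => X τ (t - τ) - ψ (-τ) with hSdef
  set S' : ℝ → ℝ → V := fun τ t => Y τ (t - τ) - D τ (t - τ) + p (-τ) with hS'def
  have hSc : ∀ τ ∈ Icc 0 b, Continuous (S τ) := fun τ hτ => by
    have := hX.cont τ hτ
    fun_prop
  have hS'm : ∀ τ ∈ Icc 0 b, StronglyMeasurable (S' τ) := fun τ hτ => by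
    have h1 := hYc τ hτ
    exact (((by fun_prop : Continuous fun t => Y τ (t - τ)).stronglyMeasurable).sub
      ((hDm τ hτ).comp_measurable (measurable_id.sub_const τ))).add stronglyMeasurable_const
  have hS'B : ∀ τ ∈ Icc 0 b, ∀ t, ‖S' τ t‖ ≤ N + B + Bp := fun τ hτ t =>
    (norm_add_le _ _).trans (add_le_add ((norm_sub_le _ _).trans
      (add_le_add (hN τ hτ _) (hDB τ hτ _))) (hBp _))
  have hB0 : 0 ≤ B := (norm_nonneg _).trans (hDB 0 ⟨le_rfl, hb.le⟩ 0)
  have hSlip : ∀ τ ∈ Icc 0 b, ∀ τ' ∈ Icc 0 b, ∀ t ∈ Icc 0 T,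
      ‖S τ' t - S τ t‖ ≤ (C + B + B) * |τ' - τ| := fun τ hτ τ' hτ' t ht => by
    have hsh : ∀ t ∈ Icc 0 T, ‖X τ (t - τ') - X τ (t - τ)‖ ≤ B * |τ' - τ| := fun t ht => by
      rw [hXD τ hτ (t - τ) ⟨by linarith [hτ.2, ht.1], by linarith [hτ.1, ht.2]⟩ (t - τ')
        ⟨by linarith [hτ'.2, ht.1], by linarith [hτ'.1, ht.2]⟩]
      refine (intervalIntegral.norm_integral_le_of_norm_le_const fun s _ => hDB τ hτ s).trans ?_
      rw [show t - τ' - (t - τ) = -(τ' - τ) by ring, abs_neg]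
    have h1 := hsh t ht
    have h2 := hsh 0 ⟨le_rfl, hT.le⟩
    rw [zero_sub, zero_sub, hX.hist τ hτ (-τ') (by linarith [hτ'.1]),
      hX.hist τ hτ (-τ) (by linarith [hτ.1])] at h2
    have h3 := hC τ hτ τ' hτ' (t - τ') (by linarith [hτ'.1, ht.2])
    have e : S τ' t - S τ t = (X τ' (t - τ') - X τ (t - τ')) + (X τ (t - τ') - X τ (t - τ)) -
        (ψ (-τ') - ψ (-τ)) := by simp only [hSdef]; abel
    rw [e]
    linarith [norm_sub_le ((X τ' (t - τ') - X τ (t - τ')) + (X τ (t - τ') - X τ (t - τ)))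
      (ψ (-τ') - ψ (-τ)), norm_add_le (X τ' (t - τ') - X τ (t - τ')) (X τ (t - τ') - X τ (t - τ))]
  -- the augmented delay equation
  let H : V × V → V × V := fun q => (-f q.1, -(fderiv ℝ f q.1 q.2))
  have hH : ContDiff ℝ 1 H := by
    have h1 : ContDiff ℝ 1 (fderiv ℝ f) := hf.fderiv_right (by norm_num)
    exact ((hf.of_le one_le_two).comp contDiff_fst).neg.prodMk
      ((h1.comp contDiff_fst).clm_apply contDiff_snd).neg
  let L : V →L[ℝ] V × V := (ContinuousLinearMap.inr ℝ V V).comp (-A)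
  have hDf : ∀ v, fderiv ℝ (fun v => -f v) v = -fderiv ℝ f v := fun v => fderiv_fun_neg
  have hr : Continuous r := hX.cont_R 0 ⟨le_rfl, hb.le⟩
  have hDfc := hf.continuous_fderiv two_ne_zero
  have hfam : IsDelayFamily b T (A.prodMap A) H (fun t => (ψ t, 0))
      (fun τ t => (r t, 0) + L (S τ t)) (fun τ t => (X τ t, Y τ t)) := by
    refine ⟨fun τ hτ => (hX.cont τ hτ).prodMk (hYc τ hτ), fun τ hτ => ?_, fun τ hτ t ht => ?_,
      ⟨max M N, fun τ hτ t => max_le_max (hM τ hτ t) (hN τ hτ t)⟩, ?_, fun τ hτ t ht => ?_⟩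
    · have := hSc τ hτ
      fun_prop
    · rw [hX.hist τ hτ t ht, hY.hist τ hτ t ht]
    · refine ⟨‖L‖ * (C + B + B), by positivity, fun τ hτ τ' hτ' t ht => ?_⟩
      rw [add_sub_add_left_eq_sub, ← map_sub, mul_assoc]
      exact L.le_opNorm_of_le (hSlip τ hτ τ' hτ' t ht)
    · have hXc := hX.cont τ hτ
      have hYcτ := hYc τ hτ
      have hi : IntervalIntegrable (fun s => H (X τ s, Y τ s) +
          (A.prodMap A) (X τ (s - τ), Y τ (s - τ))) volume 0 t := by
        have := hH.continuous
        exact Continuous.intervalIntegrable (by fun_prop) _ _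
      refine Prod.ext ?_ ?_
      · rw [Prod.fst_add, ← ContinuousLinearMap.coe_fst' (R := ℝ) (M₁ := V) (M₂ := V),
          ← ContinuousLinearMap.intervalIntegral_comp_comm _ hi]
        simp only [ContinuousLinearMap.coe_fst', Prod.fst_add, L, H]
        simpa using hX.eq τ hτ t ht
      · rw [Prod.snd_add, ← ContinuousLinearMap.coe_snd' (R := ℝ) (M₁ := V) (M₂ := V),
          ← ContinuousLinearMap.intervalIntegral_comp_comm _ hi]
        simp only [ContinuousLinearMap.coe_snd', Prod.snd_add, L, H]
        rcases eq_or_lt_of_le ht.1 with h0 | h0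
        · rw [← h0, intervalIntegral.integral_same]
          simp [hSdef, hY.hist τ hτ 0 le_rfl, hX.hist τ hτ (-τ) (by linarith [hτ.1])]
        · have := hY.eq τ hτ t ⟨h0, ht.2⟩
          simp only [hDf] at this
          simpa [hSdef] using this
  have hRm : ∀ τ ∈ Icc 0 b, StronglyMeasurable (fun t => L (S' τ t)) := fun τ hτ =>
    L.continuous.comp_stronglyMeasurable (hS'm τ hτ)
  have hRB : ∀ τ ∈ Icc 0 b, ∀ t, ‖L (S' τ t)‖ ≤ ‖L‖ * (N + B + Bp) := fun τ hτ t =>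
    L.le_opNorm_of_le (hS'B τ hτ t)
  obtain ⟨Z, hZ, -⟩ := hfam.exists_variation (R' := fun τ t => L (S' τ t)) hT hH hRm hRB
  have hSi : ∀ τ ∈ Icc 0 b, IntervalIntegrable (S τ) volume 0 T := fun τ hτ =>
    (hSc τ hτ).intervalIntegrable _ _
  have hS'i : ∀ τ ∈ Icc 0 b, IntervalIntegrable (S' τ) volume 0 T := fun τ hτ =>
    intervalIntegrable_of_measurable_of_bounded (hS'm τ hτ) (hS'B τ hτ) _ _
  have hR : HasL1Deriv b T (fun τ t => (r t, 0) + L (S τ t)) (fun τ t => L (S' τ t)) := by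
    have := hS.clm_comp L hT.le hSi hS'i
    intro τ hτ ε hε
    simpa only [add_sub_add_left_eq_sub] using this τ hτ ε hε
  have hRZ := fun τ (hτ : τ ∈ Icc 0 b) =>
    (⟨hRm τ hτ, _, hRB τ hτ⟩ : StronglyMeasurable (fun t => L (S' τ t)) ∧
      ∃ M, ∀ t, ‖L (S' τ t)‖ ≤ M)
  exact ⟨H, _, _, _, Z, hH, hfam, hZ, hfam.hasL1Deriv hZ hT.le hH hR hRZ,
    hZ.isL1Continuous hfam hT.le hH (by fun_prop) (hS'.clm_comp L hT.le hS'i) hRZ⟩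

end

/-! ### Optimality conditions on a compact interval -/

theorem nonneg_derivWithin_mul_of_isMinOn {b τ₀ : ℝ} {j : ℝ → ℝ}
    (hj : DifferentiableOn ℝ j (Icc 0 b)) (hτ₀ : τ₀ ∈ Icc 0 b) (hmin : IsMinOn j (Icc 0 b) τ₀) :
    ∀ τ ∈ Icc 0 b, 0 ≤ derivWithin j (Icc 0 b) τ₀ * (τ - τ₀) := fun τ hτ => by
  have h1 := (hj τ₀ hτ₀).hasDerivWithinAt.hasFDerivWithinAt
  have h2 := hmin.localize.hasFDerivWithinAt_nonneg h1
    (sub_mem_posTangentConeAt_of_segment_subset ((convex_Icc 0 b).segment_subset hτ₀ hτ))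
  simpa [mul_comm] using h2

theorem isStrictLocalMinimizerOn_of_deriv_deriv_pos {b τ₀ : ℝ} {j : ℝ → ℝ}
    (hj : DifferentiableOn ℝ j (Icc 0 b)) (h0 : 0 < τ₀) (hb : τ₀ < b)
    (h1 : derivOn b j τ₀ = 0) (h2 : 0 < derivOn b (derivOn b j) τ₀) :
    IsStrictLocalMinimizerOn b j τ₀ := by
  have hnhds : ∀ x ∈ Ioo 0 b, Icc 0 b ∈ 𝓝 x := fun x hx => Icc_mem_nhds hx.1 hx.2
  have hderiv : ∀ x ∈ Ioo 0 b, deriv j x = derivOn b j x := fun x hx =>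
    (derivWithin_of_mem_nhds (hnhds x hx)).symm
  have hd : DifferentiableWithinAt ℝ (derivOn b j) (Icc 0 b) τ₀ := by
    by_contra h
    exact h2.ne' (derivWithin_zero_of_not_differentiableWithinAt h)
  have hs := hasDerivAt_iff_tendsto_slope.1
    (hd.hasDerivWithinAt.hasDerivAt (hnhds τ₀ ⟨h0, hb⟩))
  obtain ⟨ε, hε, hball⟩ := Metric.mem_nhdsWithin_iff.1 (hs.eventually (lt_mem_nhds h2))
  have hpos : ∀ x, |x - τ₀| < ε → x ≠ τ₀ → 0 < (x - τ₀)⁻¹ * derivOn b j x := fun x hx hne => by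
    have : 0 < slope (derivOn b j) τ₀ x := hball ⟨by rwa [Metric.mem_ball, Real.dist_eq], hne⟩
    simpa [slope_def_field, h1, div_eq_inv_mul] using this
  refine ⟨⟨h0.le, hb.le⟩, ε, hε, fun τ hτ hne habs => ?_⟩
  have hsub : ∀ x ∈ Icc (min τ τ₀) (max τ τ₀), x ∈ Icc 0 b := fun x hx =>
    ⟨(le_min hτ.1 h0.le).trans hx.1, hx.2.trans (max_le hτ.2 hb.le)⟩
  rcases lt_or_gt_of_ne hne with h | h
  · rw [min_eq_left h.le, max_eq_right h.le] at hsub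
    refine strictAntiOn_of_deriv_neg (convex_Icc τ τ₀) (hj.continuousOn.mono hsub) (fun x hx => ?_)
      (left_mem_Icc.2 h.le) (right_mem_Icc.2 h.le) h
    rw [interior_Icc] at hx
    rw [hderiv x ⟨hτ.1.trans_lt hx.1, hx.2.trans hb⟩]
    have h3 := hpos x (by
      rw [abs_of_neg (by linarith [hx.2])]; rw [abs_of_neg (by linarith)] at habs
      linarith [hx.1]) hx.2.ne
    exact neg_of_mul_pos_right h3 (inv_nonpos.2 (by linarith [hx.2]))
  · rw [min_eq_right h.le, max_eq_left h.le] at hsub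
    refine strictMonoOn_of_deriv_pos (convex_Icc τ₀ τ) (hj.continuousOn.mono hsub) (fun x hx => ?_)
      (left_mem_Icc.2 h.le) (right_mem_Icc.2 h.le) h
    rw [interior_Icc] at hx
    rw [hderiv x ⟨h0.trans hx.1, hx.2.trans_le hτ.2⟩]
    have h3 := hpos x (by
      rw [abs_of_pos (by linarith [hx.1])]; rw [abs_of_pos (by linarith)] at habs
      linarith [hx.2]) hx.1.ne'
    exact pos_of_mul_pos_right h3 (inv_nonneg.2 (by linarith [hx.1]))

/-- At an end point, a strict sign of the one-sided derivative makes the point a strict local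
minimizer. -/
theorem isStrictLocalMinimizerOn_of_derivOn_mul_pos {b τ₀ : ℝ} {j : ℝ → ℝ}
    (hj : DifferentiableOn ℝ j (Icc 0 b)) (hτ₀ : τ₀ ∈ Icc 0 b)
    (h : ∀ τ ∈ Icc 0 b, τ ≠ τ₀ → 0 < derivOn b j τ₀ * (τ - τ₀)) :
    IsStrictLocalMinimizerOn b j τ₀ := by
  have hs := hasDerivWithinAt_iff_tendsto_slope.1 (hj τ₀ hτ₀).hasDerivWithinAt
  by_cases hd : derivOn b j τ₀ = 0
  · refine ⟨hτ₀, 1, one_pos, fun τ hτ hne _ => ?_⟩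
    have := h τ hτ hne
    rw [hd, zero_mul] at this
    exact absurd this (lt_irrefl _)
  have hev := hs.eventually ((tendsto_id (x := 𝓝 (derivOn b j τ₀))).const_mul
    (derivOn b j τ₀) |>.eventually (lt_mem_nhds (mul_self_pos.2 hd)))
  obtain ⟨ε, hε, hball⟩ := Metric.mem_nhdsWithin_iff.1 hev
  refine ⟨hτ₀, ε, hε, fun τ hτ hne habs => ?_⟩
  have h1 : 0 < derivOn b j τ₀ * slope j τ₀ τ :=
    hball ⟨by rwa [Metric.mem_ball, Real.dist_eq], hτ, hne⟩
  have h2 := h τ hτ hne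
  have h3 := mul_pos h1 h2
  have hne' : τ - τ₀ ≠ 0 := sub_ne_zero.2 hne
  have e : derivOn b j τ₀ * slope j τ₀ τ * (derivOn b j τ₀ * (τ - τ₀)) =
      derivOn b j τ₀ ^ 2 * (j τ - j τ₀) := by
    rw [slope_def_field]; field_simp
  rw [e] at h3
  have := pos_of_mul_pos_right h3 (sq_nonneg _)
  linarith

theorem theorem4p4 {n : ℕ} (b T : ℝ) (hb : 0 < b) (hT : 0 < T)
    (f : EuclideanSpace ℝ (Fin n) → EuclideanSpace ℝ (Fin n)) (A : Matrix (Fin n) (Fin n) ℝ)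
    (g φ xd : ℝ → EuclideanSpace ℝ (Fin n)) (hxd : IsL2 0 T xd)
    (hA : StandingAssumption b T f g φ) :
    -- the state `x[τ]` is well defined: the delay equation is uniquely solvable
    (∀ τ ∈ Icc 0 b, IsDelaySolution b T f A g φ τ (delayState b T f A g φ τ) ∧
      ∀ y, IsDelaySolution b T f A g φ τ y →
        EqOn y (delayState b T f A g φ τ) (Icc (-b) T)) ∧
    -- the cost is continuously differentiable
    ContDiffOn ℝ 1 (delayCost b T f A g φ xd) (Icc 0 b) ∧
    -- existence of a solution of the delay optimization problem
    (∃ τbar ∈ Icc 0 b, IsMinOn (delayCost b T f A g φ xd) (Icc 0 b) τbar) ∧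
    -- first-order necessary condition
    (∀ τbar ∈ Icc 0 b, IsMinOn (delayCost b T f A g φ xd) (Icc 0 b) τbar →
      ∀ τ ∈ Icc 0 b, 0 ≤ derivOn b (delayCost b T f A g φ xd) τbar * (τ - τbar)) ∧
    -- sufficient conditions under additional regularity
    (RegularityAssumption b T f g φ →
      ContDiffOn ℝ 2 (delayCost b T f A g φ xd) (Icc 0 b) ∧
      (∀ τhat : ℝ, 0 < τhat → τhat < b →
        derivOn b (delayCost b T f A g φ xd) τhat = 0 →
        0 < derivOn b (derivOn b (delayCost b T f A g φ xd)) τhat →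
        IsStrictLocalMinimizerOn b (delayCost b T f A g φ xd) τhat) ∧
      (0 < derivOn b (delayCost b T f A g φ xd) 0 →
        IsStrictLocalMinimizerOn b (delayCost b T f A g φ xd) 0) ∧
      (derivOn b (delayCost b T f A g φ xd) b < 0 →
        IsStrictLocalMinimizerOn b (delayCost b T f A g φ xd) b)) := by
  obtain ⟨X, hX, hsol⟩ := hA.exists_states (A := A) hb hT
  set A' := (Matrix.toEuclideanLin A).toContinuousLinearMap with hA'
  set j := delayCost b T f A g φ xd with hj
  set ξ : ℝ → EuclideanSpace ℝ (Fin n) →L[ℝ] ℝ := fun t => -innerSL ℝ (xd t) with hξdef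
  have hξ : MemLp ξ 2 (volume.restrict (Ioc 0 T)) := hxd.memLp_innerSL
  have hf1 : ContDiff ℝ 1 (fun v => -f v) := hA.contDiff_f.neg
  have hψc := continuous_historyExt hb.le hA.φ_cont
  -- the derivative of the state
  obtain ⟨Y, hY, hYc⟩ := hX.exists_variation (R' := fun _ _ => 0) hT hf1
    (fun _ _ => stronglyMeasurable_const) (M' := 0) fun _ _ _ => by simp
  replace hYc : ∀ τ ∈ Icc 0 b, Continuous (Y τ) := fun τ hτ => hYc τ hτ rfl
  obtain ⟨M, hM⟩ := hX.bdd
  obtain ⟨N, hN⟩ := hY.bdd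
  obtain ⟨C, hC0, hC⟩ := hX.exists_lipschitz hf1
  have hR0 : ∀ τ ∈ Icc 0 b, StronglyMeasurable (fun _ : ℝ => (0 : EuclideanSpace ℝ (Fin n))) ∧
      ∃ M, ∀ _ : ℝ, ‖(0 : EuclideanSpace ℝ (Fin n))‖ ≤ M :=
    fun _ _ => ⟨stronglyMeasurable_const, 0, fun _ => by simp⟩
  obtain ⟨hd, hdc⟩ := hasDerivWithinAt_integral_of_hasL1Deriv hT.le
    (fun τ hτ => (hX.cont τ hτ).stronglyMeasurable) hY.meas hM hN hC0 hC
    (hX.hasL1Deriv hY hT.le hf1 (hasL1Deriv_const _) hR0)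
    (hY.isL1Continuous hX hT.le hf1 hψc (isL1Continuous_const _) hR0)
    (P := fun v => (1 / 2 : ℝ) * ‖v‖ ^ 2) (contDiff_const.mul (contDiff_norm_sq ℝ)) hξ
  have hP : ∀ v : EuclideanSpace ℝ (Fin n),
      fderiv ℝ (fun v => (1 / 2 : ℝ) * ‖v‖ ^ 2) v = innerSL ℝ v := fun v => by
    rw [((hasStrictFDerivAt_norm_sq v).hasFDerivAt.const_mul (1 / 2 : ℝ)).fderiv]
    ext w; simp
  simp only [hP, innerSL_apply_apply] at hd hdc
  set j' : ℝ → ℝ := fun τ => ∫ t in (0 : ℝ)..T, (inner ℝ (X τ t) (Y τ t) + ξ t (Y τ t)) with hj'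
  have hcost : ∀ τ ∈ Icc 0 b, j τ = (∫ t in (0 : ℝ)..T, ((1 / 2 : ℝ) * ‖X τ t‖ ^ 2 +
      ξ t (X τ t))) + (1 / 2 : ℝ) * ∫ t in Ioo 0 T, ‖xd t‖ ^ 2 := fun τ hτ =>
    delayCost_eq hxd hT.le (hX.cont τ hτ) fun t ht =>
      (hsol τ hτ).2 _ (hsol τ hτ).1 ⟨by linarith [ht.1], ht.2⟩
  have hjd : ∀ τ ∈ Icc 0 b, HasDerivWithinAt j (j' τ) (Icc 0 b) τ := fun τ hτ =>
    ((hd τ hτ).add_const _).congr hcost (hcost τ hτ)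
  have hjdiff : DifferentiableOn ℝ j (Icc 0 b) := fun τ hτ => (hjd τ hτ).differentiableWithinAt
  refine ⟨fun τ hτ => ⟨(hsol τ hτ).1, fun y hy t ht => ?_⟩,
    contDiffOn_one_of_hasDerivWithinAt hb hjd hdc,
    isCompact_Icc.exists_isMinOn ⟨0, le_rfl, hb.le⟩ hjdiff.continuousOn,
    fun τ₀ hτ₀ hmin => nonneg_derivWithin_mul_of_isMinOn hjdiff hτ₀ hmin,
    fun hreg => ⟨?_, fun τ₀ h0 hb' h1 h2 =>
      isStrictLocalMinimizerOn_of_deriv_deriv_pos hjdiff h0 hb' h1 h2, fun h => ?_, fun h => ?_⟩⟩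
  · rw [(hsol τ hτ).2 y hy ht, (hsol τ hτ).2 _ (hsol τ hτ).1 ht]
  · obtain ⟨p, hp, hpB, hφp⟩ := hreg.φ_mem.exists_continuous_deriv (by linarith) hA.φ_cont
    obtain ⟨γ, hγ, hγB, hgγ⟩ := hreg.g_mem.exists_continuous_ae_eq hT
    obtain ⟨H, ψ₂, R, R', Z, hH, hU, hZ, hUZ, hZc⟩ := hX.exists_second_variation hb hT
      hreg.contDiff_f hY hYc hψc hp hpB hγ hγB
      (fun t ht => by
        rw [historyExt_of_mem ht, historyExt_of_mem ⟨by linarith, le_rfl⟩, hφp t ht,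
          hφp 0 ⟨by linarith, le_rfl⟩, add_assoc, intervalIntegral.integral_add_adjacent_intervals
            (hp.intervalIntegrable _ _) (hp.intervalIntegrable _ _)])
      (fun t ht => by
        congr 1
        refine intervalIntegral.integral_congr_ae ?_
        filter_upwards [hgγ, compl_mem_ae_iff.2 (measure_singleton (μ := volume) T)]
          with s hs hsT hst
        rw [uIoc_of_le ht.1] at hst
        have hs' : s ∈ Ioo 0 T := ⟨hst.1, lt_of_le_of_ne (hst.2.trans ht.2) hsT⟩
        rw [indicator_of_mem hs', hs hs'])
    obtain ⟨M₂, hM₂⟩ := hU.bdd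
    obtain ⟨N₂, hN₂⟩ := hZ.bdd
    obtain ⟨C₂, hC₂0, hC₂⟩ := hU.exists_lipschitz hH
    have hξ₂ : MemLp (fun t => (ξ t).comp
        (ContinuousLinearMap.snd ℝ (EuclideanSpace ℝ (Fin n)) (EuclideanSpace ℝ (Fin n)))) 2
        (volume.restrict (Ioc 0 T)) := by
      refine hξ.of_le_mul (c := ‖ContinuousLinearMap.snd ℝ (EuclideanSpace ℝ (Fin n))
        (EuclideanSpace ℝ (Fin n))‖) ?_ (Eventually.of_forall fun t => ?_)
      · exact (ContinuousLinearMap.precomp ℝ (ContinuousLinearMap.snd ℝ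
          (EuclideanSpace ℝ (Fin n)) (EuclideanSpace ℝ (Fin n)))).continuous.comp_aestronglyMeasurable
          hξ.aestronglyMeasurable
      · rw [mul_comm]; exact ContinuousLinearMap.opNorm_comp_le _ _
    obtain ⟨hd₂, hdc₂⟩ := hasDerivWithinAt_integral_of_hasL1Deriv hT.le
      (fun τ hτ => (hU.cont τ hτ).stronglyMeasurable) hZ.meas hM₂ hN₂ hC₂0 hC₂ hUZ hZc
      (P := fun q => inner ℝ q.1 q.2) (contDiff_fst.inner ℝ contDiff_snd) hξ₂
    have hj'1 : ContDiffOn ℝ 1 j' (Icc 0 b) := contDiffOn_one_of_hasDerivWithinAt hb hd₂ hdc₂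
    have hu := uniqueDiffOn_Icc hb
    rw [show (2 : WithTop ℕ∞) = 1 + 1 by norm_num, contDiffOn_succ_iff_derivWithin hu]
    exact ⟨hjdiff, by simp, hj'1.congr fun τ hτ => (hjd τ hτ).derivWithin (hu τ hτ)⟩
  · refine isStrictLocalMinimizerOn_of_derivOn_mul_pos hjdiff ⟨le_rfl, hb.le⟩ fun τ hτ hne => ?_
    exact mul_pos h (by rw [sub_zero]; exact lt_of_le_of_ne hτ.1 hne.symm)
  · refine isStrictLocalMinimizerOn_of_derivOn_mul_pos hjdiff ⟨hb.le, le_rfl⟩ fun τ hτ hne => ?_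
    exact mul_pos_of_neg_of_neg h (sub_neg.2 (lt_of_le_of_ne hτ.2 hne))
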